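/- Let $p>2$, $\frac1p+\frac1q=1$, let $I=[\alpha,\beta]$ with $\alpha<\beta$, and let $\langle h\rangle_I=|I|^{-1}\int_I h$. For $x\in\mathbb R^4$ put $$\mathbb B_{c,+}(x)=\sup\{\langle fg\rangle_I : f\in L^p(I),\ g\in L^q(I)\text{ real-valued},\ \langle f\rangle_I=x_1,\ \langle g\rangle_I=x_2,\ \langle|f|^p\rangle_I=x_3,\ \langle|g|^q\rangle_I=x_4\}$$ (with $\sup\emptyset=-\infty$), and $\Omega_c=\{x\in\mathbb R^4: x_3\ge|x_1|^p,\ x_4\ge|x_2|^q\}$. A linearity domain (extremal) of $\mathbb B_{c,+}$ is a maximal convex subset of $\Omega_c$ on which $\mathbb B_{c,+}$ coincides with an affine function; its dimension is that of its affine hull. Let $\varphi(R)=R|R|^{p-2}$, $\lambda(R)=\frac1{1+R}-\frac{p-1}{1+\varphi(R)}$ for $R\neq-1$, and $\lambda(-1)=-\frac{p-2}2$. There is a unique $R_0\in(0,1)$ with $$R_0^{\frac{p-1}2}+R_0^{-\frac{p-1}2}=(p-1)\bigl(R_0^{\frac12}+R_0^{-\frac12}\bigr),$$ and there is a function $\rho:[-1,1]\to[R_0,1]$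 with $\lambda(\rho(R))=\lambda(R)$ for $R\in[-1,R_0]$ and $\rho(R)=R$ for $R\in[R_0,1]$. For every such $\rho$, put $$\eta(\tau,R)=\left(\frac{-\tau+(1-\tau)\rho(R)}{(\tau+(1-\tau)\rho(R)^p)^{1/p}},\ \frac{-\tau+(1-\tau)\varphi(R)}{(\tau+(1-\tau)|R|^p)^{1/q}}\right),$$ and let $T(x)=(x_1x_3^{-1/p},x_2x_4^{-1/q})$ on the set of $x\in\Omega_c$ with neither $x_1=x_3=0$ nor $x_2=x_4=0$. For $t>0$ let $\gamma_t=\{(u,\,pt\varphi(u),\,|u|^p,\,|u|^p(pt)^q):u\in\mathbb R\}$. For $a_1a_2>0$ let $\ell(a_1,a_2,R)$ be the closed segment with the endpoints $$(a_1,a_2,|a_1|^p,|a_2|^q)\quad\text{and}\quad(-\rho(R)a_1,\,-\varphi(R)a_2,\,|\rho(R)a_1|^p,\,|R|^p|a_2|^q).$$ Then: 1. Each point of the interior of $\Omega_c$ lies in exactly one linearity domain of $\mathbb B_{c,+}$, and each linearity domain that meets the interior of $\Omega_c$ has dimension one or three. 2. The three-dimensional linearity domains that meet the interior of $\Omega_c$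 are exactly the convex hulls $\operatorname{conv}\gamma_t$, $t>0$, and distinct $t$ give distinct hulls. For each $t>0$ one has $\mathbb B_{c,+}(x)=x_3^{1/p}x_4^{1/q}$ on $\operatorname{conv}\gamma_t$, and the $T$-image of $\operatorname{conv}\gamma_t$ (intersected with the domain of $T$) is the closed region in the plane bounded by the curve $\eta_-=\{\eta(\tau,R_0):\tau\in[0,1]\}$ and its symmetric image $\eta_+=-\eta_-$. 3. The one-dimensional linearity domains that meet the interior of $\Omega_c$ are exactly the chords $\ell(a_1,a_2,R)$ with $a_1a_2>0$ and $R\in(-1,R_0)$. The set of points of the interior of $\Omega_c$ that lie in no $\operatorname{conv}\gamma_t$, $t>0$, is the union of these chords without their endpoints. The $T$-image of such a chord without its endpoints is the curve $\{\eta(\tau,R):\tau\in(0,1)\}$ if $a_1,a_2<0$, and its symmetric image $\{-\eta(\tau,R):\tau\in(0,1)\}$ if $a_1,a_2>0$. -/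

import Mathlib

open Set MeasureTheory

/-- The Bellman function `B_{c,+}` on the interval `[α, β]`, as an extended real number
(the supremum of the empty set is `-∞`). The point `x` has coordinates
`x 0, x 1, x 2, x 3`, written `x₁, x₂, x₃, x₄` in the usual notation. -/
noncomputable def bellmanC (α β p q : ℝ) (x : Fin 4 → ℝ) : EReal :=
  sSup {v : EReal | ∃ f g : ℝ → ℝ,
    MemLp f (ENNReal.ofReal p) (volume.restrict (Icc α β)) ∧
    MemLp g (ENNReal.ofReal q) (volume.restrict (Icc α β)) ∧
    (⨍ s in Icc α β, f s) = x 0 ∧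
    (⨍ s in Icc α β, g s) = x 1 ∧
    (⨍ s in Icc α β, |f s| ^ p) = x 2 ∧
    (⨍ s in Icc α β, |g s| ^ q) = x 3 ∧
    v = ((⨍ s in Icc α β, f s * g s : ℝ) : EReal)}

/-- The natural domain `Ω_c` of `B_{c,+}`. -/
def omegaC (p q : ℝ) : Set (Fin 4 → ℝ) :=
  {x | |x 0| ^ p ≤ x 2 ∧ |x 1| ^ q ≤ x 3}

/-- `C` is a linearity domain (extremal) of a function `B` on `Ω`: a convex subset of `Ω` on which
`B` coincides with a (finite) affine function, and which is maximal with this property. -/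
def IsLinearityDomain (Ω : Set (Fin 4 → ℝ)) (B : (Fin 4 → ℝ) → EReal)
    (C : Set (Fin 4 → ℝ)) : Prop :=
  Maximal (fun D : Set (Fin 4 → ℝ) => D ⊆ Ω ∧ Convex ℝ D ∧
    ∃ L : (Fin 4 → ℝ) →ᵃ[ℝ] ℝ, ∀ x ∈ D, B x = ((L x : ℝ) : EReal)) C

/-- The linearity domains of `B_{c,+}` that meet the interior of `Ω_c`. -/
def IsInnerLinearityDomain (α β p q : ℝ) (C : Set (Fin 4 → ℝ)) : Prop :=
  IsLinearityDomain (omegaC p q) (bellmanC α β p q) C ∧ (C ∩ interior (omegaC p q)).Nonempty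

/-- The dimension of a convex set: the dimension of its affine hull. -/
noncomputable def affineDim (C : Set (Fin 4 → ℝ)) : ℕ :=
  Module.finrank ℝ (vectorSpan ℝ C)

/-- `φ(R) = R |R|^{p-2}`. -/
noncomputable def phiFun (p R : ℝ) : ℝ := R * |R| ^ (p - 2)

/-- The function `λ`. -/
noncomputable def lambdaFun (p R : ℝ) : ℝ :=
  if R = -1 then -((p - 2) / 2) else 1 / (1 + R) - (p - 1) / (1 + phiFun p R)

/-- The equation that determines the number `R₀ ∈ (0, 1)`. -/
def IsCriticalR (p R₀ : ℝ) : Prop :=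
  R₀ ∈ Ioo (0 : ℝ) 1 ∧
    R₀ ^ ((p - 1) / 2) + R₀ ^ (-((p - 1) / 2)) =
      (p - 1) * (R₀ ^ ((1 : ℝ) / 2) + R₀ ^ (-((1 : ℝ) / 2)))

/-- The conditions that determine the function `ρ : [-1, 1] → [R₀, 1]`. -/
def IsRho (p R₀ : ℝ) (ρ : ℝ → ℝ) : Prop :=
  (∀ R ∈ Icc (-1 : ℝ) 1, ρ R ∈ Icc R₀ 1) ∧
  (∀ R ∈ Icc (-1 : ℝ) R₀, lambdaFun p (ρ R) = lambdaFun p R) ∧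
  (∀ R ∈ Icc R₀ 1, ρ R = R)

/-- The point of the skeleton of `Ω_c` over `(u, v)`. -/
noncomputable def skelPoint (p q u v : ℝ) : Fin 4 → ℝ :=
  ![u, v, |u| ^ p, |v| ^ q]

/-- The endpoint `b` of the chord `ℓ_c(a₁, a₂, R)`; the other one is `skelPoint p q a₁ a₂`. -/
noncomputable def chordEnd (p : ℝ) (q : ℝ) (ρ : ℝ → ℝ) (a₁ a₂ R : ℝ) : Fin 4 → ℝ :=
  ![-(ρ R * a₁), -(phiFun p R * a₂), |ρ R * a₁| ^ p, |R| ^ p * |a₂| ^ q]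

/-- The curve `γ_t`. -/
noncomputable def gammaCurve (p q t : ℝ) : Set (Fin 4 → ℝ) :=
  range fun u : ℝ => ![u, p * t * phiFun p u, |u| ^ p, |u| ^ p * (p * t) ^ q]

/-- The domain of the mapping `T`. -/
def domT (p q : ℝ) : Set (Fin 4 → ℝ) :=
  omegaC p q \ ({x | x 0 = 0 ∧ x 2 = 0} ∪ {x | x 1 = 0 ∧ x 3 = 0})

/-- The mapping `T`; only its values on `domT p q` matter. -/
noncomputable def mapT (p q : ℝ) (x : Fin 4 → ℝ) : ℝ × ℝ :=
  (x 0 * x 2 ^ (-(1 / p)), x 1 * x 3 ^ (-(1 / q)))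

/-- The function `η`. -/
noncomputable def etaFun (p q : ℝ) (ρ : ℝ → ℝ) (τ R : ℝ) : ℝ × ℝ :=
  ((-τ + (1 - τ) * ρ R) / (τ + (1 - τ) * ρ R ^ p) ^ (1 / p),
   (-τ + (1 - τ) * phiFun p R) / (τ + (1 - τ) * |R| ^ p) ^ (1 / q))

/-- The closed curve formed by `η_- = η(·, R₀)` and `η_+ = -η_-`. -/
noncomputable def etaLoop (p q R₀ : ℝ) (ρ : ℝ → ℝ) : Set (ℝ × ℝ) :=
  (fun τ => etaFun p q ρ τ R₀) '' Icc 0 1 ∪ (fun τ => -etaFun p q ρ τ R₀) '' Icc 0 1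

/-- The closed region bounded by `Γ` in the plane: the union of `Γ` and of the bounded connected
components of its complement (`connectedComponentIn Γᶜ y` is empty for `y ∈ Γ`). -/
def regionBoundedBy (Γ : Set (ℝ × ℝ)) : Set (ℝ × ℝ) :=
  {y | Bornology.IsBounded (connectedComponentIn Γᶜ y)}

/-! ### The function `φ` and powers of the absolute value -/

/-! The proof is a duality between test functions and affine majorants. Call an affine function a
majorant if it dominates `u * v` at every skeleton point `(u, v, |u|^p, |v|^q)`. Integrating this
inequality bounds the Bellman function by the majorant (`bellmanC_le`). Step functions show that the
bound is attained on the convex hull of the contact set, where the majorant equals `u * v`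
(`bellmanC_eq_of_mem_convexHull`). The theorem thus becomes a classification of the majorants that
are optimal at interior points; these exist by compactness (`exists_optimal_majorant`).

Minimizing over `v` by Young's inequality reduces a majorant to the one-variable condition `c + m 0
* u + m 2 * |u|^p - κ/p * |u - m 1|^p ≥ 0`, where `κ` encodes `m 3`. Growth at infinity gives `κ ≤ m
2 * p`. In the case of equality the optimal majorant is a Young majorant, with contact set `γ_t`. In
the strict case the majorant is coercive and the gap is convex, concave, convex, so it has at most
two zeros. Fewer than two cannot be optimal, because a coercive majorant can be improved off the
hull of its contact set. If there are two, the values and derivatives at them combine, through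
Taylor remainders of `|u|^p`, into `λ(r) = λ(R)`, hence `r = ρ(R)`, and the contact set is the pair
of endpoints of a chord (`exists_chord_of_two_zeros`). The same equations, solved for the
coefficients, produce a majorant for every chord (`exists_majorant_of_chord`).

The hulls of the `γ_t` need separate treatment, since the Young majorants are not coercive. Each
hull is invariant under weighted dilations, so it is determined by a plane section. A functional
that touches `(u, φ(u), |u|^p)` exactly at `-1` and `R₀` (`exists_critical_functional`), its dilates
and their reflections bound this section by the two curves `η(·, R₀)` and `-η(·, R₀)`. Outside the
hull an explicit perturbation improves the Young majorant (`exists_better_majorant_of_notMem_hull`).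

Finally, two majorants with two common contact points coincide, so the optimal majorant at an
interior point is unique (`IsMajorant.eq_of_optimal`). Hence every convex set on which the Bellman
function is affine, and which meets the hull of a contact set at an interior point, is governed by
that one majorant and lies in that hull (`subset_hull_of_affine`). -/

theorem phiFun_zero (r : ℝ) : phiFun r 0 = 0 := by simp [phiFun]

theorem phiFun_one (r : ℝ) : phiFun r 1 = 1 := by simp [phiFun]

theorem phiFun_neg (r x : ℝ) : phiFun r (-x) = -phiFun r x := by simp [phiFun]

theorem phiFun_mul (r x y : ℝ) : phiFun r (x * y) = phiFun r x * phiFun r y := by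
  rw [phiFun, phiFun, phiFun, abs_mul, Real.mul_rpow (abs_nonneg x) (abs_nonneg y)]; ring

theorem phiFun_of_pos {r x : ℝ} (hx : 0 < x) : phiFun r x = x ^ (r - 1) := by
  rw [phiFun, abs_of_pos hx]
  nth_rewrite 1 [← Real.rpow_one x]
  rw [← Real.rpow_add hx]; ring_nf

theorem phiFun_of_nonneg {r x : ℝ} (hr : 1 < r) (hx : 0 ≤ x) : phiFun r x = x ^ (r - 1) := by
  rcases hx.eq_or_lt with h | h
  · rw [← h, phiFun_zero, Real.zero_rpow (by linarith)]
  · exact phiFun_of_pos h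

theorem phiFun_pos {r x : ℝ} (hx : 0 < x) : 0 < phiFun r x := by
  rw [phiFun_of_pos hx]; positivity

theorem phiFun_neg_of_neg {r x : ℝ} (hx : x < 0) : phiFun r x < 0 := by
  have := phiFun_pos (r := r) (neg_pos.2 hx)
  rw [phiFun_neg] at this; linarith

theorem mul_phiFun {r : ℝ} (hr : r ≠ 0) (x : ℝ) : x * phiFun r x = |x| ^ r := by
  rcases eq_or_ne x 0 with h | h
  · simp [h, Real.zero_rpow hr]
  · have h' : 0 < |x| := abs_pos.2 h
    rw [phiFun, ← mul_assoc, ← abs_mul_abs_self x]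
    nth_rewrite 1 2 [← Real.rpow_one |x|]
    rw [← Real.rpow_add h', ← Real.rpow_add h']; ring_nf

theorem phiFun_strictMono {r : ℝ} (hr : 1 < r) : StrictMono (phiFun r) := by
  intro x y hxy
  have key : ∀ x y : ℝ, 0 ≤ x → x < y → phiFun r x < phiFun r y := by
    intro x y hx hxy
    rw [phiFun_of_nonneg hr hx, phiFun_of_nonneg hr (hx.trans hxy.le)]
    exact Real.rpow_lt_rpow hx hxy (by linarith)
  rcases le_or_gt 0 x with hx | hx
  · exact key x y hx hxy
  · rcases le_or_gt y 0 with hy | hy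
    · have := key (-y) (-x) (by linarith) (by linarith)
      rw [phiFun_neg, phiFun_neg] at this; linarith
    · exact (phiFun_neg_of_neg hx).trans (phiFun_pos hy)

theorem hasDerivAt_abs_rpow_phiFun {r : ℝ} (hr : 1 < r) (x : ℝ) :
    HasDerivAt (fun x : ℝ => |x| ^ r) (r * phiFun r x) x := by
  convert hasDerivAt_abs_rpow x hr using 1
  rw [phiFun]; ring

theorem continuous_abs_rpow {r : ℝ} (hr : 0 ≤ r) : Continuous fun x : ℝ => |x| ^ r :=
  continuous_abs.rpow_const fun _ => Or.inr hr

theorem strictConvexOn_abs_rpow {r : ℝ} (hr : 1 < r) :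
    StrictConvexOn ℝ univ fun x : ℝ => |x| ^ r := by
  apply StrictMono.strictConvexOn_univ_of_deriv (continuous_abs_rpow (by linarith))
  have : deriv (fun x : ℝ => |x| ^ r) = fun x => r * phiFun r x :=
    funext fun x => (hasDerivAt_abs_rpow_phiFun hr x).deriv
  rw [this]
  exact (phiFun_strictMono hr).const_mul (by linarith)

theorem abs_rpow_tangent_lt {r : ℝ} (hr : 1 < r) {x y : ℝ} (hxy : x ≠ y) :
    |x| ^ r + r * phiFun r x * (y - x) < |y| ^ r := by
  have hd := hasDerivAt_abs_rpow_phiFun hr x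
  have hs := strictConvexOn_abs_rpow hr
  rcases lt_or_gt_of_ne hxy with h | h
  · have := hs.lt_slope_of_hasDerivAt (mem_univ x) (mem_univ y) h hd
    rw [slope_def_field, lt_div_iff₀ (by linarith)] at this
    linarith
  · have := hs.slope_lt_of_hasDerivAt (mem_univ y) (mem_univ x) h hd
    rw [slope_def_field, div_lt_iff₀ (by linarith)] at this
    linarith

theorem abs_rpow_tangent_le {r : ℝ} (hr : 1 < r) (x y : ℝ) :
    |x| ^ r + r * phiFun r x * (y - x) ≤ |y| ^ r := by
  rcases eq_or_ne x y with h | h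
  · simp [h]
  · exact (abs_rpow_tangent_lt hr h).le

theorem abs_phiFun {r : ℝ} (hr : 1 < r) (x : ℝ) : |phiFun r x| = |x| ^ (r - 1) := by
  rcases le_total 0 x with h | h
  · rw [phiFun_of_nonneg hr h, abs_of_nonneg (Real.rpow_nonneg h _), abs_of_nonneg h]
  · have := phiFun_of_nonneg hr (neg_nonneg.2 h)
    rw [← abs_neg (phiFun r x), ← phiFun_neg, this,
      abs_of_nonneg (Real.rpow_nonneg (neg_nonneg.2 h) _), abs_of_nonpos h]

/-- Oddness reduces negative arguments to positive ones. At `0` the difference quotient is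
`|t|^(r-2)`, which tends to `0` because `r > 2`. -/
theorem hasDerivAt_phiFun {r : ℝ} (hr : 2 < r) (x : ℝ) :
    HasDerivAt (phiFun r) ((r - 1) * |x| ^ (r - 2)) x := by
  have key : ∀ x : ℝ, 0 < x → HasDerivAt (phiFun r) ((r - 1) * |x| ^ (r - 2)) x := by
    intro x hx
    have h1 : HasDerivAt (fun y : ℝ => y ^ (r - 1)) ((r - 1) * x ^ (r - 1 - 1)) x :=
      Real.hasDerivAt_rpow_const (Or.inl hx.ne')
    rw [abs_of_pos hx]
    have : r - 2 = r - 1 - 1 := by ring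
    rw [this]
    refine h1.congr_of_eventuallyEq ?_
    filter_upwards [lt_mem_nhds hx] with y hy
    exact phiFun_of_pos hy
  rcases lt_trichotomy x 0 with h | h | h
  · have h1 : HasDerivAt (fun y => -phiFun r (-y)) (-(((r - 1) * |(-x)| ^ (r - 2)) * (-1))) x :=
      ((key (-x) (neg_pos.2 h)).comp x (hasDerivAt_neg x)).neg
    simp only [phiFun_neg, neg_neg, abs_neg, mul_neg, mul_one] at h1
    exact h1
  · subst h
    rw [hasDerivAt_iff_tendsto_slope_zero]
    have hc : Continuous fun t : ℝ => |t| ^ (r - 2) := continuous_abs_rpow (by linarith)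
    have h0 := (hc.tendsto 0).mono_left (nhdsWithin_le_nhds (s := {0}ᶜ))
    simp only [abs_zero] at h0 ⊢
    rw [Real.zero_rpow (by linarith : r - 2 ≠ 0)] at h0 ⊢
    rw [mul_zero]
    refine h0.congr' ?_
    filter_upwards [self_mem_nhdsWithin] with t ht
    have ht' : t ≠ 0 := ht
    rw [zero_add, phiFun_zero, sub_zero, smul_eq_mul, phiFun, ← mul_assoc, inv_mul_cancel₀ ht',
      one_mul]
  · exact key x h

theorem continuous_phiFun {r : ℝ} (hr : 2 < r) : Continuous (phiFun r) :=
  continuous_iff_continuousAt.2 fun x => (hasDerivAt_phiFun hr x).continuousAt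

/-! ### Young's inequality with a parameter and its case of equality. -/

section Young

variable {p q : ℝ}

/-- The exponents multiply to `(p - 1) * (q - 1) = 1`: the derivatives of conjugate powers are
inverse functions up to constants. -/
theorem phiFun_conj_phiFun (hpq : p.HolderConjugate q) (w : ℝ) :
    phiFun q (phiFun p w) = w := by
  have key : ∀ w : ℝ, 0 < w → phiFun q (phiFun p w) = w := by
    intro w hw
    rw [phiFun_of_pos (phiFun_pos hw), phiFun_of_pos hw, ← Real.rpow_mul hw.le]
    have : (p - 1) * (q - 1) = 1 := by
      have := hpq.mul_eq_add; linarith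
    rw [this, Real.rpow_one]
  rcases lt_trichotomy w 0 with h | h | h
  · have := key (-w) (neg_pos.2 h)
    rw [phiFun_neg, phiFun_neg] at this; linarith
  · subst h; simp [phiFun_zero]
  · exact key w h

theorem abs_smul_phiFun_rpow (hpq : p.HolderConjugate q) {κ : ℝ} (hκ : 0 < κ) (w : ℝ) :
    |κ * phiFun p w| ^ q = κ ^ q * |w| ^ p := by
  rw [abs_mul, Real.mul_rpow (abs_nonneg _) (abs_nonneg _), abs_of_pos hκ, abs_phiFun hpq.lt,
    ← Real.rpow_mul (abs_nonneg w), hpq.sub_one_mul_conj]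

theorem young_value (hpq : p.HolderConjugate q) {κ : ℝ} (hκ : 0 < κ) (w : ℝ) :
    κ / p * |w| ^ p + κ ^ (1 - q) / q * |κ * phiFun p w| ^ q = w * (κ * phiFun p w) := by
  have h1 := mul_phiFun hpq.ne_zero w
  have h2 : κ ^ (1 - q) * κ ^ q = κ := by
    rw [← Real.rpow_add hκ]; simp
  rw [abs_smul_phiFun_rpow hpq hκ]
  have h3 : p⁻¹ + q⁻¹ = 1 := hpq.inv_add_inv_eq_one
  calc κ / p * |w| ^ p + κ ^ (1 - q) / q * (κ ^ q * |w| ^ p)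
      = κ / p * |w| ^ p + (κ ^ (1 - q) * κ ^ q) / q * |w| ^ p := by ring
    _ = κ * |w| ^ p * (p⁻¹ + q⁻¹) := by rw [h2]; ring
    _ = _ := by rw [h3, ← h1]; ring

/-- The tangent of `|·|^q` at `κ * phiFun p w`, multiplied by `κ^(1-q)/q`, has slope exactly `w`,
since `phiFun q` inverts `phiFun p`. Strict convexity then makes the case of equality unique. -/
theorem young_lt (hpq : p.HolderConjugate q) {κ : ℝ} (hκ : 0 < κ) {w v : ℝ}
    (hv : v ≠ κ * phiFun p w) : w * v < κ / p * |w| ^ p + κ ^ (1 - q) / q * |v| ^ q := by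
  have h1 := abs_rpow_tangent_lt hpq.symm.lt hv.symm
  have h2 : phiFun q (κ * phiFun p w) = κ ^ (q - 1) * w := by
    rw [phiFun_mul, phiFun_conj_phiFun hpq, phiFun_of_pos hκ]
  have h3 := young_value hpq hκ w
  have hq := hpq.symm.pos
  have h4 : κ ^ (1 - q) * κ ^ (q - 1) = 1 := by
    rw [← Real.rpow_add hκ]; simp
  have h5 : 0 < κ ^ (1 - q) / q := by positivity
  have h6 := mul_lt_mul_of_pos_left h1 h5
  rw [h2] at h6
  have h7 : κ ^ (1 - q) / q * (|κ * phiFun p w| ^ q + q * (κ ^ (q - 1) * w) * (v - κ * phiFun p w))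
      = κ ^ (1 - q) / q * |κ * phiFun p w| ^ q + w * (v - κ * phiFun p w) := by
    have : κ ^ (1 - q) / q * (q * (κ ^ (q - 1) * w) * (v - κ * phiFun p w))
      = (κ ^ (1 - q) * κ ^ (q - 1)) * (w * (v - κ * phiFun p w)) := by field_simp
    rw [mul_add, this, h4, one_mul]
  rw [h7] at h6
  linarith

theorem young_le (hpq : p.HolderConjugate q) {κ : ℝ} (hκ : 0 < κ) (w v : ℝ) :
    w * v ≤ κ / p * |w| ^ p + κ ^ (1 - q) / q * |v| ^ q := by
  rcases eq_or_ne v (κ * phiFun p w) with h | h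
  · rw [h, young_value hpq hκ]
  · exact (young_lt hpq hκ h).le

end Young

/-! ### The function `λ`, the number `R₀` and the function `ρ` -/

section Hyperbolic

/-- The derivative is `a * (sinh (a x) - sinh x)`. With `a = p - 1` this monotonicity yields both
the uniqueness of `R₀` and the sign of `λ'` on either side of it. -/
theorem cosh_mul_sub_strictMonoOn {a : ℝ} (ha : 1 < a) :
    StrictMonoOn (fun x : ℝ => Real.cosh (a * x) - a * Real.cosh x) (Ici 0) := by
  have hd : ∀ x : ℝ, HasDerivAt (fun x : ℝ => Real.cosh (a * x) - a * Real.cosh x)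
      (Real.sinh (a * x) * a - a * Real.sinh x) x := fun x =>
    ((((hasDerivAt_id x).const_mul a).cosh).sub ((Real.hasDerivAt_cosh x).const_mul a)).congr_deriv
      (by simp)
  apply strictMonoOn_of_deriv_pos (convex_Ici 0)
  · exact fun x _ => (hd x).continuousAt.continuousWithinAt
  · intro x hx
    rw [interior_Ici] at hx
    have hx' : 0 < x := hx
    rw [(hd x).deriv]
    have : Real.sinh x < Real.sinh (a * x) := Real.sinh_lt_sinh.2 (by nlinarith)
    nlinarith

theorem mul_sinh_lt_sinh_mul {a x : ℝ} (ha : 1 < a) (hx : 0 < x) :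
    a * Real.sinh x < Real.sinh (a * x) := by
  have hd : ∀ x : ℝ, HasDerivAt (fun x : ℝ => Real.sinh (a * x) - a * Real.sinh x)
      (Real.cosh (a * x) * a - a * Real.cosh x) x := fun x =>
    ((((hasDerivAt_id x).const_mul a).sinh).sub ((Real.hasDerivAt_sinh x).const_mul a)).congr_deriv
      (by simp)
  have hm : StrictMonoOn (fun x : ℝ => Real.sinh (a * x) - a * Real.sinh x) (Ici 0) := by
    apply strictMonoOn_of_deriv_pos (convex_Ici 0)
    · exact fun x _ => (hd x).continuousAt.continuousWithinAt
    · intro x hx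
      rw [interior_Ici] at hx
      have hx' : 0 < x := hx
      rw [(hd x).deriv]
      have : Real.cosh x < Real.cosh (a * x) := by
        rw [Real.cosh_lt_cosh, abs_of_pos hx', abs_of_pos (by positivity)]
        nlinarith
      nlinarith
  have := hm (self_mem_Ici) (mem_Ici.2 hx.le) hx
  simp at this
  exact this

/-- The difference of the two sides vanishes at `0` and has the derivative `(a² - 1) sinh x sinh (a
x)`. -/
theorem sinh_mul_cosh_lt {a x : ℝ} (ha : 1 < a) (hx : 0 < x) :
    Real.sinh (a * x) * Real.cosh x < a * (Real.sinh x * Real.cosh (a * x)) := by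
  have h1 : ∀ x, HasDerivAt (fun x : ℝ => Real.sinh (a * x)) (Real.cosh (a * x) * a) x := fun x =>
    (((hasDerivAt_id x).const_mul a).sinh).congr_deriv (by simp)
  have h2 : ∀ x, HasDerivAt (fun x : ℝ => Real.cosh (a * x)) (Real.sinh (a * x) * a) x := fun x =>
    (((hasDerivAt_id x).const_mul a).cosh).congr_deriv (by simp)
  have hd := fun x : ℝ => (((Real.hasDerivAt_sinh x).mul (h2 x)).const_mul a).sub
    ((h1 x).mul (Real.hasDerivAt_cosh x))
  have hm : StrictMonoOn (fun x : ℝ => a * (Real.sinh x * Real.cosh (a * x)) -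
      Real.sinh (a * x) * Real.cosh x) (Ici 0) := by
    apply strictMonoOn_of_deriv_pos (convex_Ici 0)
    · exact fun x _ => (hd x).continuousAt.continuousWithinAt
    · intro x hx
      rw [interior_Ici] at hx
      have hx' : 0 < x := hx
      have h3 := (hd x).deriv
      simp only [Pi.mul_def, Pi.sub_def] at h3
      rw [h3]
      have h4 : 0 < Real.sinh x * Real.sinh (a * x) :=
        mul_pos (Real.sinh_pos_iff.2 hx') (Real.sinh_pos_iff.2 (by positivity))
      have h5 : 0 < (a * a - 1) * (Real.sinh x * Real.sinh (a * x)) := mul_pos (by nlinarith) h4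
      linarith
  have := hm (self_mem_Ici) (mem_Ici.2 hx.le) hx
  simp at this
  exact this

end Hyperbolic

theorem exp_rpow (x a : ℝ) : Real.exp (-(2 * x)) ^ a = Real.exp (-(2 * x) * a) := by
  rw [← Real.exp_mul]

/-- The substitution `R₀ = exp (-2x)` symmetrizes the powers, so facts about `R₀` and `λ` become
comparisons of hyperbolic functions at `x` and `(p - 1) x`. -/
theorem isCriticalR_exp_iff {p x : ℝ} :
    IsCriticalR p (Real.exp (-(2 * x))) ↔
      0 < x ∧ Real.cosh ((p - 1) * x) = (p - 1) * Real.cosh x := by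
  have h1 : Real.exp (-(2 * x)) ^ ((p - 1) / 2) + Real.exp (-(2 * x)) ^ (-((p - 1) / 2))
      = 2 * Real.cosh ((p - 1) * x) := by
    rw [exp_rpow, exp_rpow, Real.cosh_eq]; ring_nf
  have h2 : Real.exp (-(2 * x)) ^ ((1 : ℝ) / 2) + Real.exp (-(2 * x)) ^ (-((1 : ℝ) / 2))
      = 2 * Real.cosh x := by
    rw [exp_rpow, exp_rpow, Real.cosh_eq]; ring_nf
  rw [IsCriticalR, h1, h2]
  have h3 : Real.exp (-(2 * x)) ∈ Ioo (0 : ℝ) 1 ↔ 0 < x := by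
    rw [mem_Ioo, Real.exp_lt_one_iff]
    constructor
    · rintro ⟨-, h⟩; linarith
    · intro h; exact ⟨Real.exp_pos _, by linarith⟩
  rw [h3]
  refine and_congr_right fun _ => ⟨fun h => by linarith, fun h => by linarith⟩

theorem exists_exp_of_pos {R : ℝ} (hR : 0 < R) : ∃ x : ℝ, R = Real.exp (-(2 * x)) :=
  ⟨-Real.log R / 2, by
    rw [show -(2 * (-Real.log R / 2)) = Real.log R by ring, Real.exp_log hR]⟩

theorem existsUnique_isCriticalR {p : ℝ} (hp : 2 < p) : ∃! R₀ : ℝ, IsCriticalR p R₀ := by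
  have ha : 1 < p - 1 := by linarith
  have hm := cosh_mul_sub_strictMonoOn ha
  have hc : Continuous fun x : ℝ => Real.cosh ((p - 1) * x) - (p - 1) * Real.cosh x := by fun_prop
  obtain ⟨x₀, hx₀, hx₀'⟩ : ∃ x : ℝ, 0 < x ∧
      Real.cosh ((p - 1) * x) - (p - 1) * Real.cosh x = 0 := by
    have hlim : ∃ y : ℝ, 0 < y ∧ 0 < Real.cosh ((p - 1) * y) - (p - 1) * Real.cosh y := by
      -- With this `y`, `exp ((p - 2) y) = exp (2 (p - 1)) > 2 (p - 1)`, so `exp ((p - 1) y) / 2`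
      -- already exceeds `(p - 1) exp y ≥ (p - 1) cosh y`.
      refine ⟨2 * (p - 1) / (p - 2), by apply div_pos <;> linarith, ?_⟩
      set y := 2 * (p - 1) / (p - 2) with hy
      have hy1 : (p - 2) * y = 2 * (p - 1) := by rw [hy]; field_simp [show p - 2 ≠ 0 by linarith]
      have hy0 : 0 < y := by apply div_pos <;> linarith
      have e1 : Real.cosh ((p - 1) * y) = Real.exp ((p - 1) * y) / 2 + Real.exp (-((p - 1) * y)) / 2 := by
        rw [Real.cosh_eq]; ring
      have e2 : Real.cosh y ≤ Real.exp y := by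
        rw [Real.cosh_eq]
        have : Real.exp (-y) ≤ Real.exp y := Real.exp_le_exp.2 (by linarith)
        linarith
      have e3 : Real.exp ((p - 1) * y) = Real.exp (2 * (p - 1)) * Real.exp y := by
        rw [← Real.exp_add]; congr 1; linarith
      have e4 : 2 * (p - 1) + 1 ≤ Real.exp (2 * (p - 1)) := Real.add_one_le_exp _
      have e5 := Real.exp_pos (-((p - 1) * y))
      have e6 := Real.exp_pos y
      rw [e1, e3]
      nlinarith
    obtain ⟨y, hy, hy'⟩ := hlim
    have h0 : Real.cosh ((p - 1) * 0) - (p - 1) * Real.cosh 0 < 0 := by simp; linarith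
    obtain ⟨x, hx, hx'⟩ := intermediate_value_Ioo hy.le hc.continuousOn ⟨h0, hy'⟩
    exact ⟨x, hx.1, hx'⟩
  refine ⟨Real.exp (-(2 * x₀)), isCriticalR_exp_iff.2 ⟨hx₀, by linarith⟩, ?_⟩
  intro R hR
  obtain ⟨x, rfl⟩ := exists_exp_of_pos hR.1.1
  obtain ⟨hx, hx'⟩ := isCriticalR_exp_iff.1 hR
  have : x = x₀ := hm.injOn (mem_Ici.2 hx.le) (mem_Ici.2 hx₀.le) (by
    show Real.cosh ((p - 1) * x) - (p - 1) * Real.cosh x = _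
    rw [hx₀', hx']; ring)
  rw [this]

section Lambda

variable {p : ℝ}

theorem one_add_phiFun_pos (hp : 1 < p) {R : ℝ} (hR : -1 < R) : 0 < 1 + phiFun p R := by
  have := phiFun_strictMono hp hR
  rw [phiFun_neg, phiFun_one] at this; linarith

theorem lambdaFun_of_ne {R : ℝ} (hR : -1 < R) :
    lambdaFun p R = 1 / (1 + R) - (p - 1) / (1 + phiFun p R) := if_neg hR.ne'

theorem hasDerivAt_lambdaFun (hp : 2 < p) {R : ℝ} (hR : -1 < R) :
    HasDerivAt (lambdaFun p) (((p - 1) ^ 2 * |R| ^ (p - 2) * (1 + R) ^ 2 - (1 + phiFun p R) ^ 2) /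
      ((1 + R) ^ 2 * (1 + phiFun p R) ^ 2)) R := by
  have hX : 0 < 1 + R := by linarith
  have hY := one_add_phiFun_pos (by linarith) hR (p := p)
  have h1 : HasDerivAt (fun R => 1 + R) 1 R := (hasDerivAt_id R).const_add 1
  have h2 := (hasDerivAt_phiFun hp R).const_add 1
  have h3 := ((h1.inv hX.ne').sub ((h2.inv hY.ne').const_mul (p - 1)))
  have h4 : HasDerivAt (lambdaFun p) (-1 / (1 + R) ^ 2 -
      (p - 1) * (-((p - 1) * |R| ^ (p - 2)) / (1 + phiFun p R) ^ 2)) R := by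
    refine h3.congr_of_eventuallyEq ?_
    filter_upwards [lt_mem_nhds hR] with y hy
    rw [lambdaFun_of_ne hy]
    simp [div_eq_mul_inv]
  refine h4.congr_deriv ?_
  field_simp
  ring

/-- The left side is the numerator of `λ'`. In the variable `x` it is a positive factor times a
difference of squares, so its sign is that of `(p - 1) cosh x - cosh ((p - 1) x)`. -/
theorem critical_sign_pos (x : ℝ) :
    (p - 1) ^ 2 * |Real.exp (-(2 * x))| ^ (p - 2) * (1 + Real.exp (-(2 * x))) ^ 2 -
      (1 + phiFun p (Real.exp (-(2 * x)))) ^ 2 =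
    4 * Real.exp (-(2 * (p - 1) * x)) *
      (((p - 1) * Real.cosh x) ^ 2 - Real.cosh ((p - 1) * x) ^ 2) := by
  rw [phiFun_of_pos (Real.exp_pos _), abs_of_pos (Real.exp_pos _), exp_rpow, exp_rpow]
  have e1 : 1 + Real.exp (-(2 * x)) = 2 * Real.exp (-x) * Real.cosh x := by
    rw [Real.cosh_eq]
    have : Real.exp (-(2 * x)) = Real.exp (-x) * Real.exp (-x) := by rw [← Real.exp_add]; ring_nf
    have h2 : Real.exp (-x) * Real.exp x = 1 := by rw [← Real.exp_add]; simp
    rw [this]; linear_combination -h2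
  have e2 : 1 + Real.exp (-(2 * x) * (p - 1)) =
      2 * Real.exp (-((p - 1) * x)) * Real.cosh ((p - 1) * x) := by
    rw [Real.cosh_eq]
    have : Real.exp (-(2 * x) * (p - 1)) = Real.exp (-((p - 1) * x)) * Real.exp (-((p - 1) * x)) := by
      rw [← Real.exp_add]; ring_nf
    have h2 : Real.exp (-((p - 1) * x)) * Real.exp ((p - 1) * x) = 1 := by
      rw [← Real.exp_add]; simp
    rw [this]; linear_combination -h2
  have e3 : Real.exp (-(2 * x) * (p - 2)) * Real.exp (-x) ^ 2 = Real.exp (-(2 * (p - 1) * x)) := by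
    rw [← Real.exp_nat_mul, ← Real.exp_add]; congr 1; push_cast; ring
  have e4 : Real.exp (-((p - 1) * x)) ^ 2 = Real.exp (-(2 * (p - 1) * x)) := by
    rw [← Real.exp_nat_mul]; congr 1; push_cast; ring
  rw [e1, e2]
  linear_combination 4 * (p - 1) ^ 2 * Real.cosh x ^ 2 * e3 - 4 * Real.cosh ((p - 1) * x) ^ 2 * e4

/-- For negative arguments `sinh` replaces `cosh`, and `mul_sinh_lt_sinh_mul` leaves only one sign:
`λ'` has no zero there. -/
theorem critical_sign_neg (x : ℝ) :
    (p - 1) ^ 2 * |-Real.exp (-(2 * x))| ^ (p - 2) * (1 + -Real.exp (-(2 * x))) ^ 2 -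
      (1 + phiFun p (-Real.exp (-(2 * x)))) ^ 2 =
    4 * Real.exp (-(2 * (p - 1) * x)) *
      (((p - 1) * Real.sinh x) ^ 2 - Real.sinh ((p - 1) * x) ^ 2) := by
  rw [phiFun_neg, phiFun_of_pos (Real.exp_pos _), abs_neg, abs_of_pos (Real.exp_pos _), exp_rpow,
    exp_rpow]
  have e1 : 1 + -Real.exp (-(2 * x)) = 2 * Real.exp (-x) * Real.sinh x := by
    rw [Real.sinh_eq]
    have : Real.exp (-(2 * x)) = Real.exp (-x) * Real.exp (-x) := by rw [← Real.exp_add]; ring_nf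
    have h2 : Real.exp (-x) * Real.exp x = 1 := by rw [← Real.exp_add]; simp
    rw [this]; linear_combination -h2
  have e2 : 1 + -Real.exp (-(2 * x) * (p - 1)) =
      2 * Real.exp (-((p - 1) * x)) * Real.sinh ((p - 1) * x) := by
    rw [Real.sinh_eq]
    have : Real.exp (-(2 * x) * (p - 1)) = Real.exp (-((p - 1) * x)) * Real.exp (-((p - 1) * x)) := by
      rw [← Real.exp_add]; ring_nf
    have h2 : Real.exp (-((p - 1) * x)) * Real.exp ((p - 1) * x) = 1 := by
      rw [← Real.exp_add]; simp
    rw [this]; linear_combination -h2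
  have e3 : Real.exp (-(2 * x) * (p - 2)) * Real.exp (-x) ^ 2 = Real.exp (-(2 * (p - 1) * x)) := by
    rw [← Real.exp_nat_mul, ← Real.exp_add]; congr 1; push_cast; ring
  have e4 : Real.exp (-((p - 1) * x)) ^ 2 = Real.exp (-(2 * (p - 1) * x)) := by
    rw [← Real.exp_nat_mul]; congr 1; push_cast; ring
  rw [e1, e2]
  linear_combination 4 * (p - 1) ^ 2 * Real.sinh x ^ 2 * e3 - 4 * Real.sinh ((p - 1) * x) ^ 2 * e4

theorem deriv_lambdaFun_neg (hp : 2 < p) {R₀ : ℝ} (h₀ : IsCriticalR p R₀) {R : ℝ} (hR : -1 < R)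
    (hR' : R < R₀) : deriv (lambdaFun p) R < 0 := by
  have ha : 1 < p - 1 := by linarith
  have hX : 0 < 1 + R := by linarith
  have hY := one_add_phiFun_pos (by linarith) hR (p := p)
  rw [(hasDerivAt_lambdaFun hp hR).deriv]
  refine div_neg_of_neg_of_pos ?_ (by positivity)
  obtain ⟨x₀, rfl⟩ := exists_exp_of_pos h₀.1.1
  obtain ⟨hx₀, hx₀'⟩ := isCriticalR_exp_iff.1 h₀
  rcases lt_trichotomy R 0 with h | h | h
  · obtain ⟨x, hx⟩ := exists_exp_of_pos (neg_pos.2 h)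
    have hxp : 0 < x := by
      have : Real.exp (-(2 * x)) < 1 := by linarith
      rw [Real.exp_lt_one_iff] at this; linarith
    have hR2 : R = -Real.exp (-(2 * x)) := by linarith
    rw [hR2, critical_sign_neg]
    refine mul_neg_of_pos_of_neg (by positivity) ?_
    have := mul_sinh_lt_sinh_mul ha hxp
    have h2 : 0 < (p - 1) * Real.sinh x := mul_pos (by linarith) (Real.sinh_pos_iff.2 hxp)
    have := pow_lt_pow_left₀ this h2.le two_ne_zero
    linarith
  · subst h
    rw [phiFun_zero, abs_zero, Real.zero_rpow (by linarith)]; norm_num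
  · obtain ⟨x, rfl⟩ := exists_exp_of_pos h
    rw [critical_sign_pos]
    refine mul_neg_of_pos_of_neg (by positivity) ?_
    have hx : x₀ < x := by
      rw [Real.exp_lt_exp] at hR'; linarith
    have := cosh_mul_sub_strictMonoOn ha (mem_Ici.2 hx₀.le) (mem_Ici.2 (hx₀.trans hx).le) hx
    simp only at this
    rw [hx₀'] at this
    have h1 : (p - 1) * Real.cosh x < Real.cosh ((p - 1) * x) := by linarith
    have h2 : 0 < (p - 1) * Real.cosh x := mul_pos (by linarith) (Real.cosh_pos x)
    have := pow_lt_pow_left₀ h1 h2.le two_ne_zero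
    linarith

theorem deriv_lambdaFun_pos (hp : 2 < p) {R₀ : ℝ} (h₀ : IsCriticalR p R₀) {R : ℝ} (hR : R₀ < R)
    (hR' : R < 1) : 0 < deriv (lambdaFun p) R := by
  have ha : 1 < p - 1 := by linarith
  have hR0 : 0 < R := h₀.1.1.trans hR
  have hX : 0 < 1 + R := by linarith
  have hY := one_add_phiFun_pos (by linarith) (show -1 < R by linarith) (p := p)
  rw [(hasDerivAt_lambdaFun hp (by linarith)).deriv]
  refine div_pos ?_ (by positivity)
  obtain ⟨x₀, rfl⟩ := exists_exp_of_pos h₀.1.1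
  obtain ⟨hx₀, hx₀'⟩ := isCriticalR_exp_iff.1 h₀
  obtain ⟨x, rfl⟩ := exists_exp_of_pos hR0
  rw [critical_sign_pos]
  refine mul_pos (by positivity) ?_
  have hx : x < x₀ := by
    rw [Real.exp_lt_exp] at hR; linarith
  have hx0 : 0 < x := by
    rw [Real.exp_lt_one_iff] at hR'; linarith
  have := cosh_mul_sub_strictMonoOn ha (mem_Ici.2 hx0.le) (mem_Ici.2 hx₀.le) hx
  simp only at this
  rw [hx₀'] at this
  have h1 : Real.cosh ((p - 1) * x) < (p - 1) * Real.cosh x := by linarith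
  have := pow_lt_pow_left₀ h1 (Real.cosh_pos _).le two_ne_zero
  linarith

/-- This is the square root of the equation `λ'(R₀) = 0`; it comes from the defining equation
multiplied by `R₀^((p-1)/2)`. -/
theorem one_add_phiFun_critical {R₀ : ℝ} (h₀ : IsCriticalR p R₀) :
    1 + phiFun p R₀ = (p - 1) * R₀ ^ ((p - 2) / 2) * (1 + R₀) := by
  have h0 := h₀.1.1
  have h1 := h₀.2
  rw [phiFun_of_pos h0]
  have e1 : R₀ ^ ((p - 1) / 2) * R₀ ^ ((p - 1) / 2) = R₀ ^ (p - 1) := by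
    rw [← Real.rpow_add h0]; ring_nf
  have e2 : R₀ ^ ((p - 1) / 2) * R₀ ^ (-((p - 1) / 2)) = 1 := by
    rw [← Real.rpow_add h0]; simp
  have e3 : R₀ ^ ((p - 1) / 2) * R₀ ^ ((1 : ℝ) / 2) = R₀ ^ ((p - 2) / 2) * R₀ := by
    nth_rewrite 4 [← Real.rpow_one R₀]
    rw [← Real.rpow_add h0, ← Real.rpow_add h0]; ring_nf
  have e4 : R₀ ^ ((p - 1) / 2) * R₀ ^ (-((1 : ℝ) / 2)) = R₀ ^ ((p - 2) / 2) := by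
    rw [← Real.rpow_add h0]; ring_nf
  linear_combination R₀ ^ ((p - 1) / 2) * h1 - e1 - e2 + (p - 1) * e3 + (p - 1) * e4

theorem continuousAt_lambdaFun (hp : 2 < p) {R : ℝ} (hR : -1 < R) :
    ContinuousAt (lambdaFun p) R := (hasDerivAt_lambdaFun hp hR).continuousAt

theorem lambdaFun_strictAntiOn_Ioc (hp : 2 < p) {R₀ : ℝ} (h₀ : IsCriticalR p R₀) :
    StrictAntiOn (lambdaFun p) (Ioc (-1) R₀) := by
  apply strictAntiOn_of_deriv_neg (convex_Ioc _ _)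
  · exact fun x hx => (continuousAt_lambdaFun hp hx.1).continuousWithinAt
  · intro x hx
    rw [interior_Ioc] at hx
    exact deriv_lambdaFun_neg hp h₀ hx.1 hx.2

theorem lambdaFun_strictMonoOn (hp : 2 < p) {R₀ : ℝ} (h₀ : IsCriticalR p R₀) :
    StrictMonoOn (lambdaFun p) (Icc R₀ 1) := by
  have h0 := h₀.1.1
  apply strictMonoOn_of_deriv_pos (convex_Icc _ _)
  · exact fun x hx => (continuousAt_lambdaFun hp (by linarith [hx.1])).continuousWithinAt
  · intro x hx
    rw [interior_Icc] at hx
    exact deriv_lambdaFun_pos hp h₀ hx.1 hx.2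

theorem lambdaFun_neg_one : lambdaFun p (-1) = -((p - 2) / 2) := if_pos rfl

theorem lambdaFun_one : lambdaFun p 1 = -((p - 2) / 2) := by
  rw [lambdaFun_of_ne (by norm_num), phiFun_one]; ring

/-- Since `1 / (1 - exp (-2y)) = (coth y + 1) / 2`, the claim reduces to `coth x < (p - 1) coth ((p
- 1) x)`, that is, to `sinh_mul_cosh_lt`. -/
theorem lambdaFun_lt_of_neg (hp : 2 < p) {R : ℝ} (hR : -1 < R) (hR' : R < 0) :
    lambdaFun p R < -((p - 2) / 2) := by
  have ha : 1 < p - 1 := by linarith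
  obtain ⟨x, hx⟩ := exists_exp_of_pos (neg_pos.2 hR')
  have hxp : 0 < x := by
    have : Real.exp (-(2 * x)) < 1 := by linarith
    rw [Real.exp_lt_one_iff] at this; linarith
  have hY := one_add_phiFun_pos (by linarith) hR (p := p)
  rw [lambdaFun_of_ne hR]
  have hR2 : R = -Real.exp (-(2 * x)) := by linarith
  have key : ∀ y : ℝ, 0 < y → 1 / (1 - Real.exp (-(2 * y))) =
      (Real.cosh y / Real.sinh y + 1) / 2 := by
    intro y hy
    have hs := Real.sinh_pos_iff.2 hy
    have h1 : Real.exp (-(2 * y)) < 1 := by rw [Real.exp_lt_one_iff]; linarith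
    have h2 : Real.cosh y + Real.sinh y = Real.exp y := Real.cosh_add_sinh y
    have h3 : 1 - Real.exp (-(2 * y)) = 2 * Real.exp (-y) * Real.sinh y := by
      rw [Real.sinh_eq]
      have : Real.exp (-(2 * y)) = Real.exp (-y) * Real.exp (-y) := by
        rw [← Real.exp_add]; ring_nf
      have h2 : Real.exp (-y) * Real.exp y = 1 := by rw [← Real.exp_add]; simp
      rw [this]; linear_combination -h2
    rw [h3]
    have h4 : Real.exp (-y) * Real.exp y = 1 := by rw [← Real.exp_add]; simp
    field_simp
    rw [h2]; linarith
  have e1 : 1 / (1 + R) = (Real.cosh x / Real.sinh x + 1) / 2 := by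
    rw [hR2, ← key x hxp]; ring_nf
  have e2 : 1 / (1 + phiFun p R) =
      (Real.cosh ((p - 1) * x) / Real.sinh ((p - 1) * x) + 1) / 2 := by
    rw [← key _ (by positivity), hR2, phiFun_neg, phiFun_of_pos (Real.exp_pos _), exp_rpow]
    ring_nf
  have e3 : (p - 1) / (1 + phiFun p R) = (p - 1) * (1 / (1 + phiFun p R)) := by ring
  rw [e3, e1, e2]
  have hs1 := Real.sinh_pos_iff.2 hxp
  have hs2 := Real.sinh_pos_iff.2 (show 0 < (p - 1) * x by positivity)
  have : Real.cosh x / Real.sinh x <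
      (p - 1) * (Real.cosh ((p - 1) * x) / Real.sinh ((p - 1) * x)) := by
    rw [← mul_div_assoc, div_lt_div_iff₀ hs1 hs2]
    have := sinh_mul_cosh_lt ha hxp
    linarith
  linarith

theorem lambdaFun_lt_neg_one (hp : 2 < p) {R₀ : ℝ} (h₀ : IsCriticalR p R₀) {R : ℝ}
    (hR : R ∈ Ioc (-1) R₀) : lambdaFun p R < -((p - 2) / 2) := by
  have h0 := h₀.1.1
  rcases lt_or_ge R 0 with h | h
  · exact lambdaFun_lt_of_neg hp hR.1 h
  · exact (lambdaFun_strictAntiOn_Ioc hp h₀ ⟨by norm_num, by linarith⟩ hR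
      (show (-1 / 2 : ℝ) < R by linarith)).trans
      (lambdaFun_lt_of_neg hp (by norm_num) (by norm_num))

/-- The values of `λ` on `[-1, R₀]` lie between `λ(R₀)` and `λ(-1) = λ(1)`, so the intermediate
value theorem finds them again on `[R₀, 1]`. -/
theorem exists_isRho (hp : 2 < p) {R₀ : ℝ} (h₀ : IsCriticalR p R₀) : ∃ ρ, IsRho p R₀ ρ := by
  have h0 := h₀.1.1
  have h1 := h₀.1.2
  have key : ∀ R ∈ Icc (-1 : ℝ) R₀, ∃ r ∈ Icc R₀ 1, lambdaFun p r = lambdaFun p R := by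
    intro R hR
    have hc : ContinuousOn (lambdaFun p) (Icc R₀ 1) := fun x hx =>
      (continuousAt_lambdaFun hp (by linarith [hx.1])).continuousWithinAt
    refine intermediate_value_Icc h1.le hc ⟨?_, ?_⟩
    · rcases hR.1.eq_or_lt with h | h
      · rw [← h, lambdaFun_neg_one]
        exact (lambdaFun_lt_neg_one hp h₀ ⟨by linarith, le_rfl⟩).le
      · exact (lambdaFun_strictAntiOn_Ioc hp h₀).antitoneOn ⟨h, hR.2⟩ ⟨by linarith, le_rfl⟩ hR.2
    · rw [lambdaFun_one]
      rcases hR.1.eq_or_lt with h | h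
      · rw [← h, lambdaFun_neg_one]
      · exact (lambdaFun_lt_neg_one hp h₀ ⟨h, hR.2⟩).le
  choose! r hr hr' using key
  refine ⟨fun R => if R < R₀ then r R else R, ?_, ?_, ?_⟩
  · intro R hR
    dsimp only
    split_ifs with h
    · exact hr R ⟨hR.1, h.le⟩
    · exact ⟨not_lt.1 h, hR.2⟩
  · intro R hR
    dsimp only
    split_ifs with h
    · exact hr' R hR
    · rfl
  · intro R hR
    exact if_neg (not_lt.2 hR.1)

/-- `λ` is strictly monotone on each side of `R₀`, so two points with the same value must straddle
`R₀`. -/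
theorem lt_critical_lt_of_lambdaFun_eq (hp : 2 < p) {R₀ : ℝ} (h₀ : IsCriticalR p R₀) {R r : ℝ}
    (hR : -1 < R) (hRr : R < r) (hr : r ≤ 1) (h : lambdaFun p r = lambdaFun p R) :
    R < R₀ ∧ R₀ < r := by
  have hlt : R₀ < r := by
    by_contra! hle
    exact (lambdaFun_strictAntiOn_Ioc hp h₀ ⟨hR, (hRr.le.trans hle)⟩ ⟨hR.trans hRr, hle⟩ hRr).ne h
  refine ⟨?_, hlt⟩
  by_contra! hle
  exact (lambdaFun_strictMonoOn hp h₀ ⟨hle, hRr.le.trans hr⟩ ⟨hlt.le, hr⟩ hRr).ne' h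

end Lambda

/-! ### Functions that are convex, concave and convex on three consecutive intervals -/

section ConvexConcaveConvex

/-- `f` has the derivative `f'`, which increases on `(-∞, s₁]`, decreases on `[s₁, s₂]` and
increases on `[s₂, ∞)`. -/
structure IsTriconvex (f f' : ℝ → ℝ) (s₁ s₂ : ℝ) : Prop where
  le : s₁ ≤ s₂
  hasDerivAt : ∀ u, HasDerivAt f (f' u) u
  left : StrictMonoOn f' (Iic s₁)
  mid : StrictAntiOn f' (Icc s₁ s₂)
  right : StrictMonoOn f' (Ici s₂)

variable {f f' : ℝ → ℝ} {s₁ s₂ u₁ u₂ : ℝ}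

theorem exists_between_eq_slope (hd : ∀ u, HasDerivAt f (f' u) u) {x y : ℝ} (hxy : x < y) :
    ∃ c ∈ Ioo x y, f y - f x = f' c * (y - x) := by
  obtain ⟨c, hc, h⟩ := exists_hasDerivAt_eq_slope f f' hxy
    (fun u _ => (hd u).continuousAt.continuousWithinAt) (fun u _ => hd u)
  refine ⟨c, hc, ?_⟩
  rw [h, div_mul_cancel₀ _ (by linarith)]

/-- Rolle's theorem adds a third zero of `f'` between `u₁` and `u₂`. Each monotone piece holds at
most one zero, so the outer two must lie on the outer pieces. -/
theorem IsTriconvex.le_of_zeros (h : IsTriconvex f f' s₁ s₂) (hu : u₁ < u₂) (h₁ : f' u₁ = 0)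
    (h₂ : f' u₂ = 0) (h₁₂ : f u₁ = f u₂) : u₁ ≤ s₁ ∧ s₂ ≤ u₂ := by
  obtain ⟨c, hc, hc'⟩ := exists_between_eq_slope h.hasDerivAt hu
  have hc0 : f' c = 0 := by
    rw [h₁₂, sub_self] at hc'
    rcases mul_eq_zero.1 hc'.symm with h | h
    · exact h
    · linarith
  constructor
  · by_contra! hlt
    rcases le_or_gt c s₂ with hcs | hcs
    · exact (h.mid ⟨hlt.le, hc.1.le.trans hcs⟩ ⟨(hlt.trans hc.1).le, hcs⟩ hc.1).ne (hc0.trans h₁.symm)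
    · exact (h.right (mem_Ici.2 hcs.le) (mem_Ici.2 (hcs.trans hc.2).le) hc.2).ne (hc0.trans h₂.symm)
  · by_contra! hlt
    rcases le_or_gt s₁ c with hcs | hcs
    · exact (h.mid ⟨hcs, (hc.2.trans hlt).le⟩ ⟨hcs.trans hc.2.le, hlt.le⟩ hc.2).ne' (hc0.trans h₂.symm)
    · exact (h.left (mem_Iic.2 (hc.1.trans hcs).le) (mem_Iic.2 hcs.le) hc.1).ne (h₁.trans hc0.symm)

theorem lt_of_strictMonoOn_deriv (hd : ∀ u, HasDerivAt f (f' u) u) {D : Set ℝ}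
    (hD : D.OrdConnected) (hm : StrictMonoOn f' D) {u v : ℝ} (hu : u ∈ D) (hv : v ∈ D)
    (huv : v ≠ u) (h0 : f' u = 0) : f u < f v := by
  rcases lt_or_gt_of_ne huv with h | h
  · obtain ⟨c, hc, hc'⟩ := exists_between_eq_slope hd h
    have := hm (hD.out hv hu ⟨hc.1.le, hc.2.le⟩) hu hc.2
    rw [h0] at this
    nlinarith
  · obtain ⟨c, hc, hc'⟩ := exists_between_eq_slope hd h
    have := hm hu (hD.out hu hv ⟨hc.1.le, hc.2.le⟩) hc.1
    rw [h0] at this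
    nlinarith

/-- On the outer pieces `f` is strictly convex with minimum `0` at `u₁` or `u₂`. On the middle piece
it is concave and nonnegative at the ends: a value `≤ 0` inside would force a nonpositive slope
before a nonnegative one. -/
theorem IsTriconvex.pos_of_ne (h : IsTriconvex f f' s₁ s₂) (hu : u₁ < u₂) (h₁ : f' u₁ = 0)
    (h₂ : f' u₂ = 0) (hf₁ : f u₁ = 0) (hf₂ : f u₂ = 0) {u : ℝ} (hu₁ : u ≠ u₁) (hu₂ : u ≠ u₂) :
    0 < f u := by
  obtain ⟨hs₁, hs₂⟩ := h.le_of_zeros hu h₁ h₂ (hf₁.trans hf₂.symm)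
  have hl : ∀ v ≤ s₁, v ≠ u₁ → 0 < f v := fun v hv hne => hf₁ ▸
    lt_of_strictMonoOn_deriv h.hasDerivAt ordConnected_Iic h.left (mem_Iic.2 hs₁) (mem_Iic.2 hv)
      hne h₁
  have hr : ∀ v, s₂ ≤ v → v ≠ u₂ → 0 < f v := fun v hv hne => hf₂ ▸
    lt_of_strictMonoOn_deriv h.hasDerivAt ordConnected_Ici h.right (mem_Ici.2 hs₂) (mem_Ici.2 hv)
      hne h₂
  rcases le_or_gt u s₁ with hu | hu
  · exact hl u hu hu₁
  rcases le_or_gt s₂ u with hu' | hu'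
  · exact hr u hu' hu₂
  have hs₁' : 0 ≤ f s₁ := by
    rcases eq_or_ne s₁ u₁ with h | h
    · rw [h, hf₁]
    · exact (hl _ le_rfl h).le
  have hs₂' : 0 ≤ f s₂ := by
    rcases eq_or_ne s₂ u₂ with h | h
    · rw [h, hf₂]
    · exact (hr _ le_rfl h).le
  obtain ⟨c, hc, hc'⟩ := exists_between_eq_slope h.hasDerivAt hu
  obtain ⟨d, hd, hd'⟩ := exists_between_eq_slope h.hasDerivAt hu'
  have := h.mid ⟨hc.1.le, (hc.2.trans hu').le⟩ ⟨(hu.trans hd.1).le, hd.2.le⟩ (hc.2.trans hd.1)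
  by_contra! hle
  have e1 : f' c ≤ 0 := by
    by_contra! hpos
    have := mul_pos hpos (sub_pos.2 hu)
    linarith
  have e2 : 0 ≤ f' d := by
    by_contra! hneg
    have := mul_neg_of_neg_of_pos hneg (sub_pos.2 hu')
    linarith
  linarith

theorem deriv_eq_zero_of_nonneg (hd : ∀ u, HasDerivAt f (f' u) u) (h0 : ∀ u, 0 ≤ f u) {u : ℝ}
    (hu : f u = 0) : f' u = 0 :=
  IsLocalMin.hasDerivAt_eq_zero (Filter.Eventually.of_forall fun v => by
    show f u ≤ f v
    rw [hu]; exact h0 v) (hd u)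

end ConvexConcaveConvex

/-! ### The shape of the one-variable gap profile. -/

section Profile

variable {p : ℝ}

theorem hasDerivAt_profile (hp : 2 < p) (A κ a b c u : ℝ) :
    HasDerivAt (fun u : ℝ => c + a * u + A * |u| ^ p - κ / p * |u - b| ^ p)
      (a + A * p * phiFun p u - κ * phiFun p (u - b)) u := by
  have h1 := (hasDerivAt_abs_rpow_phiFun (by linarith : 1 < p) u).const_mul A
  have h2 := ((hasDerivAt_abs_rpow_phiFun (by linarith : 1 < p) (u - b)).comp_sub_const u b).const_mul
    (κ / p)
  have h3 := (((hasDerivAt_id u).const_mul a).const_add c)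
  refine ((h3.add h1).sub h2).congr_deriv ?_
  field_simp

theorem hasDerivAt_profile_deriv (hp : 2 < p) (A κ a b u : ℝ) :
    HasDerivAt (fun u : ℝ => a + A * p * phiFun p u - κ * phiFun p (u - b))
      ((p - 1) * (A * p * |u| ^ (p - 2) - κ * |u - b| ^ (p - 2))) u := by
  have h1 := ((hasDerivAt_phiFun hp u).const_mul (A * p)).const_add a
  have h2 := ((hasDerivAt_phiFun hp (u - b)).comp_sub_const u b).const_mul κ
  exact (h1.sub h2).congr_deriv (by ring)

/-- The second derivative has the sign of `|u| - k |u - b|`, where `k = (κ / (A p))^(1/(p-2)) < 1`.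
It changes sign exactly at the two solutions `-kb/(1-k)` and `kb/(1+k)` of `|u| = k |u - b|`. -/
theorem exists_isTriconvex_profile (hp : 2 < p) {A κ b : ℝ} (hκ : 0 < κ) (hA : κ < A * p)
    (hb : 0 < b) (a c : ℝ) : ∃ s₁ < 0, ∃ s₂ > 0,
      IsTriconvex (fun u : ℝ => c + a * u + A * |u| ^ p - κ / p * |u - b| ^ p)
        (fun u => a + A * p * phiFun p u - κ * phiFun p (u - b)) s₁ s₂ := by
  set k : ℝ := (κ / (A * p)) ^ (1 / (p - 2)) with hk
  have hAp : 0 < A * p := hκ.trans hA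
  have hk0 : 0 < k := by positivity
  have hk1 : k < 1 := Real.rpow_lt_one (by positivity) ((div_lt_one hAp).2 hA)
    (by apply div_pos <;> linarith)
  have hkp : A * p * k ^ (p - 2) = κ := by
    rw [hk, ← Real.rpow_mul (by positivity), one_div_mul_cancel (by linarith), Real.rpow_one]
    exact mul_div_cancel₀ _ hAp.ne'
  have hp2 : 0 < p - 2 := by linarith
  have hpos : ∀ u, k * |u - b| < |u| →
      0 < (p - 1) * (A * p * |u| ^ (p - 2) - κ * |u - b| ^ (p - 2)) := by
    intro u hu
    have := Real.rpow_lt_rpow (by positivity) hu hp2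
    rw [Real.mul_rpow hk0.le (abs_nonneg _)] at this
    have := mul_lt_mul_of_pos_left this hAp
    rw [← mul_assoc, hkp] at this
    exact mul_pos (by linarith) (by linarith)
  have hneg : ∀ u, |u| < k * |u - b| →
      (p - 1) * (A * p * |u| ^ (p - 2) - κ * |u - b| ^ (p - 2)) < 0 := by
    intro u hu
    have := Real.rpow_lt_rpow (by positivity) hu hp2
    rw [Real.mul_rpow hk0.le (abs_nonneg _)] at this
    have := mul_lt_mul_of_pos_left this hAp
    rw [← mul_assoc, hkp] at this
    exact mul_neg_of_pos_of_neg (by linarith) (by linarith)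
  have hd := hasDerivAt_profile_deriv hp A κ a b
  have hs1 : -(k * b / (1 - k)) < 0 := neg_neg_of_pos (div_pos (by positivity) (by linarith))
  have hs2 : 0 < k * b / (1 + k) := by positivity
  refine ⟨-(k * b / (1 - k)), hs1, k * b / (1 + k), hs2, by linarith,
    hasDerivAt_profile hp A κ a b c, ?_, ?_, ?_⟩
  · apply strictMonoOn_of_deriv_pos (convex_Iic _)
    · exact fun u _ => (hd u).continuousAt.continuousWithinAt
    · intro u hu
      rw [interior_Iic, mem_Iio] at hu
      rw [(hd u).deriv]
      apply hpos
      rw [abs_of_neg (by linarith), abs_of_neg (by linarith : u < 0)]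
      have : k * b / (1 - k) < -u := by linarith
      rw [div_lt_iff₀ (by linarith)] at this
      linarith
  · apply strictAntiOn_of_deriv_neg (convex_Icc _ _)
    · exact fun u _ => (hd u).continuousAt.continuousWithinAt
    · intro u hu
      rw [interior_Icc] at hu
      rw [(hd u).deriv]
      apply hneg
      obtain ⟨h1, h2⟩ := hu
      rw [lt_div_iff₀ (by linarith)] at h2
      have h3 : -u < k * b / (1 - k) := by linarith
      rw [lt_div_iff₀ (by linarith)] at h3
      have hub : u < b := by nlinarith
      rw [abs_of_neg (by linarith : u - b < 0), abs_lt]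
      constructor <;> linarith
  · apply strictMonoOn_of_deriv_pos (convex_Ici _)
    · exact fun u _ => (hd u).continuousAt.continuousWithinAt
    · intro u hu
      rw [interior_Ici, mem_Ioi] at hu
      rw [(hd u).deriv]
      apply hpos
      have hu0 : 0 < u := hs2.trans hu
      rw [div_lt_iff₀ (by linarith)] at hu
      rw [abs_of_pos hu0]
      rcases le_total u b with h | h
      · rw [abs_of_nonpos (by linarith)]; linarith
      · rw [abs_of_nonneg (by linarith)]; nlinarith

end Profile

/-! ### The functional that touches the normalized curve at two points. -/

section CriticalProfile

variable {p : ℝ}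

/-- For `u < 0` the second derivative is `(p - 1) (-u)^(p-3) (p (-u) - n (p - 2))`. On `[0, ∞)` the
derivative increases term by term; this avoids differentiating `|u|^(p-2)` at `0`, which is
impossible for `p < 3`. -/
theorem isTriconvex_critical (hp : 2 < p) {n : ℝ} (hn : 0 < n) (c₁ c₀ : ℝ) :
    IsTriconvex (fun u : ℝ => |u| ^ p + n * phiFun p u + c₁ * u + c₀)
      (fun u => p * phiFun p u + n * ((p - 1) * |u| ^ (p - 2)) + c₁) (-(n * (p - 2) / p)) 0 := by
  have hd : ∀ u < 0, HasDerivAt (fun u => p * phiFun p u + n * ((p - 1) * |u| ^ (p - 2)) + c₁)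
      ((p - 1) * (-u) ^ (p - 3) * (p * (-u) - n * (p - 2))) u := by
    intro u hu
    have h1 := (hasDerivAt_phiFun hp u).const_mul p
    have h2 : HasDerivAt (fun u : ℝ => (-u) ^ (p - 2)) ((p - 2) * (-u) ^ (p - 2 - 1) * (-1)) u :=
      (Real.hasDerivAt_rpow_const (x := -u) (p := p - 2) (Or.inl (by linarith))).comp u
        (hasDerivAt_neg u)
    have h3 : HasDerivAt (fun u : ℝ => |u| ^ (p - 2)) ((p - 2) * (-u) ^ (p - 2 - 1) * (-1)) u := by
      refine h2.congr_of_eventuallyEq ?_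
      filter_upwards [gt_mem_nhds hu] with v hv
      rw [abs_of_neg hv]
    refine ((h1.add ((h3.const_mul (p - 1)).const_mul n)).add_const c₁).congr_deriv ?_
    rw [abs_of_neg hu]
    have h4 : (-u) ^ (p - 2) = (-u) ^ (p - 3) * (-u) := by
      nth_rewrite 3 [← Real.rpow_one (-u)]
      rw [← Real.rpow_add (by linarith)]; ring_nf
    have h5 : p - 2 - 1 = p - 3 := by ring
    rw [h4, h5]; ring
  have hc : Continuous (fun u => p * phiFun p u + n * ((p - 1) * |u| ^ (p - 2)) + c₁) := by
    have h1 := continuous_phiFun hp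
    have h2 := continuous_abs_rpow (show 0 ≤ p - 2 by linarith)
    fun_prop
  have hs : 0 < n * (p - 2) / p := div_pos (mul_pos hn (by linarith)) (by linarith)
  refine ⟨by linarith, ?_, ?_, ?_, ?_⟩
  · intro u
    have h1 := hasDerivAt_abs_rpow_phiFun (by linarith : 1 < p) u
    have h2 := (hasDerivAt_phiFun hp u).const_mul n
    exact (((h1.add h2).add ((hasDerivAt_id u).const_mul c₁)).add_const c₀).congr_deriv (by simp)
  · apply strictMonoOn_of_deriv_pos (convex_Iic _) hc.continuousOn
    intro u hu
    rw [interior_Iic, mem_Iio] at hu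
    rw [(hd u (by linarith)).deriv]
    have h1 : n * (p - 2) / p < -u := by linarith
    rw [div_lt_iff₀ (by linarith)] at h1
    have h2 : 0 < (-u) ^ (p - 3) := Real.rpow_pos_of_pos (by linarith) _
    exact mul_pos (mul_pos (by linarith) h2) (by linarith)
  · apply strictAntiOn_of_deriv_neg (convex_Icc _ _) hc.continuousOn
    intro u hu
    rw [interior_Icc] at hu
    obtain ⟨hu1, hu2⟩ := hu
    rw [(hd u hu2).deriv]
    have h1 : -u < n * (p - 2) / p := by linarith
    rw [lt_div_iff₀ (by linarith)] at h1
    have h2 : 0 < (-u) ^ (p - 3) := Real.rpow_pos_of_pos (by linarith) _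
    exact mul_neg_of_pos_of_neg (mul_pos (by linarith) h2) (by linarith)
  · intro x hx y hy hxy
    have hx' : 0 ≤ x := hx
    have h1 := phiFun_strictMono (by linarith : 1 < p) hxy
    have h2 : |x| ^ (p - 2) ≤ |y| ^ (p - 2) :=
      Real.rpow_le_rpow (abs_nonneg _) (abs_le_abs_of_nonneg hx' hxy.le) (by linarith)
    have h3 : n * ((p - 1) * |x| ^ (p - 2)) ≤ n * ((p - 1) * |y| ^ (p - 2)) :=
      mul_le_mul_of_nonneg_left (mul_le_mul_of_nonneg_left h2 (by linarith)) hn.le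
    have h4 := mul_lt_mul_of_pos_left h1 (by linarith : 0 < p)
    simp only
    linarith

/-- The functional on the curve `(u, φ(u), |u|^p)` that touches it at `-1` and `R₀` only. -/
theorem exists_critical_functional (hp : 2 < p) {r : ℝ} (hr : IsCriticalR p r) :
    ∃ n c₁ c₀ : ℝ, 0 < n ∧ c₁ < 0 ∧
      (∀ u, 0 ≤ |u| ^ p + n * phiFun p u + c₁ * u + c₀) ∧
      (∀ u, |u| ^ p + n * phiFun p u + c₁ * u + c₀ = 0 ↔ u = -1 ∨ u = r) := by
  have hr0 := hr.1.1
  have hY := one_add_phiFun_critical hr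
  set g := r ^ ((p - 2) / 2) with hg
  have hg0 : 0 < g := by positivity
  have hg1 : g < 1 := Real.rpow_lt_one hr0.le hr.1.2 (by linarith)
  have hg2 : 0 < 1 - g ^ 2 := by nlinarith
  have e2 : r ^ (p - 2) = g ^ 2 := by
    rw [hg, ← Real.rpow_natCast, ← Real.rpow_mul hr0.le]; congr 1; push_cast; ring
  have e1 : phiFun p r = r * g ^ 2 := by rw [phiFun, abs_of_pos hr0, e2]
  have e0 : |r| ^ p = r * (r * g ^ 2) := by rw [← e1, mul_phiFun (by linarith)]
  rw [e1] at hY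
  -- `n` and `c₁` make the derivative vanish at `-1` and at `r`; criticality of `r` has been used to
  -- simplify them. The constant term `n + c₁ - 1` gives the value `0` at `-1`, and the value at `r`
  -- is then `0` again by criticality.
  set n := p * g * (1 + r) / (1 - g ^ 2) with hn
  set c₁ := -(p * g ^ 2 * (1 + r) / (1 - g ^ 2)) with hc₁
  have hn' : n * (1 - g ^ 2) = p * g * (1 + r) := by rw [hn]; field_simp
  have hc' : c₁ * (1 - g ^ 2) = -(p * g ^ 2 * (1 + r)) := by rw [hc₁]; field_simp
  have hn0 : 0 < n := by rw [hn]; apply div_pos _ hg2; positivity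
  have hc0 : c₁ < 0 := by
    rw [hc₁]; apply neg_neg_of_pos; apply div_pos _ hg2; positivity
  have tri := isTriconvex_critical hp hn0 c₁ (n + c₁ - 1)
  have f1 : |(-1 : ℝ)| ^ p + n * phiFun p (-1) + c₁ * (-1) + (n + c₁ - 1) = 0 := by
    rw [phiFun_neg, phiFun_one, abs_neg, abs_one, Real.one_rpow]; ring
  have f2 : |r| ^ p + n * phiFun p r + c₁ * r + (n + c₁ - 1) = 0 := by
    rw [e0, e1]
    have : (r * (r * g ^ 2) + n * (r * g ^ 2) + c₁ * r + (n + c₁ - 1)) * (1 - g ^ 2) = 0 := by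
      linear_combination (r * g ^ 2 + 1) * hn' + (r + 1) * hc' + (g * (1 + r) - (1 + r * g ^ 2)) * hY
    exact (mul_eq_zero.1 this).resolve_right hg2.ne'
  have d1 : p * phiFun p (-1) + n * ((p - 1) * |(-1 : ℝ)| ^ (p - 2)) + c₁ = 0 := by
    rw [phiFun_neg, phiFun_one, abs_neg, abs_one, Real.one_rpow]
    have : (p * -1 + n * ((p - 1) * 1) + c₁) * (1 - g ^ 2) = 0 := by
      linear_combination (p - 1) * hn' + hc' - p * hY
    exact (mul_eq_zero.1 this).resolve_right hg2.ne'
  have d2 : p * phiFun p r + n * ((p - 1) * |r| ^ (p - 2)) + c₁ = 0 := by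
    rw [e1, abs_of_pos hr0, e2]
    have : (p * (r * g ^ 2) + n * ((p - 1) * g ^ 2) + c₁) * (1 - g ^ 2) = 0 := by
      linear_combination (p - 1) * g ^ 2 * hn' + hc' - p * g ^ 2 * hY
    exact (mul_eq_zero.1 this).resolve_right hg2.ne'
  have pos := fun u => tri.pos_of_ne (u := u) (by linarith : (-1 : ℝ) < r) d1 d2 f1 f2
  refine ⟨n, c₁, n + c₁ - 1, hn0, hc0, fun u => ?_, fun u => ⟨fun h => ?_, ?_⟩⟩
  · by_cases h1 : u = -1
    · rw [h1, f1]
    · by_cases h2 : u = r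
      · rw [h2, f2]
      · exact (pos u h1 h2).le
  · by_contra! hne
    exact (pos u hne.1 hne.2).ne' h
  · rintro (h | h) <;> rw [h] <;> assumption

end CriticalProfile

/-! ### Majorants of the Bellman function and step functions -/

/-- The affine function with the constant term `c` and the coefficients `m`. -/
def affVal (c : ℝ) (m x : Fin 4 → ℝ) : ℝ :=
  c + (m 0 * x 0 + m 1 * x 1 + m 2 * x 2 + m 3 * x 3)

/-- The affine function dominates `u v` on the skeleton of `Ω_c`. -/
def IsMajorant (p q c : ℝ) (m : Fin 4 → ℝ) : Prop :=
  ∀ u v : ℝ, u * v ≤ affVal c m (skelPoint p q u v)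

/-- The points of the skeleton where the affine function equals `u v`. -/
def contactSet (p q c : ℝ) (m : Fin 4 → ℝ) : Set (Fin 4 → ℝ) :=
  {x | ∃ u v : ℝ, x = skelPoint p q u v ∧ u * v = affVal c m x}

theorem affVal_skelPoint (p q c : ℝ) (m : Fin 4 → ℝ) (u v : ℝ) :
    affVal c m (skelPoint p q u v) = c + (m 0 * u + m 1 * v + m 2 * |u| ^ p + m 3 * |v| ^ q) := by
  simp [affVal, skelPoint]

theorem affVal_sum {ι : Type*} (s : Finset ι) (w : ι → ℝ) (hw : ∑ i ∈ s, w i = 1)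
    (z : ι → Fin 4 → ℝ) (c : ℝ) (m : Fin 4 → ℝ) :
    affVal c m (∑ i ∈ s, w i • z i) = ∑ i ∈ s, w i * affVal c m (z i) := by
  simp only [affVal, Finset.sum_apply, Pi.smul_apply, smul_eq_mul, mul_add, Finset.sum_add_distrib,
    Finset.mul_sum]
  rw [← Finset.sum_mul, hw, one_mul]
  congr 1
  congr 1
  · congr 1
    · congr 1 <;> exact Finset.sum_congr rfl fun i _ => by ring
    · exact Finset.sum_congr rfl fun i _ => by ring
  · exact Finset.sum_congr rfl fun i _ => by ring

section Bellman

variable {α β p q : ℝ}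

/-- Every admissible pair satisfies the majorant inequality pointwise. Averaging it turns the right
side into the majorant at `x`, and Hölder's inequality makes `f * g` integrable. -/
theorem bellmanC_le (hpq : p.HolderConjugate q) (hI : α < β) {c : ℝ} {m : Fin 4 → ℝ}
    (hm : IsMajorant p q c m) (x : Fin 4 → ℝ) :
    bellmanC α β p q x ≤ ((affVal c m x : ℝ) : EReal) := by
  refine sSup_le ?_
  rintro _ ⟨f, g, hf, hg, h0, h1, h2, h3, rfl⟩
  rw [EReal.coe_le_coe_iff]
  set μ := volume.restrict (Icc α β) with hμ
  have hμ0 : μ univ ≠ 0 := by simp [hμ, hI]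
  have hfin : IsFiniteMeasure μ := by rw [hμ]; infer_instance
  have hpe : (1 : ENNReal) ≤ ENNReal.ofReal p := by
    rw [← ENNReal.ofReal_one]; exact ENNReal.ofReal_le_ofReal hpq.lt.le
  have hqe : (1 : ENNReal) ≤ ENNReal.ofReal q := by
    rw [← ENNReal.ofReal_one]; exact ENNReal.ofReal_le_ofReal hpq.symm.lt.le
  have hconj : (ENNReal.ofReal p).HolderConjugate (ENNReal.ofReal q) := hpq.ennrealOfReal
  have if1 : Integrable f μ := hf.integrable hpe
  have ig1 : Integrable g μ := hg.integrable hqe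
  have ifp : Integrable (fun s => |f s| ^ p) μ := by
    have := hf.integrable_norm_rpow'
    rwa [ENNReal.toReal_ofReal hpq.pos.le] at this
  have igq : Integrable (fun s => |g s| ^ q) μ := by
    have := hg.integrable_norm_rpow'
    rwa [ENNReal.toReal_ofReal hpq.symm.pos.le] at this
  have ifg : Integrable (fun s => f s * g s) μ := hf.integrable_mul hg
  set V := μ.real univ with hV
  have hVpos : 0 < V := by
    rw [hV, Measure.real]
    exact ENNReal.toReal_pos hμ0 (measure_ne_top _ _)
  simp only [average_eq, smul_eq_mul] at h0 h1 h2 h3 ⊢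
  have i0 : Integrable (fun s => m 0 * f s) μ := if1.const_mul _
  have i1 : Integrable (fun s => m 1 * g s) μ := ig1.const_mul _
  have i2 : Integrable (fun s => m 2 * |f s| ^ p) μ := ifp.const_mul _
  have i3 : Integrable (fun s => m 3 * |g s| ^ q) μ := igq.const_mul _
  have i01 : Integrable (fun s => m 0 * f s + m 1 * g s) μ := i0.add i1
  have i02 : Integrable (fun s => m 0 * f s + m 1 * g s + m 2 * |f s| ^ p) μ := i01.add i2
  have i03 : Integrable (fun s => m 0 * f s + m 1 * g s + m 2 * |f s| ^ p + m 3 * |g s| ^ q) μ :=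
    i02.add i3
  have key : ∫ s, f s * g s ∂μ ≤
      ∫ s, (c + (m 0 * f s + m 1 * g s + m 2 * |f s| ^ p + m 3 * |g s| ^ q)) ∂μ := by
    refine integral_mono ifg ((integrable_const c).add i03) fun s => ?_
    have := hm (f s) (g s)
    rwa [affVal_skelPoint] at this
  rw [integral_add (integrable_const c) i03, integral_add i02 i3, integral_add i01 i2,
    integral_add i0 i1, integral_const_mul, integral_const_mul,
    integral_const_mul, integral_const_mul, integral_const, ← hV] at key
  rw [affVal, ← h0, ← h1, ← h2, ← h3]
  calc V⁻¹ * ∫ s, f s * g s ∂μ ≤ V⁻¹ * _ := mul_le_mul_of_nonneg_left key (by positivity)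
    _ = _ := by simp only [smul_eq_mul, ← hV]; field_simp

/-- The interval is cut into consecutive pieces of lengths `w i`, the leftmost one first; pieces of
length zero are harmless. -/
theorem exists_measurable_step {ι : Type*} [Finite ι] [Nonempty ι] [MeasurableSpace ι]
    [DiscreteMeasurableSpace ι] (w : ι → ℝ) (hw : ∀ i, 0 ≤ w i) (s : Finset ι) :
    ∀ a b : ℝ, ∑ i ∈ s, w i = b - a → ∃ k : ℝ → ι, Measurable k ∧
      ∀ F : ι → ℝ, ∫ t in a..b, F (k t) = ∑ i ∈ s, w i * F i := by
  classical
  induction s using Finset.induction_on with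
  | empty =>
    intro a b h
    have : b = a := by simp at h; linarith
    exact ⟨fun _ => Classical.arbitrary ι, measurable_const, fun F => by simp [this]⟩
  | insert j s hj ih =>
    intro a b h
    rw [Finset.sum_insert hj] at h
    obtain ⟨k, hk, hk'⟩ := ih (a + w j) b (by linarith)
    have hk2 : Measurable fun t => if t ≤ a + w j then j else k t :=
      Measurable.ite measurableSet_Iic measurable_const hk
    refine ⟨_, hk2, fun F => ?_⟩
    have hb : a + w j ≤ b := by
      have := Finset.sum_nonneg (s := s) fun i _ => hw i
      linarith
    have hint : ∀ c d : ℝ, IntervalIntegrable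
        (fun t => F (if t ≤ a + w j then j else k t)) volume c d := by
      intro c d
      obtain ⟨M, hM⟩ := (Set.finite_range fun i => ‖F i‖).bddAbove
      refine IntervalIntegrable.mono_fun (intervalIntegrable_const (c := M)) ?_ ?_
      · exact ((measurable_of_finite F).comp hk2).aestronglyMeasurable
      · refine Filter.Eventually.of_forall fun t => ?_
        exact (hM (mem_range_self _)).trans (le_abs_self M)
    rw [← intervalIntegral.integral_add_adjacent_intervals (hint a (a + w j)) (hint _ b),
      Finset.sum_insert hj, ← hk' F]
    congr 1
    · have : ∫ t in a..(a + w j), F (if t ≤ a + w j then j else k t) =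
          ∫ t in a..(a + w j), F j := by
        refine intervalIntegral.integral_congr_ae (Filter.Eventually.of_forall fun t ht => ?_)
        rw [uIoc_of_le (by linarith [hw j])] at ht
        rw [if_pos ht.2]
      rw [this]; simp
    · refine intervalIntegral.integral_congr_ae (Filter.Eventually.of_forall fun t ht => ?_)
      rw [uIoc_of_le hb] at ht
      rw [if_neg (not_le.2 ht.1)]

/-- The test pair takes the value `(u i, v i)` on a part of the interval of relative length `w i`.
-/
theorem le_bellmanC_sum (hI : α < β) {ι : Type*} [Fintype ι] (w : ι → ℝ)
    (hw : ∀ i, 0 ≤ w i) (hw1 : ∑ i, w i = 1) (u v : ι → ℝ) :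
    ((∑ i, w i * (u i * v i) : ℝ) : EReal) ≤
      bellmanC α β p q (∑ i, w i • skelPoint p q (u i) (v i)) := by
  let _ : MeasurableSpace ι := ⊤
  have : Nonempty ι := by
    by_contra h
    rw [not_nonempty_iff] at h
    simp at hw1
  obtain ⟨k, hk, hk'⟩ := exists_measurable_step (fun i => (β - α) * w i)
    (fun i => mul_nonneg (by linarith) (hw i)) Finset.univ α β
    (by rw [← Finset.mul_sum, hw1, mul_one])
  have hav : ∀ F : ι → ℝ, (⨍ t in Icc α β, F (k t)) = ∑ i, w i * F i := by
    intro F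
    rw [setAverage_eq, integral_Icc_eq_integral_Ioc, ← intervalIntegral.integral_of_le hI.le, hk' F]
    have : volume.real (Icc α β) = β - α := by simp [hI.le]
    rw [this, smul_eq_mul, Finset.mul_sum]
    refine Finset.sum_congr rfl fun i _ => ?_
    have : β - α ≠ 0 := by linarith
    field_simp
  have hmem : ∀ (F : ι → ℝ) (r : ENNReal), MemLp (fun t => F (k t)) r
      (volume.restrict (Icc α β)) := by
    intro F r
    obtain ⟨M, hM⟩ := (Set.finite_range fun i => ‖F i‖).bddAbove
    exact MemLp.of_bound ((measurable_of_finite F).comp hk).aestronglyMeasurable M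
      (Filter.Eventually.of_forall fun t => hM (mem_range_self _))
  refine le_sSup ⟨fun t => u (k t), fun t => v (k t), hmem _ _, hmem _ _, ?_, ?_, ?_, ?_, ?_⟩
  · rw [hav]; simp [skelPoint]
  · rw [hav]; simp [skelPoint]
  · rw [hav fun i => |u i| ^ p]; simp [skelPoint]
  · rw [hav fun i => |v i| ^ q]; simp [skelPoint]
  · rw [hav fun i => u i * v i]

/-- On the convex hull of the contact set of a majorant, the Bellman function is the majorant. -/
theorem bellmanC_eq_of_mem_convexHull (hpq : p.HolderConjugate q) (hI : α < β) {c : ℝ}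
    {m : Fin 4 → ℝ} (hm : IsMajorant p q c m) {x : Fin 4 → ℝ}
    (hx : x ∈ convexHull ℝ (contactSet p q c m)) :
    bellmanC α β p q x = ((affVal c m x : ℝ) : EReal) := by
  refine le_antisymm (bellmanC_le hpq hI hm x) ?_
  obtain ⟨ι, _, w, z, hw, hw1, hz, rfl⟩ := mem_convexHull_iff_exists_fintype.1 hx
  choose u v hz hval using hz
  obtain rfl : z = fun i => skelPoint p q (u i) (v i) := funext hz
  rw [affVal_sum _ _ hw1]
  simp only [← hval]
  exact le_bellmanC_sum hI w hw hw1 u v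

end Bellman

/-! ### The domain `Ω_c` and optimal majorants -/

section Domain

variable {p q : ℝ}

theorem continuous_skelPoint (hpq : p.HolderConjugate q) :
    Continuous fun z : ℝ × ℝ => skelPoint p q z.1 z.2 := by
  have h1 := continuous_abs_rpow hpq.pos.le
  have h2 := continuous_abs_rpow hpq.symm.pos.le
  refine continuous_pi fun i => ?_
  fin_cases i
  · exact continuous_fst
  · exact continuous_snd
  · exact h1.comp continuous_fst
  · exact h2.comp continuous_snd

theorem isOpen_strict (hpq : p.HolderConjugate q) :
    IsOpen {x : Fin 4 → ℝ | |x 0| ^ p < x 2 ∧ |x 1| ^ q < x 3} := by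
  have h1 := continuous_abs_rpow hpq.pos.le
  have h2 := continuous_abs_rpow hpq.symm.pos.le
  exact (isOpen_lt (h1.comp (continuous_apply 0)) (continuous_apply 2)).inter
    (isOpen_lt (h2.comp (continuous_apply 1)) (continuous_apply 3))

theorem mem_interior_omegaC_iff (hpq : p.HolderConjugate q) {x : Fin 4 → ℝ} :
    x ∈ interior (omegaC p q) ↔ |x 0| ^ p < x 2 ∧ |x 1| ^ q < x 3 := by
  constructor
  · intro hx
    obtain ⟨r, hr, hball⟩ := Metric.isOpen_iff.1 isOpen_interior x hx
    -- Lowering the third or the fourth coordinate inside the ball makes the corresponding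
    -- inequality strict.
    have key : ∀ i : Fin 4, x - Pi.single i (r / 2) ∈ omegaC p q := by
      intro i
      apply interior_subset
      apply hball
      rw [Metric.mem_ball, dist_eq_norm, sub_sub_cancel_left, norm_neg, Pi.norm_single,
        Real.norm_eq_abs, abs_of_pos (by positivity)]
      linarith
    have h2 := (key 2).1
    have h3 := (key 3).2
    simp at h2 h3
    constructor <;> linarith
  · intro hx
    have hsub : {x : Fin 4 → ℝ | |x 0| ^ p < x 2 ∧ |x 1| ^ q < x 3} ⊆ omegaC p q :=
      fun y hy => ⟨hy.1.le, hy.2.le⟩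
    exact interior_maximal hsub (isOpen_strict hpq) hx

theorem convex_omegaC (hpq : p.HolderConjugate q) : Convex ℝ (omegaC p q) := by
  intro x hx y hy a b ha hb hab
  have h1 := (strictConvexOn_abs_rpow hpq.lt).convexOn.2 (mem_univ (x 0)) (mem_univ (y 0)) ha hb hab
  have h2 := (strictConvexOn_abs_rpow hpq.symm.lt).convexOn.2 (mem_univ (x 1)) (mem_univ (y 1))
    ha hb hab
  simp only [smul_eq_mul] at h1 h2
  constructor
  · refine h1.trans ?_
    simp only [Pi.add_apply, Pi.smul_apply, smul_eq_mul]
    exact add_le_add (mul_le_mul_of_nonneg_left hx.1 ha) (mul_le_mul_of_nonneg_left hy.1 hb)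
  · refine h2.trans ?_
    simp only [Pi.add_apply, Pi.smul_apply, smul_eq_mul]
    exact add_le_add (mul_le_mul_of_nonneg_left hx.2 ha) (mul_le_mul_of_nonneg_left hy.2 hb)

theorem skelPoint_mem_omegaC (u v : ℝ) : skelPoint p q u v ∈ omegaC p q := by
  constructor <;> simp [skelPoint]

theorem skelPoint_notMem_interior (hpq : p.HolderConjugate q) (u v : ℝ) :
    skelPoint p q u v ∉ interior (omegaC p q) := by
  rw [mem_interior_omegaC_iff hpq]
  simp [skelPoint]

end Domain

section Majorant

variable {p q c : ℝ} {m : Fin 4 → ℝ}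

theorem IsMajorant.pos_three (hm : IsMajorant p q c m) : 0 < m 3 := by
  by_contra! h
  -- With `u = m 1 + 1` the term `u v - m 1 v` equals `v`, and `v = K + 1` is too large once `m 3 ≤
  -- 0`.
  set K := c + m 0 * (m 1 + 1) + m 2 * |m 1 + 1| ^ p with hK
  have := hm (m 1 + 1) (K + 1)
  rw [affVal_skelPoint] at this
  have h2 : m 3 * |K + 1| ^ q ≤ 0 := mul_nonpos_of_nonpos_of_nonneg h (by positivity)
  nlinarith

theorem IsMajorant.pos_two (hm : IsMajorant p q c m) : 0 < m 2 := by
  by_contra! h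
  set K := c + m 1 * (m 0 + 1) + m 3 * |m 0 + 1| ^ q with hK
  have := hm (K + 1) (m 0 + 1)
  rw [affVal_skelPoint] at this
  have h2 : m 2 * |K + 1| ^ p ≤ 0 := mul_nonpos_of_nonpos_of_nonneg h (by positivity)
  nlinarith

theorem IsMajorant.mul_le (hm : IsMajorant p q c m) {x : Fin 4 → ℝ} (hx : x ∈ omegaC p q) :
    x 0 * x 1 ≤ affVal c m x := by
  have := hm (x 0) (x 1)
  rw [affVal_skelPoint] at this
  have h2 := mul_le_mul_of_nonneg_left hx.1 hm.pos_two.le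
  have h3 := mul_le_mul_of_nonneg_left hx.2 hm.pos_three.le
  rw [affVal]; linarith

theorem isMajorant_young (hpq : p.HolderConjugate q) {κ : ℝ} (hκ : 0 < κ) :
    IsMajorant p q 0 ![0, 0, κ / p, κ ^ (1 - q) / q] := by
  intro u v
  rw [affVal_skelPoint]
  simpa using young_le hpq hκ u v

theorem isClosed_setOf_isMajorant :
    IsClosed {l : ℝ × (Fin 4 → ℝ) | IsMajorant p q l.1 l.2} := by
  simp only [IsMajorant, ofPred_forall]
  refine isClosed_iInter fun u => isClosed_iInter fun v => ?_
  simp only [affVal_skelPoint]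
  exact isClosed_le continuous_const (by fun_prop)

/-- Over each interior point of `Ω_c` there is an optimal majorant. -/
theorem exists_optimal_majorant (hpq : p.HolderConjugate q) {x : Fin 4 → ℝ}
    (hx : x ∈ interior (omegaC p q)) :
    ∃ c m, IsMajorant p q c m ∧
      ∀ c' m', IsMajorant p q c' m' → affVal c m x ≤ affVal c' m' x := by
  set m₀ : Fin 4 → ℝ := ![0, 0, 1 / p, 1 ^ (1 - q) / q] with hm₀
  have hmaj₀ : IsMajorant p q 0 m₀ := isMajorant_young hpq one_pos
  set V := affVal 0 m₀ x with hV
  set S := {l : ℝ × (Fin 4 → ℝ) | IsMajorant p q l.1 l.2 ∧ affVal l.1 l.2 x ≤ V} with hS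
  have hcont : Continuous fun l : ℝ × (Fin 4 → ℝ) => affVal l.1 l.2 x := by
    unfold affVal; fun_prop
  have hclosed : IsClosed S := isClosed_setOf_isMajorant.inter (isClosed_le hcont continuous_const)
  obtain ⟨r, hr, hball⟩ := Metric.isOpen_iff.1 isOpen_interior x hx
  set K := (|x 0| + r) * (|x 1| + r) with hK
  have hlow : ∀ l ∈ S, ∀ y : Fin 4 → ℝ, dist y x < r → -K ≤ affVal l.1 l.2 y := by
    intro l hl y hy
    refine le_trans ?_ (hl.1.mul_le (interior_subset (hball hy)))
    have h : ∀ i, |y i| ≤ |x i| + r := by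
      intro i
      have h1 := dist_le_pi_dist y x i
      rw [Real.dist_eq] at h1
      have h2 : |y i| ≤ |y i - x i| + |x i| := by simpa using abs_add_le (y i - x i) (x i)
      linarith
    have := mul_le_mul (h 0) (h 1) (abs_nonneg _) (by positivity)
    rw [← abs_mul] at this
    exact (abs_le.1 this).1
  set M := (V + K) / (r / 2) with hM
  have hVK : 0 ≤ V + K := by
    have := hlow (0, m₀) ⟨hmaj₀, le_rfl⟩ x (by simpa using hr)
    simp only at this
    linarith
  have hM0 : 0 ≤ M := by positivity
  -- A shift by `±r/2` along one axis changes the value by `±m i * r/2`. The value stays above `-K`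
  -- and starts from at most `V`, so `m i` is bounded.
  have hmb : ∀ l ∈ S, ∀ i, |l.2 i| ≤ M := by
    intro l hl i
    have h1 := hlow l hl (x + Pi.single i (r / 2)) (by
      rw [dist_eq_norm, add_sub_cancel_left, Pi.norm_single, Real.norm_eq_abs,
        abs_of_pos (by positivity)]
      linarith)
    have h2 := hlow l hl (x + Pi.single i (-(r / 2))) (by
      rw [dist_eq_norm, add_sub_cancel_left, Pi.norm_single, Real.norm_eq_abs, abs_neg,
        abs_of_pos (by positivity)]
      linarith)
    have h3 : ∀ t, affVal l.1 l.2 (x + Pi.single i t) = affVal l.1 l.2 x + l.2 i * t := by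
      intro t
      fin_cases i <;> simp [affVal] <;> ring
    rw [h3] at h1 h2
    have h4 := hl.2
    rw [hM, le_div_iff₀ (by positivity)]
    have : |l.2 i * (r / 2)| ≤ V + K := abs_le.2 ⟨by linarith, by linarith⟩
    rwa [abs_mul, abs_of_pos (show 0 < r / 2 by positivity)] at this
  have hbdd : Bornology.IsBounded S := by
    rw [Metric.isBounded_iff_subset_closedBall (0 : ℝ × (Fin 4 → ℝ))]
    refine ⟨max (|V| + |K| + M * (|x 0| + |x 1| + |x 2| + |x 3|)) M, fun l hl => ?_⟩
    rw [mem_closedBall_zero_iff, Prod.norm_def]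
    refine max_le_max ?_ ((pi_norm_le_iff_of_nonneg hM0).2 fun i => hmb l hl i)
    have h1 := hlow l hl x (by simpa using hr)
    have h2 := hl.2
    have h3 : ∀ i, |l.2 i * x i| ≤ M * |x i| := fun i => by
      rw [abs_mul]; exact mul_le_mul_of_nonneg_right (hmb l hl i) (abs_nonneg _)
    have h30 := abs_le.1 (h3 0)
    have h31 := abs_le.1 (h3 1)
    have h32 := abs_le.1 (h3 2)
    have h33 := abs_le.1 (h3 3)
    have h4 := le_abs_self V
    have h5 := le_abs_self K
    have h6 := abs_nonneg V
    have h7 := abs_nonneg K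
    rw [affVal] at h1 h2
    rw [Real.norm_eq_abs, abs_le]
    constructor <;> linarith
  have hcomp : IsCompact S := Metric.isCompact_of_isClosed_isBounded hclosed hbdd
  obtain ⟨l, hl, hmin⟩ := hcomp.exists_isMinOn ⟨(0, m₀), hmaj₀, le_rfl⟩ hcont.continuousOn
  refine ⟨l.1, l.2, hl.1, fun c' m' h' => ?_⟩
  rcases le_total (affVal c' m' x) V with h | h
  · exact hmin (show (c', m') ∈ S from ⟨h', h⟩)
  · exact hl.2.trans h

theorem IsMajorant.exists_kappa (hpq : p.HolderConjugate q) (hm : IsMajorant p q c m) :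
    ∃ κ > 0, m 3 = κ ^ (1 - q) / q := by
  have hq := hpq.symm.pos
  have h3 := hm.pos_three
  have hq1 := hpq.symm.lt
  refine ⟨(q * m 3) ^ (1 / (1 - q)), by positivity, ?_⟩
  rw [← Real.rpow_mul (by positivity), one_div_mul_cancel (by linarith), Real.rpow_one]
  field_simp

/-- The minimum over `v` of the gap between the majorant and `u v`. -/
noncomputable def gapProfile (p κ c : ℝ) (m : Fin 4 → ℝ) (u : ℝ) : ℝ :=
  c + m 0 * u + m 2 * |u| ^ p - κ / p * |u - m 1| ^ p

theorem gap_eq (hpq : p.HolderConjugate q) {κ : ℝ} (hκ : 0 < κ) (h3 : m 3 = κ ^ (1 - q) / q)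
    (u : ℝ) : affVal c m (skelPoint p q u (κ * phiFun p (u - m 1))) -
      u * (κ * phiFun p (u - m 1)) = gapProfile p κ c m u := by
  have := young_value hpq hκ (u - m 1)
  rw [affVal_skelPoint, gapProfile, h3]; linarith

theorem gap_gt (hpq : p.HolderConjugate q) {κ : ℝ} (hκ : 0 < κ) (h3 : m 3 = κ ^ (1 - q) / q)
    {u v : ℝ} (hv : v ≠ κ * phiFun p (u - m 1)) :
    gapProfile p κ c m u < affVal c m (skelPoint p q u v) - u * v := by
  have := young_lt hpq hκ hv
  rw [affVal_skelPoint, gapProfile, h3]; linarith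

/-- Young's inequality with `w = u - m 1` minimizes the gap over `v`, at `v = κ * phiFun p (u - m
1)`; one variable remains. -/
theorem isMajorant_iff (hpq : p.HolderConjugate q) {κ : ℝ} (hκ : 0 < κ)
    (h3 : m 3 = κ ^ (1 - q) / q) : IsMajorant p q c m ↔ ∀ u, 0 ≤ gapProfile p κ c m u := by
  constructor
  · intro hm u
    rw [← gap_eq hpq hκ h3]
    linarith [hm u (κ * phiFun p (u - m 1))]
  · intro h u v
    rcases eq_or_ne v (κ * phiFun p (u - m 1)) with hv | hv
    · have := gap_eq (c := c) hpq hκ h3 u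
      rw [← hv] at this
      linarith [h u]
    · linarith [h u, gap_gt (c := c) hpq hκ h3 hv]

theorem IsMajorant.contact_iff (hpq : p.HolderConjugate q) {κ : ℝ} (hκ : 0 < κ)
    (h3 : m 3 = κ ^ (1 - q) / q) (hm : IsMajorant p q c m) {u v : ℝ} :
    u * v = affVal c m (skelPoint p q u v) ↔
      gapProfile p κ c m u = 0 ∧ v = κ * phiFun p (u - m 1) := by
  constructor
  · intro h
    have hv : v = κ * phiFun p (u - m 1) := by
      by_contra hv
      linarith [(isMajorant_iff hpq hκ h3).1 hm u, gap_gt (c := c) hpq hκ h3 hv]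
    refine ⟨?_, hv⟩
    rw [← gap_eq hpq hκ h3, ← hv]; linarith
  · rintro ⟨h, hv⟩
    rw [← gap_eq hpq hκ h3, ← hv] at h; linarith

/-- This is the tangent inequality for `ε |u|^p` at the point where its slope is `b`. -/
theorem exists_mul_le_rpow (hpq : p.HolderConjugate q) {ε : ℝ} (hε : 0 < ε) (b : ℝ) :
    ∃ C, ∀ u : ℝ, b * u - C ≤ ε * |u| ^ p := by
  set x := phiFun q (b / (ε * p)) with hx
  have hp := hpq.pos
  have h1 : phiFun p x = b / (ε * p) := phiFun_conj_phiFun hpq.symm _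
  refine ⟨b * x - ε * |x| ^ p, fun u => ?_⟩
  have := mul_le_mul_of_nonneg_left (abs_rpow_tangent_le hpq.lt x u) hε.le
  rw [h1] at this
  have h2 : ε * (p * (b / (ε * p)) * (u - x)) = b * (u - x) := by field_simp
  rw [mul_add, h2] at this
  linarith

/-- Young's inequality with some `κ₁` strictly between `κ` and `m 2 * p` leaves a positive surplus
of both powers, because `κ^(1-q)` decreases in `κ`. Half of the surplus absorbs the linear terms. -/
theorem gap_coercive (hpq : p.HolderConjugate q) {κ : ℝ} (hκ : 0 < κ)
    (h3 : m 3 = κ ^ (1 - q) / q) (h2 : κ < m 2 * p) (c : ℝ) :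
    ∃ ε > 0, ∃ K, ∀ u v : ℝ,
      ε * (|u| ^ p + |v| ^ q) - K ≤ affVal c m (skelPoint p q u v) - u * v := by
  have hp := hpq.pos
  have hq := hpq.symm.pos
  obtain ⟨κ₁, hκ₁, hκ₁'⟩ := exists_between h2
  have hκ₁0 : 0 < κ₁ := hκ.trans hκ₁
  have e1 : 0 < m 2 - κ₁ / p := by rw [sub_pos, div_lt_iff₀ hp]; exact hκ₁'
  have e2 : 0 < m 3 - κ₁ ^ (1 - q) / q := by
    rw [sub_pos, h3]
    exact div_lt_div_of_pos_right
      (Real.rpow_lt_rpow_of_neg hκ hκ₁ (by linarith [hpq.symm.lt])) hq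
  set ε := min (m 2 - κ₁ / p) (m 3 - κ₁ ^ (1 - q) / q) / 2 with hε
  have hε0 : 0 < ε := by positivity
  obtain ⟨C₁, hC₁⟩ := exists_mul_le_rpow hpq hε0 (-m 0)
  obtain ⟨C₂, hC₂⟩ := exists_mul_le_rpow hpq.symm hε0 (-m 1)
  refine ⟨ε, hε0, C₁ + C₂ - c, fun u v => ?_⟩
  have h1 := hC₁ u
  have h2 := hC₂ v
  have h4 := young_le hpq hκ₁0 u v
  have m1 : 2 * ε ≤ m 2 - κ₁ / p := by
    rw [hε]; linarith [min_le_left (m 2 - κ₁ / p) (m 3 - κ₁ ^ (1 - q) / q)]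
  have m2 : 2 * ε ≤ m 3 - κ₁ ^ (1 - q) / q := by
    rw [hε]; linarith [min_le_right (m 2 - κ₁ / p) (m 3 - κ₁ ^ (1 - q) / q)]
  have h5 := mul_le_mul_of_nonneg_right m1 (Real.rpow_nonneg (abs_nonneg u) p)
  have h6 := mul_le_mul_of_nonneg_right m2 (Real.rpow_nonneg (abs_nonneg v) q)
  rw [affVal_skelPoint]
  nlinarith

theorem le_one_add_abs_rpow {r : ℝ} (hr : 1 ≤ r) (u : ℝ) : |u| ≤ 1 + |u| ^ r := by
  rcases le_total |u| 1 with h | h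
  · linarith [Real.rpow_nonneg (abs_nonneg u) r]
  · have := Real.rpow_le_rpow_of_exponent_le h hr
    rw [Real.rpow_one] at this; linarith

/-- A nonnegative function stays nonnegative on a compact set under a small perturbation that is
positive on its zero set. -/
theorem IsCompact.exists_pos_forall_add_mul_nonneg {X : Type*} [TopologicalSpace X] {k : Set X}
    (hk : IsCompact k) {f g : X → ℝ} (hf : Continuous f) (hg : Continuous g)
    (hf0 : ∀ z ∈ k, 0 ≤ f z) (hfg : ∀ z ∈ k, f z = 0 → 0 < g z) :
    ∃ δ₀ > 0, ∀ δ, 0 < δ → δ ≤ δ₀ → ∀ z ∈ k, 0 ≤ f z + δ * g z := by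
  have hk' : IsCompact (k ∩ {z | g z ≤ 0}) := hk.inter_right (isClosed_le hg continuous_const)
  rcases (k ∩ {z | g z ≤ 0}).eq_empty_or_nonempty with h | h
  · refine ⟨1, one_pos, fun δ hδ _ z hz => ?_⟩
    have : 0 < g z := by
      by_contra! hle
      exact (h ▸ (⟨hz, hle⟩ : z ∈ k ∩ {z | g z ≤ 0}) : z ∈ (∅ : Set X))
    have := hf0 z hz
    positivity
  · obtain ⟨a, ha, hamin⟩ := hk'.exists_isMinOn h hf.continuousOn
    obtain ⟨b, hb, hbmin⟩ := hk'.exists_isMinOn h hg.continuousOn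
    have hfa : 0 < f a := lt_of_le_of_ne (hf0 a ha.1) fun h0 =>
      (hfg a ha.1 h0.symm).not_ge ha.2
    have hgb : g b ≤ 0 := hb.2
    -- The `1` keeps the denominator positive also when the minimum `g b` is `0`.
    refine ⟨f a / (1 - g b), div_pos hfa (by linarith), fun δ hδ hδ' z hz => ?_⟩
    rcases le_or_gt (g z) 0 with hgz | hgz
    · have h1 : f a ≤ f z := hamin ⟨hz, hgz⟩
      have h2 : g b ≤ g z := hbmin ⟨hz, hgz⟩
      rw [le_div_iff₀ (by linarith)] at hδ'
      nlinarith
    · have := hf0 z hz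
      positivity

theorem strongDual_apply (f : StrongDual ℝ (Fin 4 → ℝ)) (x : Fin 4 → ℝ) (s : ℝ) :
    f x - s = affVal (-s) (fun i => f (Pi.single i 1)) x := by
  have h1 : x = ∑ i, x i • Pi.single i (1 : ℝ) := by
    ext j
    simp [Finset.sum_apply, Pi.single_apply]
  have h2 : f x = ∑ i, x i * f (Pi.single i 1) := by
    nth_rewrite 1 [h1]
    rw [map_sum]
    simp
  rw [h2, Fin.sum_univ_four, affVal]; ring

theorem affVal_add_mul (c c' δ : ℝ) (m m' x : Fin 4 → ℝ) :
    affVal (c + δ * c') (fun i => m i + δ * m' i) x = affVal c m x + δ * affVal c' m' x := by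
  simp only [affVal]; ring

/-- A coercive majorant can be improved outside the convex hull of its contact set. -/
theorem exists_better_majorant_of_coercive (hpq : p.HolderConjugate q) {κ : ℝ} (hκ : 0 < κ)
    (h3 : m 3 = κ ^ (1 - q) / q) (h2 : κ < m 2 * p) (hm : IsMajorant p q c m)
    (hfin : (contactSet p q c m).Finite) {y : Fin 4 → ℝ} (hy : y ∉ convexHull ℝ (contactSet p q c m)) :
    ∃ c' m', IsMajorant p q c' m' ∧ affVal c' m' y < affVal c m y := by
  obtain ⟨ε, hε, K, hK⟩ := gap_coercive hpq hκ h3 h2 c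
  -- Finiteness of the contact set makes its hull closed, so `y` can be strictly separated from it.
  -- A small multiple of the separating functional is added to the majorant.
  obtain ⟨f, s, hfy, hfb⟩ := geometric_hahn_banach_point_closed (convex_convexHull ℝ _)
    (hfin.isClosed_convexHull ℝ) hy
  set m' : Fin 4 → ℝ := fun i => f (Pi.single i 1) with hm'
  have hneg : affVal (-s) m' y < 0 := by rw [← strongDual_apply]; linarith
  have hpos : ∀ u v, u * v = affVal c m (skelPoint p q u v) →
      0 < affVal (-s) m' (skelPoint p q u v) := by
    intro u v h
    have := hfb _ (subset_convexHull ℝ _ (⟨u, v, rfl, h⟩ : skelPoint p q u v ∈ contactSet p q c m))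
    rw [← strongDual_apply]; linarith
  set C := |s| + |m' 0| + |m' 1| + |m' 2| + |m' 3| with hC
  have hC0 : 0 ≤ C := by positivity
  have hlow : ∀ u v : ℝ, -(C * (2 + (|u| ^ p + |v| ^ q))) ≤ affVal (-s) m' (skelPoint p q u v) := by
    intro u v
    have h3 := le_one_add_abs_rpow hpq.lt.le u
    have h4 := le_one_add_abs_rpow hpq.symm.lt.le v
    have h5 := Real.rpow_nonneg (abs_nonneg u) p
    have h6 := Real.rpow_nonneg (abs_nonneg v) q
    set W := 2 + (|u| ^ p + |v| ^ q) with hW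
    have b : ∀ t w : ℝ, |w| ≤ W → -(|t| * W) ≤ t * w := by
      intro t w hw
      have h1 := neg_abs_le (t * w)
      rw [abs_mul] at h1
      have h2 := mul_le_mul_of_nonneg_left hw (abs_nonneg t)
      linarith
    have b0 := b (m' 0) u (by linarith)
    have b1 := b (m' 1) v (by linarith)
    have b2 := b (m' 2) (|u| ^ p) (by rw [abs_of_nonneg h5]; linarith)
    have b3 := b (m' 3) (|v| ^ q) (by rw [abs_of_nonneg h6]; linarith)
    have b4 := b (-s) 1 (by rw [abs_one]; linarith)
    rw [abs_neg] at b4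
    rw [affVal_skelPoint, hC]
    linarith
  -- Beyond this radius the coercive lower bound exceeds the loss, which is at most `ε/2 * (2 + W)`
  -- for the `δ` chosen below.
  set r := 2 * (|K| + 2 * ε) / ε with hr
  set Z := {z : ℝ × ℝ | |z.1| ^ p + |z.2| ^ q ≤ r} with hZ
  have hZc : IsCompact Z := by
    have g1 := continuous_abs_rpow hpq.pos.le
    have g2 := continuous_abs_rpow hpq.symm.pos.le
    refine Metric.isCompact_of_isClosed_isBounded (isClosed_le
      ((g1.comp continuous_fst).add (g2.comp continuous_snd)) continuous_const) ?_
    rw [Metric.isBounded_iff_subset_closedBall (0 : ℝ × ℝ)]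
    refine ⟨1 + r, fun z hz => ?_⟩
    have hz' : |z.1| ^ p + |z.2| ^ q ≤ r := hz
    have h3 := le_one_add_abs_rpow hpq.lt.le z.1
    have h4 := le_one_add_abs_rpow hpq.symm.lt.le z.2
    have h5 := Real.rpow_nonneg (abs_nonneg z.1) p
    have h6 := Real.rpow_nonneg (abs_nonneg z.2) q
    rw [mem_closedBall_zero_iff, Prod.norm_def, Real.norm_eq_abs, Real.norm_eq_abs]
    exact max_le (by linarith) (by linarith)
  have hcont : ∀ (c : ℝ) (m : Fin 4 → ℝ),
      Continuous fun z : ℝ × ℝ => affVal c m (skelPoint p q z.1 z.2) := by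
    intro c m
    have := continuous_skelPoint hpq
    unfold affVal
    fun_prop
  obtain ⟨δ₀, hδ₀, hδ⟩ := hZc.exists_pos_forall_add_mul_nonneg
    (f := fun z => affVal c m (skelPoint p q z.1 z.2) - z.1 * z.2)
    (g := fun z => affVal (-s) m' (skelPoint p q z.1 z.2)) ((hcont c m).sub (by fun_prop))
    (hcont (-s) m') (fun z _ => sub_nonneg.2 (hm _ _))
    (fun z _ hz => hpos _ _ (by linarith))
  set δ := min δ₀ (ε / (2 * (C + 1))) with hδdef
  have hδ0 : 0 < δ := by positivity
  refine ⟨c + δ * (-s), fun i => m i + δ * m' i, fun u v => ?_, ?_⟩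
  · rw [affVal_add_mul]
    by_cases hz : (u, v) ∈ Z
    · have := hδ δ hδ0 (min_le_left _ _) (u, v) hz
      simp only at this
      linarith
    · have hz' : r < |u| ^ p + |v| ^ q := not_le.1 hz
      have h1 := hK u v
      have h2 := hlow u v
      set W := |u| ^ p + |v| ^ q with hW
      have h3 : δ * (C + 1) ≤ ε / 2 := by
        have := min_le_right δ₀ (ε / (2 * (C + 1)))
        rw [← hδdef, le_div_iff₀ (by positivity)] at this
        linarith
      rw [hr, div_lt_iff₀ hε] at hz'
      have h4 := le_abs_self K
      have h5 := mul_le_mul_of_nonneg_left h2 hδ0.le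
      have hr0 : 0 ≤ W := by positivity
      have h6 : δ * (C * (2 + W)) ≤ ε / 2 * (2 + W) := by
        have : δ * C ≤ ε / 2 := by nlinarith
        rw [← mul_assoc]
        exact mul_le_mul_of_nonneg_right this (by linarith)
      linarith
  · rw [affVal_add_mul]
    have := mul_neg_of_pos_of_neg hδ0 hneg
    linarith

end Majorant

/-! ### The region bounded by a closed curve that contains the frontier of a convex set -/

/-- From a point outside `S` the ray pointing away from a point of `S` never meets `S`, so its
component is unbounded. A component that starts in `S` off `Γ` starts in the interior and cannot
leave, since the frontier lies in `Γ`. -/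
theorem regionBoundedBy_eq_of_convex {S Γ : Set (ℝ × ℝ)} (hc : IsCompact S) (hconv : Convex ℝ S)
    (hne : S.Nonempty) (hfr : frontier S ⊆ Γ) (hΓ : Γ ⊆ S) : regionBoundedBy Γ = S := by
  ext y
  constructor
  · intro hy
    by_contra hyS
    obtain ⟨s, hs⟩ := hne
    have hys : y - s ≠ 0 := by
      intro h
      rw [sub_eq_zero] at h
      exact hyS (h ▸ hs)
    set ray : ℝ → ℝ × ℝ := fun r => y + r • (y - s) with hray
    have hcont : Continuous ray := by fun_prop
    have hpre : IsPreconnected (ray '' Ici 0) := isPreconnected_Ici.image _ hcont.continuousOn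
    have hout : ray '' Ici 0 ⊆ Γᶜ := by
      rintro _ ⟨r, hr, rfl⟩ hmem
      have hr0 : (0 : ℝ) ≤ r := hr
      apply hyS
      -- `y` is the convex combination of the ray point and `s` with these weights, so a ray point
      -- in `S` would put `y` into `S`.
      have h1 := hconv (hΓ hmem) hs (a := 1 / (1 + r)) (b := r / (1 + r)) (by positivity)
        (by positivity) (by field_simp)
      convert h1 using 1
      ext <;> simp [hray] <;> field_simp <;> ring
    have hsub := hpre.subset_connectedComponentIn (x := y) ⟨0, by simp, by simp [hray]⟩ hout
    have hb : Bornology.IsBounded (ray '' Ici 0) := Bornology.IsBounded.subset hy hsub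
    obtain ⟨C, hC⟩ := hb.exists_norm_le
    have hpos : 0 < ‖y - s‖ := norm_pos_iff.2 hys
    have hC0 : 0 ≤ C := (norm_nonneg _).trans (hC (ray 0) ⟨0, by simp, rfl⟩)
    set r := (C + ‖y‖ + 1) / ‖y - s‖ with hr
    have hr0 : 0 ≤ r := by positivity
    have h1 := hC (ray r) ⟨r, hr0, rfl⟩
    have h2 : ‖r • (y - s)‖ ≤ ‖ray r‖ + ‖y‖ := by
      have := norm_sub_le (ray r) y
      simpa [hray] using this
    rw [norm_smul, Real.norm_eq_abs, abs_of_nonneg hr0, hr, div_mul_cancel₀ _ hpos.ne'] at h2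
    linarith
  · intro hy
    show Bornology.IsBounded (connectedComponentIn Γᶜ y)
    by_cases hyΓ : y ∈ Γ
    · rw [connectedComponentIn_eq_empty (by simpa using hyΓ)]
      exact Bornology.isBounded_empty
    · refine hc.isBounded.subset ?_
      have hpre : IsPreconnected (connectedComponentIn Γᶜ y) := isPreconnected_connectedComponentIn
      have hint : ∀ z ∈ Γᶜ, z ∈ S → z ∈ interior S := by
        intro z hz hzS
        by_contra h
        exact hz (hfr ⟨subset_closure hzS, h⟩)
      have hsub : connectedComponentIn Γᶜ y ⊆ Γᶜ := connectedComponentIn_subset _ _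
      refine Subset.trans (hpre.subset_left_of_subset_union isOpen_interior
        hc.isClosed.isOpen_compl ?_ (fun z hz => ?_) ⟨y, ?_, hint y hyΓ hy⟩) interior_subset
      · exact disjoint_compl_right.mono_left interior_subset
      · by_cases hzS : z ∈ S
        · exact Or.inl (hint z (hsub hz) hzS)
        · exact Or.inr hzS
      · exact mem_connectedComponentIn hyΓ

/-! ### The convex hull of the curve `γ_t` -/

section Hull

variable {p q t : ℝ}

theorem gammaCurve_eq (hpq : p.HolderConjugate q) (ht : 0 < t) :
    gammaCurve p q t = range fun u => skelPoint p q u (p * t * phiFun p u) := by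
  have hκ : 0 < p * t := mul_pos hpq.pos ht
  rw [gammaCurve]
  congr 1
  funext u
  rw [skelPoint, abs_smul_phiFun_rpow hpq hκ, mul_comm ((p * t) ^ q)]

/-- The point of the cone over the plane region. -/
noncomputable def slicePoint (p q t : ℝ) (y : ℝ × ℝ) : Fin 4 → ℝ :=
  ![y.1, p * t * y.2, 1, (p * t) ^ q]

/-- The section of the convex hull of `γ_t` by `x₃ = 1`, in normalized coordinates. -/
def hullSlice (p q t : ℝ) : Set (ℝ × ℝ) :=
  {y | slicePoint p q t y ∈ convexHull ℝ (gammaCurve p q t)}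

theorem gamma_hull_coord {x : Fin 4 → ℝ}
    (hx : x ∈ convexHull ℝ (gammaCurve p q t)) : x 3 = (p * t) ^ q * x 2 := by
  have : gammaCurve p q t ⊆ {x | x 3 = (p * t) ^ q * x 2} := by
    rintro _ ⟨u, rfl⟩
    simp [mul_comm]
  refine convexHull_min this ?_ hx
  intro x hx y hy a b _ _ _
  have hx' : x 3 = _ := hx
  have hy' : y 3 = _ := hy
  simp only [mem_ofPred_eq, Pi.add_apply, Pi.smul_apply, smul_eq_mul, hx', hy']
  ring

theorem gamma_hull_functional (ht : p * t ≠ 0) {a₀ a₁ a₂ : ℝ}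
    (ha : ∀ u, 0 ≤ |u| ^ p + a₂ * phiFun p u + a₁ * u + a₀) {x : Fin 4 → ℝ}
    (hx : x ∈ convexHull ℝ (gammaCurve p q t)) :
    0 ≤ x 2 + a₂ * (x 1 / (p * t)) + a₁ * x 0 + a₀ := by
  have : gammaCurve p q t ⊆ {x | 0 ≤ x 2 + a₂ * (x 1 / (p * t)) + a₁ * x 0 + a₀} := by
    rintro _ ⟨u, rfl⟩
    have h1 : p * t * phiFun p u / (p * t) = phiFun p u := mul_div_cancel_left₀ _ ht
    simpa [h1] using ha u
  refine convexHull_min this ?_ hx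
  intro x hx y hy a b ha hb hab
  have hx' : 0 ≤ x 2 + a₂ * (x 1 / (p * t)) + a₁ * x 0 + a₀ := hx
  have hy' : 0 ≤ y 2 + a₂ * (y 1 / (p * t)) + a₁ * y 0 + a₀ := hy
  have h1 := mul_nonneg ha hx'
  have h2 := mul_nonneg hb hy'
  simp only [mem_ofPred_eq, Pi.add_apply, Pi.smul_apply, smul_eq_mul]
  have h3 : b = 1 - a := by linarith
  subst h3
  refine (add_nonneg h1 h2).trans_eq ?_
  ring

/-- Since `phiFun` is multiplicative, the linear map shown here sends the curve point with parameter
`u` to the one with parameter `s * u`. Hence the hull is a weighted cone, and `s = -1` gives its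
symmetry. -/
theorem gamma_hull_scale {x : Fin 4 → ℝ} (hx : x ∈ convexHull ℝ (gammaCurve p q t)) (s : ℝ) :
    ![s * x 0, phiFun p s * x 1, |s| ^ p * x 2, |s| ^ p * x 3] ∈
      convexHull ℝ (gammaCurve p q t) := by
  have : gammaCurve p q t ⊆ {x | ![s * x 0, phiFun p s * x 1, |s| ^ p * x 2, |s| ^ p * x 3] ∈
      convexHull ℝ (gammaCurve p q t)} := by
    rintro _ ⟨u, rfl⟩
    apply subset_convexHull
    refine ⟨s * u, ?_⟩
    simp only [phiFun_mul, abs_mul, Real.mul_rpow (abs_nonneg s) (abs_nonneg u)]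
    ext i
    fin_cases i <;> simp <;> ring
  refine convexHull_min this ?_ hx
  intro x hx y hy a b ha hb hab
  have := convex_convexHull ℝ (gammaCurve p q t) hx hy ha hb hab
  simp only [mem_ofPred_eq]
  convert this using 1
  ext i
  fin_cases i <;> simp <;> ring

theorem gamma_hull_subset (hpq : p.HolderConjugate q) (ht : 0 < t) :
    convexHull ℝ (gammaCurve p q t) ⊆ omegaC p q := by
  refine convexHull_min ?_ (convex_omegaC hpq)
  rw [gammaCurve_eq hpq ht]
  rintro _ ⟨u, rfl⟩
  exact skelPoint_mem_omegaC _ _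

theorem skelPoint_mem_gamma_hull (hpq : p.HolderConjugate q) (ht : 0 < t) (u : ℝ) :
    skelPoint p q u (p * t * phiFun p u) ∈ convexHull ℝ (gammaCurve p q t) := by
  apply subset_convexHull
  rw [gammaCurve_eq hpq ht]
  exact ⟨u, rfl⟩

theorem convex_hullSlice : Convex ℝ (hullSlice p q t) := by
  intro x hx y hy a b ha hb hab
  have := convex_convexHull ℝ (gammaCurve p q t) hx hy ha hb hab
  rw [hullSlice, mem_ofPred_eq]
  convert this using 1
  have h3 : b = 1 - a := by linarith
  subst h3
  ext i
  fin_cases i <;> simp [slicePoint] <;> ring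

theorem neg_mem_hullSlice {y : ℝ × ℝ} (hy : y ∈ hullSlice p q t) : -y ∈ hullSlice p q t := by
  have := gamma_hull_scale hy (-1)
  rw [hullSlice, mem_ofPred_eq]
  convert this using 1
  ext i
  fin_cases i <;> simp [slicePoint, phiFun_neg, phiFun_one]

theorem abs_le_one_of_slicePoint (hpq : p.HolderConjugate q) (ht : 0 < t) {y : ℝ × ℝ}
    (hy : slicePoint p q t y ∈ omegaC p q) : |y.1| ≤ 1 ∧ |y.2| ≤ 1 := by
  have hκ : 0 < p * t := mul_pos hpq.pos ht
  obtain ⟨h1, h2⟩ := hy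
  simp only [slicePoint, Matrix.cons_val] at h1 h2
  constructor
  · by_contra! h
    exact absurd h1 (not_le.2 (Real.one_lt_rpow h hpq.pos))
  · by_contra! h
    rw [abs_mul, abs_of_pos hκ] at h2
    have : p * t < p * t * |y.2| := by nlinarith
    exact absurd h2 (not_le.2 (Real.rpow_lt_rpow hκ.le this hpq.symm.pos))

end Hull

/-! ### The boundary of the section of the hull of `γ_t` -/

section Slice

variable {p q t r : ℝ}

/-- For `s = w^(-1/p)` one has `phiFun p s = w^(-1/q)`, so both denominators of `η` come from a
single weighted dilation. Using `id` for `ρ` is harmless, as only the value `ρ r = r` enters. -/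
theorem etaFun_critical (hpq : p.HolderConjugate q) (hr : 0 < r) {τ : ℝ} (hτ : τ ∈ Icc (0 : ℝ) 1) :
    ∃ s > 0, |s| ^ p * (τ + (1 - τ) * |r| ^ p) = 1 ∧
      etaFun p q id τ r = (s * (-τ + (1 - τ) * r), phiFun p s * (-τ + (1 - τ) * phiFun p r)) := by
  have hp := hpq.pos
  have hw : 0 < τ + (1 - τ) * |r| ^ p := by
    have h1 : 0 < |r| ^ p := by positivity
    rcases hτ.1.eq_or_lt with h | h
    · rw [← h]; linarith
    · have := mul_nonneg (sub_nonneg.2 hτ.2) h1.le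
      linarith
  set w := τ + (1 - τ) * |r| ^ p with hwdef
  have hs : 0 < w ^ (-(1 / p)) := by positivity
  refine ⟨w ^ (-(1 / p)), hs, ?_, ?_⟩
  · rw [abs_of_pos hs, ← Real.rpow_mul hw.le]
    have : -(1 / p) * p = -1 := by field_simp
    rw [this, Real.rpow_neg_one, inv_mul_cancel₀ hw.ne']
  · have h1 : phiFun p (w ^ (-(1 / p))) = w ^ (-(1 / q)) := by
      rw [phiFun_of_pos hs, ← Real.rpow_mul hw.le]
      congr 1
      have := hpq.inv_add_inv_eq_one
      have h2 : q⁻¹ = 1 - p⁻¹ := by linarith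
      rw [one_div, one_div, h2]
      field_simp
    rw [h1, etaFun, Real.rpow_neg hw.le, Real.rpow_neg hw.le]
    simp only [id]
    rw [abs_of_pos hr] at hwdef
    rw [abs_of_pos hr, ← hwdef]
    simp only [div_eq_mul_inv, one_mul]
    rw [mul_comm, mul_comm (-τ + (1 - τ) * phiFun p r)]

theorem etaFun_zero_critical (hpq : p.HolderConjugate q) (hr : 0 < r) :
    etaFun p q id 0 r = (1, 1) := by
  obtain ⟨s, hs, h1, h2⟩ := etaFun_critical hpq hr (τ := 0) (by simp)
  have h3 : |s * r| ^ p = 1 := by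
    rw [abs_mul, Real.mul_rpow (abs_nonneg _) (abs_nonneg _)]; linarith
  have h4 : s * r = 1 := by
    have h5 : 0 < s * r := by positivity
    rw [abs_of_pos h5] at h3
    exact (Real.rpow_left_inj h5.le zero_le_one hpq.ne_zero).1 (h3.trans (Real.one_rpow p).symm)
  rw [h2]
  have h6 : phiFun p s * phiFun p r = 1 := by rw [← phiFun_mul, h4, phiFun_one]
  ext <;> simp [h4, h6]

theorem etaFun_one_critical (hpq : p.HolderConjugate q) (hr : 0 < r) :
    etaFun p q id 1 r = (-1, -1) := by
  obtain ⟨s, hs, h1, h2⟩ := etaFun_critical hpq hr (τ := 1) (by simp)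
  have h4 : s = 1 := by
    rw [abs_of_pos hs] at h1
    simp at h1
    exact (Real.rpow_left_inj hs.le zero_le_one hpq.ne_zero).1 (h1.trans (Real.one_rpow p).symm)
  rw [h2, h4, phiFun_one]
  simp

/-- The point lies on the segment between the curve points with parameters `-s` and `s * r`. -/
theorem etaFun_mem_hullSlice (hpq : p.HolderConjugate q) (hr : 0 < r) {τ : ℝ}
    (hτ : τ ∈ Icc (0 : ℝ) 1) : etaFun p q id τ r ∈ hullSlice p q t := by
  obtain ⟨s, hs, h1, h2⟩ := etaFun_critical hpq hr hτ
  rw [h2, hullSlice, mem_ofPred_eq]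
  have m1 : ![-s, p * t * phiFun p (-s), |-s| ^ p, |-s| ^ p * (p * t) ^ q] ∈
      convexHull ℝ (gammaCurve p q t) := subset_convexHull ℝ _ ⟨-s, rfl⟩
  have m2 : ![s * r, p * t * phiFun p (s * r), |s * r| ^ p, |s * r| ^ p * (p * t) ^ q] ∈
      convexHull ℝ (gammaCurve p q t) := subset_convexHull ℝ _ ⟨s * r, rfl⟩
  have := convex_convexHull ℝ (gammaCurve p q t) m1 m2 hτ.1 (sub_nonneg.2 hτ.2) (by ring)
  convert this using 1
  rw [phiFun_neg, phiFun_mul, abs_neg, abs_mul, Real.mul_rpow (abs_nonneg _) (abs_nonneg _)]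
  ext i
  fin_cases i
  · simp [slicePoint]; ring
  · simp [slicePoint]; ring
  · simp [slicePoint]; linarith
  · simp [slicePoint]; linear_combination -(p * t) ^ q * h1

theorem functional_scale (hp : p ≠ 0) {a₀ a₁ a₂ : ℝ}
    (ha : ∀ u, 0 ≤ |u| ^ p + a₂ * phiFun p u + a₁ * u + a₀) {s : ℝ} (hs : 0 < s) (u : ℝ) :
    0 ≤ |u| ^ p + a₂ * s * phiFun p u + a₁ * phiFun p s * u + a₀ * |s| ^ p := by
  have hsφ := mul_phiFun hp s
  have h3 : u = s * (u / s) := by field_simp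
  have h4 := mul_nonneg (Real.rpow_nonneg (abs_nonneg s) p) (ha (u / s))
  have h5 : |u| ^ p = |s| ^ p * |u / s| ^ p := by
    rw [← Real.mul_rpow (abs_nonneg _) (abs_nonneg _), ← abs_mul, ← h3]
  have h6 : phiFun p u = phiFun p s * phiFun p (u / s) := by rw [← phiFun_mul, ← h3]
  rw [h5, h6]
  refine h4.trans_eq ?_
  rw [h3]
  have h7 : s * (u / s) / s = u / s := by rw [← h3]
  rw [h7]
  linear_combination -(a₂ * phiFun p (u / s) + a₁ * (u / s)) * hsφ

/-- The dilate by `s` of the critical functional vanishes at the curve points with parameters `-s`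
and `s * r`, hence on the segment that contains `η(τ, r)`. The sign of `a₁` tells on which side the
slice lies. -/
theorem exists_touching_functional (hp : 2 < p) (hpq : p.HolderConjugate q)
    (hr : IsCriticalR p r) {τ : ℝ} (hτ : τ ∈ Icc (0 : ℝ) 1) :
    ∃ a₀ a₁ a₂ : ℝ, (∀ u, 0 ≤ |u| ^ p + a₂ * phiFun p u + a₁ * u + a₀) ∧ a₁ < 0 ∧
      1 + a₂ * (etaFun p q id τ r).2 + a₁ * (etaFun p q id τ r).1 + a₀ = 0 := by
  obtain ⟨n, c₁, c₀, hn, hc₁, hN, hN0⟩ := exists_critical_functional hp hr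
  obtain ⟨s, hs, h1, h2⟩ := etaFun_critical hpq hr.1.1 hτ
  have hsφ := mul_phiFun hpq.ne_zero s
  refine ⟨c₀ * |s| ^ p, c₁ * phiFun p s, n * s,
    functional_scale hpq.ne_zero hN hs, mul_neg_of_neg_of_pos hc₁ (phiFun_pos hs), ?_⟩
  · have e1 := (hN0 (-1)).2 (Or.inl rfl)
    have e2 := (hN0 r).2 (Or.inr rfl)
    rw [phiFun_neg, phiFun_one, abs_neg, abs_one, Real.one_rpow] at e1
    rw [h2]
    simp only
    linear_combination |s| ^ p * τ * e1 + |s| ^ p * (1 - τ) * e2 - h1 +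
      (n * (-τ + (1 - τ) * phiFun p r) + c₁ * (-τ + (1 - τ) * r)) * hsφ

theorem nonneg_reflect {a₀ a₁ a₂ : ℝ}
    (ha : ∀ u, 0 ≤ |u| ^ p + a₂ * phiFun p u + a₁ * u + a₀) (u : ℝ) :
    0 ≤ |u| ^ p + -a₂ * phiFun p u + -a₁ * u + a₀ := by
  have := ha (-u)
  rw [phiFun_neg, abs_neg] at this
  linarith

theorem exists_etaFun_snd_eq (hpq : p.HolderConjugate q) (hr : 0 < r) {b : ℝ} (hb : |b| ≤ 1) :
    ∃ τ ∈ Icc (0 : ℝ) 1, (etaFun p q id τ r).2 = b := by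
  have hb' := abs_le.1 hb
  have hc : ContinuousOn (fun τ => (etaFun p q id τ r).2) (Icc 0 1) := by
    simp only [etaFun]
    have hpos : ∀ τ ∈ Icc (0 : ℝ) 1, 0 < τ + (1 - τ) * |r| ^ p := by
      intro τ hτ
      have h1 : 0 < |r| ^ p := by positivity
      rcases hτ.1.eq_or_lt with h | h
      · rw [← h]; linarith
      · have := mul_nonneg (sub_nonneg.2 hτ.2) h1.le
        linarith
    refine ContinuousOn.div (by fun_prop) ?_ fun τ hτ => (Real.rpow_pos_of_pos (hpos τ hτ) _).ne'
    exact ContinuousOn.rpow_const (by fun_prop) fun τ hτ => Or.inl (hpos τ hτ).ne'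
  refine intermediate_value_Icc' zero_le_one hc ?_
  rw [etaFun_zero_critical hpq hr, etaFun_one_critical hpq hr]
  exact hb'

/-- Points with ordinate in `[-1, 1]` that violate no linear inequality valid on the curve lie
between the two boundary curves. -/
theorem between_or_exists_neg (hp : 2 < p) (hpq : p.HolderConjugate q) (hr : IsCriticalR p r)
    {y : ℝ × ℝ} (hy : |y.2| ≤ 1) :
    (∃ τ ∈ Icc (0 : ℝ) 1, ∃ τ' ∈ Icc (0 : ℝ) 1, (etaFun p q id τ r).2 = y.2 ∧
      -(etaFun p q id τ' r).2 = y.2 ∧ -(etaFun p q id τ' r).1 ≤ y.1 ∧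
      y.1 ≤ (etaFun p q id τ r).1) ∨
    ∃ a₀ a₁ a₂ : ℝ, (∀ u, 0 ≤ |u| ^ p + a₂ * phiFun p u + a₁ * u + a₀) ∧
      1 + a₂ * y.2 + a₁ * y.1 + a₀ < 0 := by
  obtain ⟨τ, hτ, h1⟩ := exists_etaFun_snd_eq hpq hr.1.1 hy
  obtain ⟨τ', hτ', h2⟩ := exists_etaFun_snd_eq hpq hr.1.1 (b := -y.2) (by rwa [abs_neg])
  by_cases h3 : -(etaFun p q id τ' r).1 ≤ y.1
  · by_cases h4 : y.1 ≤ (etaFun p q id τ r).1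
    · exact Or.inl ⟨τ, hτ, τ', hτ', h1, by linarith, h3, h4⟩
    · right
      -- `y` lies to the right of the touching point at the same height, and `a₁ < 0` makes the
      -- functional negative there.
      obtain ⟨a₀, a₁, a₂, ha, ha₁, h0⟩ := exists_touching_functional hp hpq hr hτ
      refine ⟨a₀, a₁, a₂, ha, ?_⟩
      rw [h1] at h0
      nlinarith
  · right
    obtain ⟨a₀, a₁, a₂, ha, ha₁, h0⟩ := exists_touching_functional hp hpq hr hτ'
    refine ⟨a₀, -a₁, -a₂, nonneg_reflect ha, ?_⟩
    rw [h2] at h0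
    nlinarith

theorem mem_hullSlice_of_between (hpq : p.HolderConjugate q) (hr : 0 < r) {y : ℝ × ℝ} {τ τ' : ℝ}
    (hτ : τ ∈ Icc (0 : ℝ) 1) (hτ' : τ' ∈ Icc (0 : ℝ) 1) (h1 : (etaFun p q id τ r).2 = y.2)
    (h2 : -(etaFun p q id τ' r).2 = y.2) (h3 : -(etaFun p q id τ' r).1 ≤ y.1)
    (h4 : y.1 ≤ (etaFun p q id τ r).1) : y ∈ hullSlice p q t := by
  have m1 := etaFun_mem_hullSlice (t := t) hpq hr hτ
  have m2 := neg_mem_hullSlice (etaFun_mem_hullSlice (t := t) hpq hr hτ')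
  set a := (etaFun p q id τ r).1 with ha
  set b := -(etaFun p q id τ' r).1 with hb
  rcases (h3.trans h4).eq_or_lt with h | h
  · have : y = etaFun p q id τ r := by
      ext
      · exact le_antisymm h4 (by linarith)
      · exact h1.symm
    rw [this]; exact m1
  · have hab : 0 < a - b := sub_pos.2 h
    have := convex_hullSlice m1 m2 (a := (y.1 - b) / (a - b)) (b := (a - y.1) / (a - b))
      (div_nonneg (by linarith) hab.le) (div_nonneg (by linarith) hab.le) (by field_simp; ring)
    convert this using 1
    ext
    · simp only [Prod.fst_add, Prod.smul_fst, Prod.fst_neg, smul_eq_mul, ← ha, ← hb]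
      field_simp
      ring
    · simp only [Prod.snd_add, Prod.smul_snd, Prod.snd_neg, smul_eq_mul, h1, h2]
      field_simp
      ring

theorem hullSlice_functional (ht : p * t ≠ 0) {a₀ a₁ a₂ : ℝ}
    (ha : ∀ u, 0 ≤ |u| ^ p + a₂ * phiFun p u + a₁ * u + a₀) {y : ℝ × ℝ}
    (hy : y ∈ hullSlice p q t) : 0 ≤ 1 + a₂ * y.2 + a₁ * y.1 + a₀ := by
  have := gamma_hull_functional ht ha hy
  have h1 : p * t * y.2 / (p * t) = y.2 := mul_div_cancel_left₀ _ ht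
  simpa [slicePoint, h1] using this

theorem abs_le_one_of_mem_hullSlice (hpq : p.HolderConjugate q) (ht : 0 < t) {y : ℝ × ℝ}
    (hy : y ∈ hullSlice p q t) : |y.1| ≤ 1 ∧ |y.2| ≤ 1 :=
  abs_le_one_of_slicePoint hpq ht (gamma_hull_subset hpq ht hy)

/-- The description by closed conditions yields closedness of the slice, which is not automatic for
the hull of an unbounded curve. -/
theorem mem_hullSlice_iff (hp : 2 < p) (hpq : p.HolderConjugate q) (hr : IsCriticalR p r)
    (ht : 0 < t) {y : ℝ × ℝ} : y ∈ hullSlice p q t ↔ |y.2| ≤ 1 ∧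
      ∀ a₀ a₁ a₂ : ℝ, (∀ u, 0 ≤ |u| ^ p + a₂ * phiFun p u + a₁ * u + a₀) →
        0 ≤ 1 + a₂ * y.2 + a₁ * y.1 + a₀ := by
  have hκ : p * t ≠ 0 := (mul_pos hpq.pos ht).ne'
  constructor
  · intro hy
    exact ⟨(abs_le_one_of_mem_hullSlice hpq ht hy).2, fun a₀ a₁ a₂ ha => hullSlice_functional hκ ha hy⟩
  · rintro ⟨h1, h2⟩
    rcases between_or_exists_neg hp hpq hr h1 with ⟨τ, hτ, τ', hτ', e1, e2, e3, e4⟩ |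
      ⟨a₀, a₁, a₂, ha, hlt⟩
    · exact mem_hullSlice_of_between hpq hr.1.1 hτ hτ' e1 e2 e3 e4
    · exact absurd (h2 a₀ a₁ a₂ ha) (not_le.2 hlt)

theorem isCompact_hullSlice (hp : 2 < p) (hpq : p.HolderConjugate q) (hr : IsCriticalR p r)
    (ht : 0 < t) : IsCompact (hullSlice p q t) := by
  refine Metric.isCompact_of_isClosed_isBounded ?_ ?_
  · have : hullSlice p q t = {y : ℝ × ℝ | |y.2| ≤ 1 ∧
      ∀ a₀ a₁ a₂ : ℝ, (∀ u, 0 ≤ |u| ^ p + a₂ * phiFun p u + a₁ * u + a₀) →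
        0 ≤ 1 + a₂ * y.2 + a₁ * y.1 + a₀} := by
      ext y; exact mem_hullSlice_iff hp hpq hr ht
    rw [this]
    have hcl : IsClosed {y : ℝ × ℝ | |y.2| ≤ 1} :=
      isClosed_le (continuous_abs.comp continuous_snd) continuous_const
    refine hcl.inter ?_
    change IsClosed {y : ℝ × ℝ | ∀ a₀ a₁ a₂ : ℝ,
      (∀ u, 0 ≤ |u| ^ p + a₂ * phiFun p u + a₁ * u + a₀) → 0 ≤ 1 + a₂ * y.2 + a₁ * y.1 + a₀}
    simp only [ofPred_forall]
    refine isClosed_iInter fun a₀ => isClosed_iInter fun a₁ => isClosed_iInter fun a₂ =>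
      isClosed_iInter fun _ => isClosed_le continuous_const (by fun_prop)
  · rw [Metric.isBounded_iff_subset_closedBall (0 : ℝ × ℝ)]
    refine ⟨1, fun y hy => ?_⟩
    obtain ⟨h1, h2⟩ := abs_le_one_of_mem_hullSlice hpq ht hy
    rw [mem_closedBall_zero_iff, Prod.norm_def, Real.norm_eq_abs, Real.norm_eq_abs]
    exact max_le h1 h2

/-- A point strictly between two points of a convex set at the same height is interior if the set
contains points above and below. -/
theorem mem_interior_of_strictly_between {S : Set (ℝ × ℝ)} (hS : Convex ℝ S) {a b y₁ y₂ : ℝ}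
    (ha : (a, y₂) ∈ S) (hb : (b, y₂) ∈ S) (hay : a < y₁) (hyb : y₁ < b)
    (htop : ((1 : ℝ), (1 : ℝ)) ∈ S) (hbot : ((-1 : ℝ), (-1 : ℝ)) ∈ S) (h1 : -1 < y₂) (h2 : y₂ < 1) :
    (y₁, y₂) ∈ interior S := by
  have hrow : ∀ z, a < z → z < b → (z, y₂) ∈ S := by
    intro z haz hzb
    have hab : 0 < b - a := by linarith
    have := hS ha hb (a := (b - z) / (b - a)) (b := (z - a) / (b - a))
      (div_nonneg (by linarith) hab.le) (div_nonneg (by linarith) hab.le) (by field_simp; ring)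
    convert this using 1
    ext
    · simp only [Prod.fst_add, Prod.smul_fst, smul_eq_mul]; field_simp; ring
    · simp only [Prod.snd_add, Prod.smul_snd, smul_eq_mul]; field_simp; ring
  -- A nearby point on the same side of the row as the apex `(σ, σ)` lies on a segment from that
  -- apex to the row. For `σ = ±1` the last hypothesis reads `y₂ < 1` or `-1 < y₂`.
  have key : ∀ σ : ℝ, σ ≠ 0 → (σ, σ) ∈ S → σ * y₂ < σ * σ → ∀ᶠ y' in nhds (y₁, y₂),
      0 ≤ (y'.2 - y₂) / (σ - y₂) → y' ∈ S := by
    intro σ hσ hσS hlt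
    have hne : σ - y₂ ≠ 0 := by
      intro h
      have : σ = y₂ := by linarith
      rw [this] at hlt
      exact lt_irrefl _ hlt
    have hθ : ContinuousAt (fun y' : ℝ × ℝ => (y'.2 - y₂) / (σ - y₂)) (y₁, y₂) := by fun_prop
    have hz : ContinuousAt (fun y' : ℝ × ℝ => (y'.1 - σ * ((y'.2 - y₂) / (σ - y₂))) /
        (1 - (y'.2 - y₂) / (σ - y₂))) (y₁, y₂) := by
      refine ContinuousAt.div (by fun_prop) (by fun_prop) (by simp)
    have hz0 : (y₁ - σ * ((y₂ - y₂) / (σ - y₂))) / (1 - (y₂ - y₂) / (σ - y₂)) = y₁ := by simp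
    have ev1 := hθ.eventually (gt_mem_nhds (show (y₂ - y₂) / (σ - y₂) < 1 by simp))
    have ev2 := hz.eventually (lt_mem_nhds (show a < _ by simpa [hz0] using hay))
    have ev3 := hz.eventually (gt_mem_nhds (show _ < b by simpa [hz0] using hyb))
    filter_upwards [ev1, ev2, ev3] with y' g1 g2 g3 g0
    have := hS hσS (hrow _ g2 g3) g0 (sub_nonneg.2 g1.le) (by ring)
    convert this using 1
    have hne2 : 1 - (y'.2 - y₂) / (σ - y₂) ≠ 0 := by linarith
    ext
    · simp only [Prod.fst_add, Prod.smul_fst, smul_eq_mul]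
      rw [mul_div_cancel₀ _ hne2]; ring
    · simp only [Prod.snd_add, Prod.smul_snd, smul_eq_mul]
      field_simp; ring
  rw [mem_interior_iff_mem_nhds]
  filter_upwards [key 1 one_ne_zero htop (by linarith), key (-1) (by norm_num) hbot (by linarith)]
    with y' k1 k2
  rcases le_total y₂ y'.2 with h | h
  · exact k1 (div_nonneg (by linarith) (by linarith))
  · exact k2 (div_nonneg_of_nonpos (by linarith) (by linarith))

theorem etaFun_eq_critical {ρ : ℝ → ℝ} (hρ : ρ r = r) (τ : ℝ) :
    etaFun p q ρ τ r = etaFun p q id τ r := by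
  simp [etaFun, hρ]

/-- It remains to see that the frontier lies on the loop. A point of the slice off the loop is
strictly between the two curves at its height, and the heights `±1` contain no points besides `(1,
1)` and `(-1, -1)`; so it is interior. -/
theorem hullSlice_eq_region (hp : 2 < p) (hpq : p.HolderConjugate q) (hr : IsCriticalR p r)
    (ht : 0 < t) {ρ : ℝ → ℝ} (hρ : ρ r = r) :
    hullSlice p q t = regionBoundedBy (etaLoop p q r ρ) := by
  have hκ : p * t ≠ 0 := (mul_pos hpq.pos ht).ne'
  have hr0 := hr.1.1
  have htop : ((1 : ℝ), (1 : ℝ)) ∈ hullSlice p q t := by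
    rw [← etaFun_zero_critical hpq hr0]; exact etaFun_mem_hullSlice hpq hr0 (by simp)
  have hbot : ((-1 : ℝ), (-1 : ℝ)) ∈ hullSlice p q t := by
    rw [← etaFun_one_critical hpq hr0]; exact etaFun_mem_hullSlice hpq hr0 (by simp)
  have hcomp := isCompact_hullSlice hp hpq hr ht
  have hloop : ∀ τ ∈ Icc (0 : ℝ) 1, etaFun p q id τ r ∈ etaLoop p q r ρ ∧
      -etaFun p q id τ r ∈ etaLoop p q r ρ := by
    intro τ hτ
    rw [← etaFun_eq_critical hρ]
    exact ⟨Or.inl ⟨τ, hτ, rfl⟩, Or.inr ⟨τ, hτ, rfl⟩⟩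
  refine (regionBoundedBy_eq_of_convex hcomp convex_hullSlice ⟨_, htop⟩ ?_ ?_).symm
  · intro y hy
    have hyS : y ∈ hullSlice p q t := hcomp.isClosed.frontier_subset hy
    by_contra hyΓ
    apply hy.2
    obtain ⟨h1, h2⟩ := (mem_hullSlice_iff hp hpq hr ht).1 hyS
    rcases between_or_exists_neg hp hpq hr h1 with ⟨τ, hτ, τ', hτ', e1, e2, e3, e4⟩ |
      ⟨a₀, a₁, a₂, ha, hlt⟩
    · have n1 : -(etaFun p q id τ' r).1 ≠ y.1 := fun h => hyΓ (by
        have : y = -etaFun p q id τ' r := Prod.ext h.symm e2.symm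
        rw [this]; exact (hloop τ' hτ').2)
      have n2 : y.1 ≠ (etaFun p q id τ r).1 := fun h => hyΓ (by
        have : y = etaFun p q id τ r := Prod.ext h e1.symm
        rw [this]; exact (hloop τ hτ).1)
      have key : ∀ z : ℝ × ℝ, z ∈ hullSlice p q t → ∀ σ ∈ Icc (0 : ℝ) 1,
          (etaFun p q id σ r).2 = z.2 → z.1 ≤ (etaFun p q id σ r).1 := by
        intro z hz σ hσ hσz
        obtain ⟨a₀, a₁, a₂, ha, ha₁, h0⟩ := exists_touching_functional hp hpq hr hσ
        have := hullSlice_functional hκ ha hz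
        rw [hσz] at h0
        by_contra! hlt
        nlinarith
      have hy1 := abs_le_one_of_mem_hullSlice hpq ht hyS
      -- At height `1` the right bound `η(0, r)` and the left bound `-η(1, r)` are both `(1, 1)`,
      -- which lies on the loop.
      have htop' : y.2 ≠ 1 := by
        intro h
        have k1 := key y hyS 0 (by simp) (by rw [etaFun_zero_critical hpq hr0, h])
        have k2 := key (-y) (neg_mem_hullSlice hyS) 1 (by simp)
          (by rw [etaFun_one_critical hpq hr0]; simp [h])
        rw [etaFun_zero_critical hpq hr0] at k1
        rw [etaFun_one_critical hpq hr0] at k2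
        have k3 : y = etaFun p q id 0 r := by
          rw [etaFun_zero_critical hpq hr0]
          refine Prod.ext (le_antisymm k1 ?_) h
          simp only [Prod.fst_neg] at k2
          linarith
        exact hyΓ (k3 ▸ (hloop 0 (by simp)).1)
      have hbot' : y.2 ≠ -1 := by
        intro h
        have k1 := key y hyS 1 (by simp) (by rw [etaFun_one_critical hpq hr0, h])
        have k2 := key (-y) (neg_mem_hullSlice hyS) 0 (by simp)
          (by rw [etaFun_zero_critical hpq hr0]; simp [h])
        rw [etaFun_one_critical hpq hr0] at k1
        rw [etaFun_zero_critical hpq hr0] at k2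
        have k3 : y = etaFun p q id 1 r := by
          rw [etaFun_one_critical hpq hr0]
          refine Prod.ext (le_antisymm k1 ?_) h
          simp only [Prod.fst_neg] at k2
          linarith
        exact hyΓ (k3 ▸ (hloop 1 (by simp)).1)
      have hb2 := abs_le.1 hy1.2
      refine mem_interior_of_strictly_between convex_hullSlice (a := -(etaFun p q id τ' r).1)
        (b := (etaFun p q id τ r).1) ?_ ?_ (lt_of_le_of_ne e3 n1) (lt_of_le_of_ne e4 n2) htop hbot
        (lt_of_le_of_ne hb2.1 hbot'.symm) (lt_of_le_of_ne hb2.2 htop')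
      · rw [← e2]
        exact neg_mem_hullSlice (etaFun_mem_hullSlice hpq hr0 hτ')
      · rw [← e1]
        exact etaFun_mem_hullSlice hpq hr0 hτ
    · exact absurd (h2 a₀ a₁ a₂ ha) (not_le.2 hlt)
  · rintro _ (⟨τ, hτ, rfl⟩ | ⟨τ, hτ, rfl⟩)
    · simp only [etaFun_eq_critical hρ]
      exact etaFun_mem_hullSlice hpq hr0 hτ
    · simp only [etaFun_eq_critical hρ]
      exact neg_mem_hullSlice (etaFun_mem_hullSlice hpq hr0 hτ)

end Slice

/-! ### Majorants and the hull of `γ_t` -/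

section HullMajorant

variable {p q t r : ℝ}

theorem pos_two_of_mem_domT (hpq : p.HolderConjugate q) {x : Fin 4 → ℝ} (hx : x ∈ domT p q) :
    0 < x 2 := by
  have h1 := hx.1.1
  have h2 : 0 ≤ x 2 := (Real.rpow_nonneg (abs_nonneg _) _).trans h1
  refine lt_of_le_of_ne h2 fun h => hx.2 (Or.inl ⟨?_, h.symm⟩)
  rw [← h] at h1
  have h3 := le_antisymm h1 (Real.rpow_nonneg (abs_nonneg _) _)
  exact abs_eq_zero.1 ((Real.rpow_eq_zero (abs_nonneg _) hpq.ne_zero).1 h3)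

theorem mapT_eq_div (hpq : p.HolderConjugate q) (ht : 0 < t) {x : Fin 4 → ℝ}
    (h3 : x 3 = (p * t) ^ q * x 2) (h2 : 0 < x 2) :
    ∃ σ > 0, |σ| ^ p = x 2 ∧ mapT p q x = (x 0 / σ, x 1 / (p * t * phiFun p σ)) := by
  have hκ : 0 < p * t := mul_pos hpq.pos ht
  have hp := hpq.pos
  have hq := hpq.symm.pos
  have hσ : 0 < x 2 ^ (1 / p) := by positivity
  refine ⟨x 2 ^ (1 / p), hσ, ?_, ?_⟩
  · rw [abs_of_pos hσ, ← Real.rpow_mul h2.le, one_div_mul_cancel hp.ne', Real.rpow_one]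
  · have e1 : phiFun p (x 2 ^ (1 / p)) = x 2 ^ (1 / q) := by
      rw [phiFun_of_pos hσ, ← Real.rpow_mul h2.le]
      congr 1
      have := hpq.inv_add_inv_eq_one
      have h2 : q⁻¹ = 1 - p⁻¹ := by linarith
      rw [one_div, one_div, h2]
      field_simp
    rw [mapT, e1, h3, Real.rpow_neg h2.le, Real.rpow_neg (by positivity),
      Real.mul_rpow (by positivity) h2.le, ← Real.rpow_mul hκ.le, mul_one_div_cancel hq.ne',
      Real.rpow_one, ← div_eq_mul_inv, ← div_eq_mul_inv]

/-- On the hyperplane `x 3 = (p t)^q * x 2`, up to the factor `p * t` in the second coordinate, `T`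
is the weighted dilation by `σ⁻¹` that brings `x 2` to `1`. Dilations preserve the hull. -/
theorem mem_hull_iff_mapT_mem (hpq : p.HolderConjugate q) (ht : 0 < t) {x : Fin 4 → ℝ}
    (h3 : x 3 = (p * t) ^ q * x 2) (h2 : 0 < x 2) :
    x ∈ convexHull ℝ (gammaCurve p q t) ↔ mapT p q x ∈ hullSlice p q t := by
  have hκ : 0 < p * t := mul_pos hpq.pos ht
  obtain ⟨σ, hσ, e1, e2⟩ := mapT_eq_div hpq ht h3 h2
  have e3 : phiFun p σ * phiFun p σ⁻¹ = 1 := by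
    rw [← phiFun_mul, mul_inv_cancel₀ hσ.ne', phiFun_one]
  have e4 : |σ⁻¹| ^ p * x 2 = 1 := by
    rw [← e1, ← Real.mul_rpow (abs_nonneg _) (abs_nonneg _), ← abs_mul, inv_mul_cancel₀ hσ.ne',
      abs_one, Real.one_rpow]
  have hφ := phiFun_pos (r := p) hσ
  rw [e2, hullSlice, mem_ofPred_eq]
  constructor
  · intro hx
    have := gamma_hull_scale hx σ⁻¹
    convert this using 1
    have e5 : phiFun p σ⁻¹ = (phiFun p σ)⁻¹ := eq_inv_of_mul_eq_one_right e3
    ext i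
    fin_cases i
    · simp [slicePoint, div_eq_inv_mul]
    · simp [slicePoint, e5]
      have := hpq.pos.ne'
      field_simp
    · simp only [slicePoint]; simpa using e4.symm
    · simp only [slicePoint]
      have : |σ⁻¹| ^ p * x 3 = (p * t) ^ q := by rw [h3]; linear_combination (p * t) ^ q * e4
      simpa using this.symm
  · intro hx
    have := gamma_hull_scale hx σ
    convert this using 1
    ext i
    fin_cases i
    · simp [slicePoint]; field_simp
    · simp [slicePoint]
      have := hpq.pos.ne'
      field_simp
    · simp only [slicePoint]; simp [e1]
    · simp only [slicePoint]; simp [e1, h3, mul_comm]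

theorem mapT_image_hull (hpq : p.HolderConjugate q) (ht : 0 < t) :
    mapT p q '' (convexHull ℝ (gammaCurve p q t) ∩ domT p q) = hullSlice p q t := by
  have hκ : 0 < p * t := mul_pos hpq.pos ht
  apply Subset.antisymm
  · rintro _ ⟨x, ⟨hx, hxT⟩, rfl⟩
    exact (mem_hull_iff_mapT_mem hpq ht (gamma_hull_coord hx) (pos_two_of_mem_domT hpq hxT)).1 hx
  · intro y hy
    have h2 : slicePoint p q t y 2 = 1 := rfl
    have h3 : slicePoint p q t y 3 = (p * t) ^ q := rfl
    have h3' : (0 : ℝ) < (p * t) ^ q := by positivity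
    refine ⟨slicePoint p q t y, ⟨hy, gamma_hull_subset hpq ht hy, ?_⟩, ?_⟩
    · rintro (⟨-, h⟩ | ⟨-, h⟩)
      · rw [h2] at h; exact one_ne_zero h
      · rw [h3] at h; exact h3'.ne' h
    · rw [mapT, h2, h3, Real.one_rpow, ← Real.rpow_mul hκ.le]
      have : q * -(1 / q) = -1 := by
        have := hpq.symm.pos
        field_simp
      rw [this, Real.rpow_neg_one]
      ext
      · simp [slicePoint]
      · simp only [slicePoint, Matrix.cons_val]
        rw [mul_comm (p * t), mul_inv_cancel_right₀ hκ.ne']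

/-- If `x 2 = 0`, the point is the origin, which lies on the curve. Otherwise the violated
inequality is found in the slice, where membership in `Ω_c` bounds the height by `1`, and is dilated
back. -/
theorem exists_neg_functional_of_notMem (hp : 2 < p) (hpq : p.HolderConjugate q)
    (hr : IsCriticalR p r) (ht : 0 < t) {x : Fin 4 → ℝ} (hx : x ∈ omegaC p q)
    (h3 : x 3 = (p * t) ^ q * x 2) (hxK : x ∉ convexHull ℝ (gammaCurve p q t)) :
    ∃ a₀ a₁ a₂ : ℝ, (∀ u, 0 ≤ |u| ^ p + a₂ * phiFun p u + a₁ * u + a₀) ∧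
      x 2 + a₂ * (x 1 / (p * t)) + a₁ * x 0 + a₀ < 0 := by
  have hκ : 0 < p * t := mul_pos hpq.pos ht
  have hx2 : 0 ≤ x 2 := (Real.rpow_nonneg (abs_nonneg _) _).trans hx.1
  rcases hx2.eq_or_lt with h | h2
  · exfalso
    apply hxK
    have h0 : x 0 = 0 := by
      have h1 := hx.1
      rw [← h] at h1
      exact abs_eq_zero.1 ((Real.rpow_eq_zero (abs_nonneg _) hpq.ne_zero).1
        (le_antisymm h1 (Real.rpow_nonneg (abs_nonneg _) _)))
    have h3' : x 3 = 0 := by rw [h3, ← h, mul_zero]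
    have h1 : x 1 = 0 := by
      have h1 := hx.2
      rw [h3'] at h1
      exact abs_eq_zero.1 ((Real.rpow_eq_zero (abs_nonneg _) hpq.symm.ne_zero).1
        (le_antisymm h1 (Real.rpow_nonneg (abs_nonneg _) _)))
    have : x = skelPoint p q 0 (p * t * phiFun p 0) := by
      ext i
      fin_cases i <;>
        simp [skelPoint, phiFun_zero, h0, h1, ← h, h3', Real.zero_rpow hpq.ne_zero,
          Real.zero_rpow hpq.symm.ne_zero]
    rw [this]
    exact skelPoint_mem_gamma_hull hpq ht 0
  · obtain ⟨σ, hσ, e1, e2⟩ := mapT_eq_div hpq ht h3 h2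
    have hφ := phiFun_pos (r := p) hσ
    have hσφ := mul_phiFun hpq.ne_zero σ
    rw [e1] at hσφ
    have hxS : mapT p q x ∉ hullSlice p q t := fun h => hxK ((mem_hull_iff_mapT_mem hpq ht h3 h2).2 h)
    rw [mem_hullSlice_iff hp hpq hr ht] at hxS
    have hb : |(mapT p q x).2| ≤ 1 := by
      rw [e2]
      simp only
      have h4 := hx.2
      rw [h3, ← e1, ← abs_smul_phiFun_rpow hpq hκ,
        Real.rpow_le_rpow_iff (abs_nonneg _) (abs_nonneg _) hpq.symm.pos,
        abs_of_pos (mul_pos hκ hφ)] at h4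
      rw [abs_div, abs_of_pos (mul_pos hκ hφ)]
      exact (div_le_one (mul_pos hκ hφ)).2 h4
    have : ∃ a₀ a₁ a₂ : ℝ, (∀ u, 0 ≤ |u| ^ p + a₂ * phiFun p u + a₁ * u + a₀) ∧
        1 + a₂ * (mapT p q x).2 + a₁ * (mapT p q x).1 + a₀ < 0 := by
      by_contra! hcon
      exact hxS ⟨hb, hcon⟩
    obtain ⟨a₀, a₁, a₂, ha, hlt⟩ := this
    refine ⟨a₀ * |σ| ^ p, a₁ * phiFun p σ, a₂ * σ, functional_scale hpq.ne_zero ha hσ, ?_⟩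
    rw [e2] at hlt
    simp only at hlt
    have := mul_neg_of_pos_of_neg h2 hlt
    refine lt_of_eq_of_lt ?_ this
    rw [e1, ← hσφ]
    have := hpq.pos.ne'
    field_simp

/-- The derivative of `phiFun p` on the unit ball around `u` is `O(1 + |u|^p)`, so the mean value
inequality gives an estimate uniform in `u`. -/
theorem exists_phiFun_sub_le (hp : 2 < p) {ε : ℝ} (hε : 0 < ε) :
    ∃ d₀ > 0, ∀ d, |d| ≤ d₀ → ∀ u : ℝ, |phiFun p (u - d) - phiFun p u| ≤ ε * (1 + |u| ^ p) := by
  have h2p : (0 : ℝ) < 2 ^ p := by positivity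
  have hp1 : 0 < p - 1 := by linarith
  refine ⟨min 1 (ε / ((p - 1) * 2 ^ p)), by positivity, fun d hd u => ?_⟩
  have hd1 : |d| ≤ 1 := hd.trans (min_le_left _ _)
  have hd2 : |d| * ((p - 1) * 2 ^ p) ≤ ε := by
    have := hd.trans (min_le_right _ _)
    rwa [le_div_iff₀ (by positivity)] at this
  have hup : 0 ≤ |u| ^ p := by positivity
  have hgrow : (|u| + 1) ^ (p - 2) ≤ 2 ^ p * (1 + |u| ^ p) := by
    have h1 : (|u| + 1) ^ (p - 2) ≤ (|u| + 1) ^ p :=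
      Real.rpow_le_rpow_of_exponent_le (by linarith [abs_nonneg u]) (by linarith)
    refine h1.trans ?_
    rcases le_total |u| 1 with h | h
    · have : (|u| + 1) ^ p ≤ 2 ^ p := Real.rpow_le_rpow (by positivity) (by linarith) (by linarith)
      nlinarith
    · have : (|u| + 1) ^ p ≤ (2 * |u|) ^ p :=
        Real.rpow_le_rpow (by positivity) (by linarith) (by linarith)
      rw [Real.mul_rpow (by norm_num) (abs_nonneg _)] at this
      nlinarith
  have hball : ∀ z ∈ Metric.closedBall u 1, ‖(p - 1) * |z| ^ (p - 2)‖ ≤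
      (p - 1) * (2 ^ p * (1 + |u| ^ p)) := by
    intro z hz
    rw [Metric.mem_closedBall, Real.dist_eq] at hz
    rw [Real.norm_eq_abs, abs_of_nonneg (by positivity)]
    refine mul_le_mul_of_nonneg_left (le_trans ?_ hgrow) hp1.le
    refine Real.rpow_le_rpow (abs_nonneg _) ?_ (by linarith)
    have : |z| ≤ |z - u| + |u| := by simpa using abs_add_le (z - u) u
    linarith
  have := (convex_closedBall u 1).norm_image_sub_le_of_norm_hasDerivWithin_le
    (fun z _ => (hasDerivAt_phiFun hp z).hasDerivWithinAt) hball
    (Metric.mem_closedBall_self zero_le_one)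
    (show u - d ∈ Metric.closedBall u 1 by
      rw [Metric.mem_closedBall, Real.dist_eq]; simpa using hd1)
  rw [Real.norm_eq_abs, Real.norm_eq_abs, sub_sub_cancel_left, abs_neg] at this
  refine this.trans ?_
  calc (p - 1) * (2 ^ p * (1 + |u| ^ p)) * |d| = |d| * ((p - 1) * 2 ^ p) * (1 + |u| ^ p) := by ring
    _ ≤ _ := mul_le_mul_of_nonneg_right hd2 (by positivity)

/-- The coefficients of the majorant that touches along `γ_t`. -/
noncomputable def youngCoeff (p q t : ℝ) : Fin 4 → ℝ := ![0, 0, p * t / p, (p * t) ^ (1 - q) / q]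

/-- Shifting `m 1` from `0` to `d` adds `t (|u|^p - |u - d|^p)` to the gap, to first order `p t d
φ(u)`. With `d = δ a₂ / (p t)` this supplies the missing term `δ a₂ φ(u)`, and the other
coefficients supply the rest of `δ` times the functional. A surplus `δ ε (1 + |u|^p)` covers the
error and is small enough to keep the value at `x` lower. -/
theorem exists_better_majorant_of_neg_functional (hp : 2 < p) (hpq : p.HolderConjugate q)
    (ht : 0 < t) {x : Fin 4 → ℝ} (hx2 : 0 ≤ x 2) {a₀ a₁ a₂ : ℝ}
    (ha : ∀ u, 0 ≤ |u| ^ p + a₂ * phiFun p u + a₁ * u + a₀)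
    (hneg : x 2 + a₂ * (x 1 / (p * t)) + a₁ * x 0 + a₀ < 0) :
    ∃ c' m', IsMajorant p q c' m' ∧ affVal c' m' x < affVal 0 (youngCoeff p q t) x := by
  have hp0 := hpq.pos
  have hκ : 0 < p * t := mul_pos hp0 ht
  set v := x 2 + a₂ * (x 1 / (p * t)) + a₁ * x 0 + a₀ with hv
  set ε := -v / (2 * (1 + x 2)) with hε
  have hε0 : 0 < ε := div_pos (by linarith) (by positivity)
  have hεv : v + ε * (1 + x 2) < 0 := by
    have : ε * (1 + x 2) = -v / 2 := by rw [hε]; field_simp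
    linarith
  obtain ⟨d₀, hd₀, hd⟩ := exists_phiFun_sub_le hp (ε := ε / (|a₂| + 1)) (by positivity)
  set δ := d₀ * (p * t) / (|a₂| + 1) with hδ
  have hδ0 : 0 < δ := by positivity
  set d := δ * a₂ / (p * t) with hddef
  have hd' : |d| ≤ d₀ := by
    rw [hddef, hδ, abs_div, abs_mul, abs_of_pos hκ, abs_of_pos (by positivity)]
    have : d₀ * (p * t) / (|a₂| + 1) * |a₂| / (p * t) = d₀ * (|a₂| / (|a₂| + 1)) := by field_simp
    rw [this]
    have h1 : |a₂| / (|a₂| + 1) ≤ 1 := (div_le_one (by positivity)).2 (by linarith)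
    nlinarith
  refine ⟨δ * (a₀ + ε), ![δ * a₁, d, p * t / p + δ * (1 + ε), (p * t) ^ (1 - q) / q], ?_, ?_⟩
  · rw [isMajorant_iff hpq hκ (by rfl)]
    intro u
    simp only [gapProfile, Matrix.cons_val]
    -- Convexity gives the shift estimate in the needed direction, with `φ(u - d)` in place of
    -- `φ(u)`.
    have h1 := abs_rpow_tangent_le hpq.lt (u - d) u
    have h2 := hd d hd' u
    have h3 : |a₂ * (phiFun p (u - d) - phiFun p u)| ≤ ε * (1 + |u| ^ p) := by
      rw [abs_mul]
      have h4 := mul_le_mul_of_nonneg_left h2 (abs_nonneg a₂)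
      refine h4.trans ?_
      have h5 : |a₂| * (ε / (|a₂| + 1) * (1 + |u| ^ p)) =
          (|a₂| / (|a₂| + 1)) * (ε * (1 + |u| ^ p)) := by field_simp
      rw [h5]
      have h6 : |a₂| / (|a₂| + 1) ≤ 1 := (div_le_one (by positivity)).2 (by linarith)
      have h7 : 0 ≤ ε * (1 + |u| ^ p) := by positivity
      nlinarith
    have h4 := (abs_le.1 h3).1
    have h5 := ha u
    have h6 : p * t / p = t := by field_simp
    have h7 : d * (p * t) = δ * a₂ := by rw [hddef]; field_simp
    rw [h6]
    have h8 := mul_le_mul_of_nonneg_left h1 ht.le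
    have h9 : 0 ≤ δ * (|u| ^ p + a₂ * phiFun p u + a₁ * u + a₀ + (ε * (1 + |u| ^ p) +
        a₂ * (phiFun p (u - d) - phiFun p u))) := mul_nonneg hδ0.le (by linarith)
    have h10 : t * (|u - d| ^ p + p * phiFun p (u - d) * (u - (u - d))) =
        t * |u - d| ^ p + δ * (a₂ * phiFun p (u - d)) := by
      linear_combination phiFun p (u - d) * h7
    rw [h10] at h8
    linarith
  · have h1 : affVal (δ * (a₀ + ε)) ![δ * a₁, d, p * t / p + δ * (1 + ε), (p * t) ^ (1 - q) / q] x =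
        affVal 0 (youngCoeff p q t) x + δ * (v + ε * (1 + x 2)) := by
      simp only [affVal, youngCoeff, Matrix.cons_val, hv, hddef]
      field_simp
      ring
    rw [h1]
    have := mul_neg_of_pos_of_neg hδ0 hεv
    linarith

/-- Other Young majorants suffice: their value at `x`, as a function of `κ`, is stationary at `p *
t` only if `x 3 = (p t)^q * x 2`. -/
theorem exists_better_majorant_of_ratio_ne (hpq : p.HolderConjugate q) (ht : 0 < t)
    {x : Fin 4 → ℝ} (h3 : x 3 ≠ (p * t) ^ q * x 2) :
    ∃ c' m', IsMajorant p q c' m' ∧ affVal c' m' x < affVal 0 (youngCoeff p q t) x := by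
  have hp := hpq.pos
  have hq := hpq.symm.pos
  have hκ : 0 < p * t := mul_pos hp ht
  by_contra! hcon
  apply h3
  set ψ : ℝ → ℝ := fun κ => κ / p * x 2 + κ ^ (1 - q) / q * x 3 with hψ
  have hmin : IsLocalMin ψ (p * t) := by
    filter_upwards [lt_mem_nhds hκ] with κ hκ'
    have := hcon 0 _ (isMajorant_young hpq hκ')
    simpa [affVal, youngCoeff, hψ] using this
  have hd : HasDerivAt ψ (1 / p * x 2 + (1 - q) * (p * t) ^ (1 - q - 1) / q * x 3) (p * t) := by
    have h1 : HasDerivAt (fun κ : ℝ => κ ^ (1 - q)) ((1 - q) * (p * t) ^ (1 - q - 1)) (p * t) :=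
      Real.hasDerivAt_rpow_const (Or.inl hκ.ne')
    exact (((hasDerivAt_id _).div_const p).mul_const _).add ((h1.div_const q).mul_const _)
  have h0 := hmin.hasDerivAt_eq_zero hd
  have e1 : (1 - q) / q = -(1 / p) := by
    have := hpq.inv_add_inv_eq_one
    rw [sub_div, div_self hq.ne', one_div, one_div]; linarith
  have e2 : (p * t) ^ (1 - q - 1) = ((p * t) ^ q)⁻¹ := by
    rw [← Real.rpow_neg hκ.le]; congr 1; ring
  have e3 : (0 : ℝ) < (p * t) ^ q := by positivity
  have e4 : (1 - q) * (p * t) ^ (1 - q - 1) / q * x 3 = -(1 / p) * (((p * t) ^ q)⁻¹ * x 3) := by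
    rw [← e1, e2]; ring
  rw [e4] at h0
  have e5 : x 2 = ((p * t) ^ q)⁻¹ * x 3 := by
    have h1 : 1 / p * (x 2 - ((p * t) ^ q)⁻¹ * x 3) = 0 := by linarith
    have h2 := (mul_eq_zero.1 h1).resolve_left (by positivity)
    linarith
  rw [e5, mul_inv_cancel_left₀ e3.ne']

theorem exists_better_majorant_of_notMem_hull (hp : 2 < p) (hpq : p.HolderConjugate q)
    (hr : IsCriticalR p r) (ht : 0 < t) {x : Fin 4 → ℝ} (hx : x ∈ omegaC p q)
    (hxK : x ∉ convexHull ℝ (gammaCurve p q t)) :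
    ∃ c' m', IsMajorant p q c' m' ∧ affVal c' m' x < affVal 0 (youngCoeff p q t) x := by
  by_cases h3 : x 3 = (p * t) ^ q * x 2
  · obtain ⟨a₀, a₁, a₂, ha, hneg⟩ := exists_neg_functional_of_notMem hp hpq hr ht hx h3 hxK
    exact exists_better_majorant_of_neg_functional hp hpq ht
      ((Real.rpow_nonneg (abs_nonneg _) _).trans hx.1) ha hneg
  · exact exists_better_majorant_of_ratio_ne hpq ht h3

theorem contactSet_young (hpq : p.HolderConjugate q) (ht : 0 < t) :
    contactSet p q 0 (youngCoeff p q t) = gammaCurve p q t := by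
  have hκ : 0 < p * t := mul_pos hpq.pos ht
  have hm : IsMajorant p q 0 (youngCoeff p q t) := isMajorant_young hpq hκ
  rw [gammaCurve_eq hpq ht]
  ext x
  constructor
  · rintro ⟨u, v, rfl, h⟩
    obtain ⟨-, h2⟩ := (hm.contact_iff hpq hκ (by rfl)).1 h
    refine ⟨u, ?_⟩
    rw [h2]
    simp [youngCoeff]
  · rintro ⟨u, rfl⟩
    refine ⟨u, _, rfl, (hm.contact_iff hpq hκ (by rfl)).2 ⟨?_, by simp [youngCoeff]⟩⟩
    simp [gapProfile, youngCoeff]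

end HullMajorant

/-! ### Majorants that touch the skeleton at two points -/

section Bregman

variable {p : ℝ}

/-- The Taylor remainders between `x` and `-(R x)`, from either end, share the factor `(1 + R)(1 +
φ(R))`; the rest depends on `λ(R)` only. This is how `λ` enters the problem. -/
theorem bregman_left (hp : 1 < p) {R : ℝ} (hR : -1 < R) (x : ℝ) :
    |-(R * x)| ^ p - |x| ^ p - p * phiFun p x * (-(R * x) - x) =
      |x| ^ p * ((1 + R) * (1 + phiFun p R) * (1 - lambdaFun p R)) := by
  have hX : 0 < 1 + R := by linarith
  have hY := one_add_phiFun_pos hp hR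
  have e1 : |-(R * x)| ^ p = |R| ^ p * |x| ^ p := by
    rw [abs_neg, abs_mul, Real.mul_rpow (abs_nonneg _) (abs_nonneg _)]
  have e2 := mul_phiFun (by linarith : p ≠ 0) x
  have e3 := mul_phiFun (by linarith : p ≠ 0) R
  have e4 : (1 + R) * (1 + phiFun p R) * (1 - lambdaFun p R) = |R| ^ p - 1 + p * (1 + R) := by
    rw [lambdaFun_of_ne hR, ← e3]; field_simp; ring
  rw [e1, e4]
  linear_combination p * (R + 1) * e2

theorem bregman_right (hp : 1 < p) {R : ℝ} (hR : -1 < R) (x : ℝ) :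
    |x| ^ p - |-(R * x)| ^ p - p * phiFun p (-(R * x)) * (x - -(R * x)) =
      |x| ^ p * ((1 + R) * (1 + phiFun p R) * (lambdaFun p R + (p - 1))) := by
  have hX : 0 < 1 + R := by linarith
  have hY := one_add_phiFun_pos hp hR
  have e1 : |-(R * x)| ^ p = |R| ^ p * |x| ^ p := by
    rw [abs_neg, abs_mul, Real.mul_rpow (abs_nonneg _) (abs_nonneg _)]
  have e2 := mul_phiFun (by linarith : p ≠ 0) x
  have e3 := mul_phiFun (by linarith : p ≠ 0) R
  have e4 : (1 + R) * (1 + phiFun p R) * (lambdaFun p R + (p - 1)) =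
      1 - |R| ^ p + p * phiFun p R * (1 + R) := by
    rw [lambdaFun_of_ne hR, ← e3]; field_simp; ring
  rw [e1, e4, phiFun_neg, phiFun_mul]
  linear_combination p * phiFun p R * (1 + R) * e2

/-- The derivative of the quotient has the sign of `|x|^(p-2) - 1`. The estimate supplies `κ < A *
p` when a majorant is built from a chord. -/
theorem one_add_phiFun_div_lt (hp : 2 < p) {R r : ℝ} (hR : -1 < R) (hRr : R < r) (hr : r ≤ 1) :
    (1 + phiFun p r) / (1 + r) ^ (p - 1) < (1 + phiFun p R) / (1 + R) ^ (p - 1) := by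
  have hanti : StrictAntiOn (fun R => (1 + phiFun p R) / (1 + R) ^ (p - 1)) (Ioc (-1) 1) := by
    have hd : ∀ x : ℝ, -1 < x → HasDerivAt (fun R => (1 + phiFun p R) / (1 + R) ^ (p - 1))
        ((((p - 1) * |x| ^ (p - 2)) * (1 + x) ^ (p - 1) - (1 + phiFun p x) *
          ((p - 1) * (1 + x) ^ (p - 1 - 1))) / ((1 + x) ^ (p - 1)) ^ 2) x := by
      intro x hx
      have hx1 : 0 < 1 + x := by linarith
      have h1 : HasDerivAt (fun R : ℝ => (1 + R) ^ (p - 1)) ((p - 1) * (1 + x) ^ (p - 1 - 1)) x := by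
        have := (((hasDerivAt_id x).const_add 1).rpow_const (p := p - 1) (Or.inl hx1.ne'))
        exact this.congr_deriv (by simp)
      exact ((hasDerivAt_phiFun hp x).const_add 1).div h1 (by positivity)
    apply strictAntiOn_of_deriv_neg (convex_Ioc _ _)
    · exact fun x hx => (hd x hx.1).continuousAt.continuousWithinAt
    · intro x hx
      rw [interior_Ioc] at hx
      have hx1 : 0 < 1 + x := by linarith [hx.1]
      rw [(hd x hx.1).deriv]
      refine div_neg_of_neg_of_pos ?_ (by positivity)
      have e1 : (1 + x) ^ (p - 1) = (1 + x) ^ (p - 1 - 1) * (1 + x) := by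
        nth_rewrite 3 [← Real.rpow_one (1 + x)]
        rw [← Real.rpow_add hx1]; ring_nf
      have e2 : phiFun p x = x * |x| ^ (p - 2) := rfl
      have e3 : |x| ^ (p - 2) < 1 :=
        Real.rpow_lt_one (abs_nonneg _) (abs_lt.2 ⟨hx.1, hx.2⟩) (by linarith)
      have e4 : ((p - 1) * |x| ^ (p - 2)) * (1 + x) ^ (p - 1) - (1 + phiFun p x) *
          ((p - 1) * (1 + x) ^ (p - 1 - 1)) =
          -((p - 1) * (1 + x) ^ (p - 1 - 1) * (1 - |x| ^ (p - 2))) := by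
        rw [e1, e2]; ring
      rw [e4]
      have : 0 < (p - 1) * (1 + x) ^ (p - 1 - 1) := mul_pos (by linarith) (by positivity)
      have := mul_pos this (sub_pos.2 e3)
      linarith
  exact hanti ⟨hR, hRr.le.trans hr⟩ ⟨hR.trans hRr, hr⟩ hRr

end Bregman

section Chord

variable {p q c R₀ : ℝ} {m : Fin 4 → ℝ} {ρ : ℝ → ℝ}

/-- The majorant touches the skeleton exactly at the endpoints of a chord. -/
def IsChordContact (p q : ℝ) (ρ : ℝ → ℝ) (c : ℝ) (m : Fin 4 → ℝ) (R a₁ a₂ : ℝ) : Prop :=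
  ∀ u v : ℝ, u * v = affVal c m (skelPoint p q u v) ↔
    (u = a₁ ∧ v = a₂) ∨ (u = -(ρ R * a₁) ∧ v = -(phiFun p R * a₂))

/-- The coefficients after the change of signs of the first two variables. -/
def reflCoeff (m : Fin 4 → ℝ) : Fin 4 → ℝ := ![-m 0, -m 1, m 2, m 3]

theorem affVal_reflCoeff (c : ℝ) (m : Fin 4 → ℝ) (u v : ℝ) :
    affVal c (reflCoeff m) (skelPoint p q u v) = affVal c m (skelPoint p q (-u) (-v)) := by
  rw [affVal_skelPoint, affVal_skelPoint]
  simp [reflCoeff]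

theorem IsMajorant.refl (hm : IsMajorant p q c m) : IsMajorant p q c (reflCoeff m) := by
  intro u v
  rw [affVal_reflCoeff]
  have := hm (-u) (-v)
  linarith

theorem IsChordContact.refl {R a₁ a₂ : ℝ} (h : IsChordContact p q ρ c m R a₁ a₂) :
    IsChordContact p q ρ c (reflCoeff m) R (-a₁) (-a₂) := by
  intro u v
  rw [affVal_reflCoeff]
  have := h (-u) (-v)
  rw [neg_mul_neg] at this
  rw [this]
  constructor
  · rintro (⟨h1, h2⟩ | ⟨h1, h2⟩)
    · exact Or.inl ⟨by linarith, by linarith⟩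
    · exact Or.inr ⟨by linarith, by linarith⟩
  · rintro (⟨h1, h2⟩ | ⟨h1, h2⟩)
    · exact Or.inl ⟨by linarith, by linarith⟩
    · exact Or.inr ⟨by linarith, by linarith⟩

theorem reflCoeff_reflCoeff (m : Fin 4 → ℝ) : reflCoeff (reflCoeff m) = m := by
  ext i
  fin_cases i <;> simp [reflCoeff]

theorem hasDerivAt_gapProfile (hp : 2 < p) (κ c : ℝ) (m : Fin 4 → ℝ) (u : ℝ) :
    HasDerivAt (gapProfile p κ c m)
      (m 0 + m 2 * p * phiFun p u - κ * phiFun p (u - m 1)) u :=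
  hasDerivAt_profile hp (m 2) κ (m 0) (m 1) c u

theorem exists_isTriconvex_gapProfile (hp : 2 < p) {κ : ℝ} (hκ : 0 < κ) (h2 : κ < m 2 * p)
    (h1 : 0 < m 1) (c : ℝ) : ∃ s₁ < 0, ∃ s₂ > 0, IsTriconvex (gapProfile p κ c m)
      (fun u => m 0 + m 2 * p * phiFun p u - κ * phiFun p (u - m 1)) s₁ s₂ :=
  exists_isTriconvex_profile hp hκ h2 h1 (m 0) c

theorem not_forall_nonneg_sub_rpow {r : ℝ} (hr : 1 < r) {d : ℝ} (hd : 0 < d) (a b : ℝ) :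
    ¬ ∀ N : ℝ, 0 < N → 0 ≤ a + b * N - d * N ^ r := by
  intro h
  obtain ⟨C, hC⟩ := exists_mul_le_rpow (Real.HolderConjugate.conjExponent hr) hd (b + 1)
  have h1 := hC (|a + C| + 1)
  have h2 := h (|a + C| + 1) (by positivity)
  rw [abs_of_pos (by positivity : 0 < |a + C| + 1)] at h1
  have h3 := le_abs_self (a + C)
  linarith

/-- At infinity the powers of order `p` give `κ ≤ m 2 * p`. If `m 1 ≠ 0` and equality held, then
along `u = -N * m 1` the difference of the powers would be of order `N^(p-1)`, which beats the
linear term because `p > 2`. -/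
theorem IsMajorant.ratio (hp : 2 < p) (hpq : p.HolderConjugate q) {κ : ℝ} (hκ : 0 < κ)
    (h3 : m 3 = κ ^ (1 - q) / q) (hm : IsMajorant p q c m) :
    κ ≤ m 2 * p ∧ (m 1 ≠ 0 → κ < m 2 * p) := by
  have hp0 := hpq.pos
  rw [isMajorant_iff hpq hκ h3] at hm
  simp only [gapProfile] at hm
  have key : m 1 ≠ 0 → κ < m 2 * p := by
    intro h1
    by_contra! hle
    have h4 : m 2 ≤ κ / p := by rwa [le_div_iff₀ hp0]
    refine not_forall_nonneg_sub_rpow (show 1 < p - 1 by linarith)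
      (d := κ * |m 1| ^ p) (by positivity) c (-(m 0 * m 1)) fun N hN => ?_
    have h5 := hm (-(N * m 1))
    have h6 := abs_rpow_tangent_le hpq.lt (-(N * m 1)) (-(N * m 1) - m 1)
    have h7 := mul_le_mul_of_nonneg_right h4 (Real.rpow_nonneg (abs_nonneg (-(N * m 1))) p)
    have h8 := mul_le_mul_of_nonneg_left h6 (show 0 ≤ κ / p by positivity)
    have h9 : κ / p * (|-(N * m 1)| ^ p + p * phiFun p (-(N * m 1)) * (-(N * m 1) - m 1 - -(N * m 1)))
        = κ / p * |-(N * m 1)| ^ p + κ * |m 1| ^ p * N ^ (p - 1) := by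
      rw [phiFun_neg, phiFun_mul, ← mul_phiFun hpq.ne_zero (m 1), phiFun_of_pos hN]
      field_simp
      ring
    rw [h9] at h8
    linarith
  refine ⟨?_, key⟩
  rcases eq_or_ne (m 1) 0 with h1 | h1
  · by_contra! hlt
    have h4 : 0 < κ / p - m 2 := by rw [sub_pos, lt_div_iff₀ hp0]; exact hlt
    refine not_forall_nonneg_sub_rpow hpq.lt h4 c (m 0) fun N hN => ?_
    have h5 := hm N
    rw [h1, sub_zero, abs_of_pos hN] at h5
    linarith
  · exact (key h1).le

/-- The difference `gap(u) - gap(-u)` vanishes at `0`, is `≥ 0` at `-u₁` and `≤ 0` at `u₂`. Its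
derivative increases strictly on `[0, ∞)`, as `|u + m 1| > |u - m 1|` there; so it cannot first rise
and then fall. -/
theorem abs_zero_right_le (hp : 2 < p) {κ : ℝ} (hκ : 0 < κ) (h1 : 0 < m 1)
    (h0 : ∀ u, 0 ≤ gapProfile p κ c m u) {u₁ u₂ : ℝ} (hu₁ : u₁ < 0)
    (hz₁ : gapProfile p κ c m u₁ = 0) (hz₂ : gapProfile p κ c m u₂ = 0) : u₂ ≤ -u₁ := by
  by_contra! hlt
  have hd := hasDerivAt_gapProfile hp κ c m
  set g : ℝ → ℝ := fun u => 2 * m 0 - κ * phiFun p (u - m 1) + κ * phiFun p (u + m 1) with hg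
  have hO : ∀ u, HasDerivAt (fun u => gapProfile p κ c m u - gapProfile p κ c m (-u)) (g u) u := by
    intro u
    have e1 := (hd u).sub (((hd (-u)).comp u (hasDerivAt_neg u)))
    refine e1.congr_deriv ?_
    have : -u - m 1 = -(u + m 1) := by ring
    rw [this, phiFun_neg, phiFun_neg, hg]
    ring
  have hmono : StrictMonoOn g (Ici 0) := by
    have hgd : ∀ u, HasDerivAt g (κ * (p - 1) * (|u + m 1| ^ (p - 2) - |u - m 1| ^ (p - 2))) u := by
      intro u
      have e1 := ((hasDerivAt_phiFun hp (u - m 1)).comp_sub_const u (m 1)).const_mul κ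
      have e2 := ((hasDerivAt_phiFun hp (u + m 1)).comp_add_const u (m 1)).const_mul κ
      exact ((e1.const_sub (2 * m 0)).add e2).congr_deriv (by ring)
    apply strictMonoOn_of_deriv_pos (convex_Ici 0)
    · exact fun u _ => (hgd u).continuousAt.continuousWithinAt
    · intro u hu
      rw [interior_Ici, mem_Ioi] at hu
      rw [(hgd u).deriv]
      have e1 : |u - m 1| < |u + m 1| := by
        rw [abs_of_pos (by linarith : 0 < u + m 1), abs_lt]
        constructor <;> linarith
      have e2 := Real.rpow_lt_rpow (abs_nonneg _) e1 (by linarith : 0 < p - 2)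
      exact mul_pos (mul_pos hκ (by linarith)) (by linarith)
  obtain ⟨x, hx, hx'⟩ := exists_between_eq_slope hO (neg_pos.2 hu₁)
  obtain ⟨y, hy, hy'⟩ := exists_between_eq_slope hO hlt
  simp only [neg_neg, neg_zero, sub_self, sub_zero, hz₁, hz₂] at hx' hy'
  have hxy := hmono (mem_Ici.2 hx.1.le) (mem_Ici.2 (hx.1.trans (hx.2.trans hy.1)).le)
    (hx.2.trans hy.1)
  have k1 := h0 (-u₁)
  have k2 := h0 (-u₂)
  have e1 : 0 ≤ g x := by
    by_contra! hneg
    have := mul_neg_of_neg_of_pos hneg (neg_pos.2 hu₁)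
    linarith
  have e2 : g y ≤ 0 := by
    by_contra! hpos
    have := mul_pos hpos (sub_pos.2 hlt)
    linarith
  linarith

theorem phiFun_ratio {x y R : ℝ} (h : y = -(R * x)) :
    phiFun p y = -(phiFun p R * phiFun p x) := by
  rw [h, phiFun_neg, phiFun_mul]

/-- With `u₂ = -(r u₁)` and `u₂ - b = -(R (u₁ - b))`, the vanishing of values and slopes at the
zeros equates Taylor remainders: `α (1 - λ(r)) = β (1 - λ(R))` and `α (λ(r) + p - 1) = β (λ(R) + p -
1)`. Adding them gives `α = β`, then `λ(r) = λ(R)`; as `R < r ≤ 1`, this means `r = ρ(R)`. -/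
theorem exists_chord_of_two_zeros_of_pos (hp : 2 < p) (hpq : p.HolderConjugate q)
    (h₀ : IsCriticalR p R₀) (hρ : IsRho p R₀ ρ) {κ : ℝ} (hκ : 0 < κ)
    (h3 : m 3 = κ ^ (1 - q) / q) (h2 : κ < m 2 * p) (hm : IsMajorant p q c m) (h1 : 0 < m 1)
    {u₁ u₂ : ℝ} (hu : u₁ < u₂) (hz₁ : gapProfile p κ c m u₁ = 0)
    (hz₂ : gapProfile p κ c m u₂ = 0) :
    ∃ R ∈ Ioo (-1) R₀, ∃ a₁ a₂ : ℝ, 0 < a₁ * a₂ ∧ IsChordContact p q ρ c m R a₁ a₂ := by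
  have hp0 := hpq.pos
  have hnn := (isMajorant_iff hpq hκ h3).1 hm
  obtain ⟨s₁, hs₁, s₂, hs₂, tri⟩ := exists_isTriconvex_gapProfile hp hκ h2 h1 c
  have hd₁ := deriv_eq_zero_of_nonneg tri.hasDerivAt hnn hz₁
  have hd₂ := deriv_eq_zero_of_nonneg tri.hasDerivAt hnn hz₂
  obtain ⟨l₁, l₂⟩ := tri.le_of_zeros hu hd₁ hd₂ (hz₁.trans hz₂.symm)
  have hu₁ : u₁ < 0 := by linarith
  have hu₂ : 0 < u₂ := by linarith
  have hle := abs_zero_right_le hp hκ h1 hnn hu₁ hz₁ hz₂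
  set b := m 1 with hb
  set r := u₂ / -u₁ with hr
  set R := (u₂ - b) / (b - u₁) with hR
  have hbu : 0 < b - u₁ := by linarith
  have eu : u₂ = -(r * u₁) := by
    have : r * -u₁ = u₂ := div_mul_cancel₀ _ (by linarith)
    linarith
  have ew : u₂ - b = -(R * (u₁ - b)) := by
    have : R * (b - u₁) = u₂ - b := div_mul_cancel₀ _ hbu.ne'
    linarith
  have hr1 : r ≤ 1 := (div_le_one (by linarith)).2 hle
  have hR1 : -1 < R := by rw [hR, lt_div_iff₀ hbu]; linarith
  have hRr : R < r := by
    rw [hR, hr, div_lt_div_iff₀ hbu (by linarith)]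
    nlinarith
  have hr0 : -1 < r := hR1.trans hRr
  have hlam : lambdaFun p r = lambdaFun p R := by
    have q1 := bregman_left hpq.lt hr0 u₁
    have q2 := bregman_left hpq.lt hR1 (u₁ - b)
    have q3 := bregman_right hpq.lt hr0 u₁
    have q4 := bregman_right hpq.lt hR1 (u₁ - b)
    rw [← eu] at q1 q3
    rw [← ew] at q2 q4
    simp only [gapProfile] at hz₁ hz₂
    set α := m 2 * |u₁| ^ p * ((1 + r) * (1 + phiFun p r)) with hα
    set β := κ / p * |u₁ - b| ^ p * ((1 + R) * (1 + phiFun p R)) with hβ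
    have hκp : κ / p * p = κ := div_mul_cancel₀ _ hp0.ne'
    have f1 : α * (1 - lambdaFun p r) = β * (1 - lambdaFun p R) := by
      linear_combination -m 2 * q1 + κ / p * q2 + hz₂ - hz₁ - (u₂ - u₁) * hd₁ +
        phiFun p (u₁ - b) * (u₂ - u₁) * hκp
    have f2 : α * (lambdaFun p r + (p - 1)) = β * (lambdaFun p R + (p - 1)) := by
      linear_combination -m 2 * q3 + κ / p * q4 + hz₁ - hz₂ - (u₁ - u₂) * hd₂ +
        phiFun p (u₂ - b) * (u₁ - u₂) * hκp
    have hβ0 : 0 < β := by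
      have := one_add_phiFun_pos hpq.lt hR1
      have h4 : 0 < |u₁ - b| := abs_pos.2 (by linarith)
      have h5 : 0 < 1 + R := by linarith
      positivity
    have f3 : α = β := by
      have : p * α = p * β := by linarith
      exact mul_left_cancel₀ hp0.ne' this
    rw [f3] at f1
    have := mul_left_cancel₀ hβ0.ne' f1
    linarith
  obtain ⟨g1, g2⟩ := lt_critical_lt_of_lambdaFun_eq hp h₀ hR1 hRr hr1 hlam
  have hρR : ρ R = r := by
    have hmem : R ∈ Icc (-1) R₀ := ⟨hR1.le, g1.le⟩
    exact (lambdaFun_strictMonoOn hp h₀).injOn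
      (hρ.1 R ⟨hR1.le, g1.le.trans h₀.1.2.le⟩) ⟨g2.le, hr1⟩ ((hρ.2.1 R hmem).trans hlam.symm)
  refine ⟨R, ⟨hR1, g1⟩, u₁, κ * phiFun p (u₁ - b), ?_, ?_⟩
  · have := phiFun_neg_of_neg (r := p) (show u₁ - b < 0 by linarith)
    exact mul_pos_of_neg_of_neg hu₁ (mul_neg_of_pos_of_neg hκ this)
  · intro u v
    rw [hm.contact_iff hpq hκ h3, hρR, ← eu]
    have e1 : -(phiFun p R * (κ * phiFun p (u₁ - b))) = κ * phiFun p (u₂ - b) := by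
      rw [phiFun_ratio ew]; ring
    rw [e1]
    constructor
    · rintro ⟨hz, hv⟩
      by_cases hc1 : u = u₁
      · exact Or.inl ⟨hc1, by rw [hv, hc1]⟩
      · by_cases hc2 : u = u₂
        · exact Or.inr ⟨hc2, by rw [hv, hc2]⟩
        · exact absurd hz (tri.pos_of_ne hu hd₁ hd₂ hz₁ hz₂ hc1 hc2).ne'
    · rintro (⟨rfl, rfl⟩ | ⟨rfl, rfl⟩)
      · exact ⟨hz₁, rfl⟩
      · exact ⟨hz₂, rfl⟩

theorem gapProfile_reflCoeff (κ u : ℝ) :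
    gapProfile p κ c (reflCoeff m) u = gapProfile p κ c m (-u) := by
  simp only [gapProfile, reflCoeff, Matrix.cons_val]
  have : -u - m 1 = -(u - -m 1) := by ring
  rw [this, abs_neg, abs_neg]
  ring

/-- A change of signs reduces `m 1 < 0` to `m 1 > 0`. For `m 1 = 0` the gap is strictly convex and
would be negative between its zeros. -/
theorem exists_chord_of_two_zeros (hp : 2 < p) (hpq : p.HolderConjugate q)
    (h₀ : IsCriticalR p R₀) (hρ : IsRho p R₀ ρ) {κ : ℝ} (hκ : 0 < κ)
    (h3 : m 3 = κ ^ (1 - q) / q) (h2 : κ < m 2 * p) (hm : IsMajorant p q c m)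
    {u₁ u₂ : ℝ} (hu : u₁ < u₂) (hz₁ : gapProfile p κ c m u₁ = 0)
    (hz₂ : gapProfile p κ c m u₂ = 0) :
    ∃ R ∈ Ioo (-1) R₀, ∃ a₁ a₂ : ℝ, 0 < a₁ * a₂ ∧ IsChordContact p q ρ c m R a₁ a₂ := by
  rcases lt_trichotomy (m 1) 0 with h1 | h1 | h1
  · obtain ⟨R, hR, a₁, a₂, ha, hc⟩ := exists_chord_of_two_zeros_of_pos (m := reflCoeff m) hp hpq
      h₀ hρ hκ h3 h2 hm.refl (neg_pos.2 h1) (neg_lt_neg hu)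
      (by rw [gapProfile_reflCoeff, neg_neg, hz₂]) (by rw [gapProfile_reflCoeff, neg_neg, hz₁])
    refine ⟨R, hR, -a₁, -a₂, by linarith, ?_⟩
    have := hc.refl
    rwa [reflCoeff_reflCoeff] at this
  · exfalso
    have hnn := (isMajorant_iff hpq hκ h3).1 hm ((1 / 2) * u₁ + (1 / 2) * u₂)
    have h4 : 0 < m 2 - κ / p := by rw [sub_pos, div_lt_iff₀ hpq.pos]; exact h2
    have h5 := (strictConvexOn_abs_rpow hpq.lt).2 (mem_univ u₁) (mem_univ u₂) hu.ne
      (show (0 : ℝ) < 1 / 2 by norm_num) (show (0 : ℝ) < 1 / 2 by norm_num) (by norm_num)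
    simp only [gapProfile, h1, sub_zero, smul_eq_mul] at hnn hz₁ hz₂ h5
    have h6 := mul_lt_mul_of_pos_left h5 h4
    linarith
  · exact exists_chord_of_two_zeros_of_pos hp hpq h₀ hρ hκ h3 h2 hm h1 hu hz₁ hz₂

/-- The equations of `exists_chord_of_two_zeros_of_pos` are solved backwards. The coefficients `a`
and `c` enforce contact at `a₁`, and `λ(r) = λ(R)` then forces contact at the other end. The
triconvex shape excludes further contacts. -/
theorem exists_majorant_of_chord_of_neg (hp : 2 < p) (hpq : p.HolderConjugate q)
    (h₀ : IsCriticalR p R₀) (hρ : IsRho p R₀ ρ) {R : ℝ} (hR : R ∈ Ioo (-1) R₀) {a₁ a₂ : ℝ}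
    (ha₁ : a₁ < 0) (ha₂ : a₂ < 0) :
    ∃ κ c m, 0 < κ ∧ m 3 = κ ^ (1 - q) / q ∧ κ < m 2 * p ∧ IsMajorant p q c m ∧
      IsChordContact p q ρ c m R a₁ a₂ := by
  have hp0 := hpq.pos
  have hmem : R ∈ Icc (-1) R₀ := ⟨hR.1.le, hR.2.le⟩
  obtain ⟨hr0, hr1⟩ := hρ.1 R ⟨hR.1.le, hR.2.le.trans h₀.1.2.le⟩
  have hlam := hρ.2.1 R hmem
  set r := ρ R with hr
  have hR0 := h₀.1.1
  have hR1 := hR.1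
  have hRr : R < r := hR.2.trans_le hr0
  have hrm : -1 < r := hR1.trans hRr
  have hX1 : 0 < 1 + R := by linarith
  have hX2 : 0 < 1 + r := by linarith
  have hY1 := one_add_phiFun_pos hpq.lt hR1
  have hY2 := one_add_phiFun_pos hpq.lt hrm
  -- `w` stands for `a₁ - b`; the distance between the zeros, computed with and without the shift by
  -- `b`, gives `w (1 + R) = a₁ (1 + r)`.
  set w := a₁ * ((1 + r) / (1 + R)) with hw
  have hw0 : w < 0 := mul_neg_of_neg_of_pos ha₁ (by positivity)
  have hwR : w * (1 + R) = a₁ * (1 + r) := by rw [hw]; field_simp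
  set b := a₁ - w with hb
  have hb0 : 0 < b := by
    have : b * (1 + R) = a₁ * (R - r) := by rw [hb]; linarith
    have h4 := mul_pos_of_neg_of_neg ha₁ (sub_neg.2 hRr)
    rw [← this] at h4
    exact pos_of_mul_pos_left h4 hX1.le
  have hφw := phiFun_neg_of_neg (r := p) hw0
  set κ := a₂ / phiFun p w with hκdef
  have hκ : 0 < κ := div_pos_of_neg_of_neg ha₂ hφw
  have hκw : κ * phiFun p w = a₂ := by rw [hκdef]; exact div_mul_cancel₀ _ hφw.ne
  have ha₁p : 0 < |a₁| ^ p := Real.rpow_pos_of_pos (abs_pos.2 ha₁.ne) _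
  -- This choice makes the factors in front of the two Taylor remainders equal.
  set A := κ / p * |w| ^ p * ((1 + R) * (1 + phiFun p R)) /
    (|a₁| ^ p * ((1 + r) * (1 + phiFun p r))) with hA
  have hden : 0 < |a₁| ^ p * ((1 + r) * (1 + phiFun p r)) := by positivity
  have hAeq : A * |a₁| ^ p * ((1 + r) * (1 + phiFun p r)) =
      κ / p * |w| ^ p * ((1 + R) * (1 + phiFun p R)) := by
    rw [mul_assoc, hA, div_mul_cancel₀ _ hden.ne']
  have hAκ : κ < A * p := by
    have hlt := one_add_phiFun_div_lt hp hR1 hRr hr1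
    rw [div_lt_div_iff₀ (by positivity) (by positivity)] at hlt
    have e1 : |w| ^ p * (1 + R) ^ p = |a₁| ^ p * (1 + r) ^ p := by
      have := congrArg (fun z => |z| ^ p) hwR
      simp only [abs_mul, abs_of_pos hX1, abs_of_pos hX2] at this
      rwa [Real.mul_rpow (abs_nonneg _) hX1.le, Real.mul_rpow (abs_nonneg _) hX2.le] at this
    have e2 : ∀ x : ℝ, 0 < x → x ^ p = x ^ (p - 1) * x := by
      intro x hx
      nth_rewrite 3 [← Real.rpow_one x]
      rw [← Real.rpow_add hx]; ring_nf
    have e3 : A * p * (|a₁| ^ p * ((1 + r) * (1 + phiFun p r))) =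
        κ * |w| ^ p * ((1 + R) * (1 + phiFun p R)) := by
      have : κ / p * p = κ := div_mul_cancel₀ _ hp0.ne'
      linear_combination p * hAeq + |w| ^ p * ((1 + R) * (1 + phiFun p R)) * this
    have e4 : κ * (|a₁| ^ p * ((1 + r) * (1 + phiFun p r))) <
        κ * |w| ^ p * ((1 + R) * (1 + phiFun p R)) := by
      rw [mul_assoc]
      refine mul_lt_mul_of_pos_left ?_ hκ
      have hpow : 0 < (1 + R) ^ (p - 1) := by positivity
      refine lt_of_mul_lt_mul_right ?_ hpow.le
      have e5 : |w| ^ p * ((1 + R) * (1 + phiFun p R)) * (1 + R) ^ (p - 1) =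
          |a₁| ^ p * (1 + r) * ((1 + phiFun p R) * (1 + r) ^ (p - 1)) := by
        rw [e2 _ hX1, e2 _ hX2] at e1
        linear_combination (1 + phiFun p R) * e1
      rw [e5]
      have := mul_lt_mul_of_pos_left hlt (show 0 < |a₁| ^ p * (1 + r) by positivity)
      linarith
    rw [← e3] at e4
    exact lt_of_mul_lt_mul_right e4 hden.le
  set a := κ * phiFun p w - A * p * phiFun p a₁ with ha
  set c := κ / p * |w| ^ p - A * |a₁| ^ p - a * a₁ with hc
  set m : Fin 4 → ℝ := ![a, b, A, κ ^ (1 - q) / q] with hm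
  set u₂ := -(r * a₁) with hu₂
  have hub : u₂ - b = -(R * w) := by rw [hu₂, hb]; linarith
  have hub₁ : a₁ - b = w := by rw [hb]; ring
  have hlt : a₁ < u₂ := by
    have := mul_neg_of_neg_of_pos ha₁ hX2
    rw [hu₂]; linarith
  obtain ⟨s₁, hs₁, s₂, hs₂, tri⟩ := exists_isTriconvex_gapProfile (m := m) hp hκ hAκ hb0 c
  have q1 := bregman_left hpq.lt hrm a₁
  have q2 := bregman_left hpq.lt hR1 w
  have q3 := bregman_right hpq.lt hrm a₁
  have q4 := bregman_right hpq.lt hR1 w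
  rw [← hu₂, hlam] at q1 q3
  rw [← hub] at q2 q4
  have hκp : κ / p * p = κ := div_mul_cancel₀ _ hp0.ne'
  have huw : u₂ - b - w = u₂ - a₁ := by rw [hb]; ring
  have z1 : gapProfile p κ c m a₁ = 0 := by
    simp only [gapProfile, hm, Matrix.cons_val, hub₁, hc]; ring
  have d1 : m 0 + m 2 * p * phiFun p a₁ - κ * phiFun p (a₁ - m 1) = 0 := by
    simp only [hm, Matrix.cons_val, hub₁, ha]; ring
  have z2 : gapProfile p κ c m u₂ = 0 := by
    simp only [gapProfile, hm, Matrix.cons_val, hc, ha]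
    linear_combination A * q1 - κ / p * q2 + (1 - lambdaFun p R) * hAeq -
      κ / p * p * phiFun p w * huw - phiFun p w * (u₂ - a₁) * hκp
  have d2 : m 0 + m 2 * p * phiFun p u₂ - κ * phiFun p (u₂ - m 1) = 0 := by
    have hz : (m 0 + m 2 * p * phiFun p u₂ - κ * phiFun p (u₂ - m 1)) * (a₁ - u₂) = 0 := by
      simp only [gapProfile, hm, Matrix.cons_val, hub₁] at z1 z2
      simp only [hm, Matrix.cons_val]
      linear_combination z1 - z2 - A * q3 + κ / p * q4 - (lambdaFun p R + (p - 1)) * hAeq -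
        κ / p * p * phiFun p (u₂ - b) * huw + phiFun p (u₂ - b) * (a₁ - u₂) * hκp
    exact (mul_eq_zero.1 hz).resolve_right (by linarith)
  have hpos := fun u => tri.pos_of_ne (u := u) hlt d1 d2 z1 z2
  have hmaj : IsMajorant p q c m := by
    rw [isMajorant_iff hpq hκ (by rfl)]
    intro u
    by_cases hc1 : u = a₁
    · rw [hc1, z1]
    · by_cases hc2 : u = u₂
      · rw [hc2, z2]
      · exact (hpos u hc1 hc2).le
  refine ⟨κ, c, m, hκ, rfl, hAκ, hmaj, fun u v => ?_⟩
  rw [hmaj.contact_iff hpq hκ (by rfl), ← hr, ← hu₂]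
  have e1 : -(phiFun p R * a₂) = κ * phiFun p (u₂ - b) := by
    rw [phiFun_ratio hub, ← hκw]; ring
  have hm1 : m 1 = b := rfl
  rw [e1, hm1]
  constructor
  · rintro ⟨hz, hv⟩
    by_cases hc1 : u = a₁
    · exact Or.inl ⟨hc1, by rw [hv, hc1, hub₁, hκw]⟩
    · by_cases hc2 : u = u₂
      · exact Or.inr ⟨hc2, by rw [hv, hc2]⟩
      · exact absurd hz (hpos u hc1 hc2).ne'
  · rintro (⟨hu', hv'⟩ | ⟨hu', hv'⟩)
    · rw [hu', hv']
      exact ⟨z1, by rw [hub₁, hκw]⟩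
    · rw [hu', hv']
      exact ⟨z2, rfl⟩

theorem exists_majorant_of_chord (hp : 2 < p) (hpq : p.HolderConjugate q)
    (h₀ : IsCriticalR p R₀) (hρ : IsRho p R₀ ρ) {R : ℝ} (hR : R ∈ Ioo (-1) R₀) {a₁ a₂ : ℝ}
    (ha : 0 < a₁ * a₂) :
    ∃ κ c m, 0 < κ ∧ m 3 = κ ^ (1 - q) / q ∧ κ < m 2 * p ∧ IsMajorant p q c m ∧
      IsChordContact p q ρ c m R a₁ a₂ := by
  rcases pos_and_pos_or_neg_and_neg_of_mul_pos ha with ⟨h1, h2⟩ | ⟨h1, h2⟩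
  · obtain ⟨κ, c, m, hκ, h3, hlt, hm, hc⟩ := exists_majorant_of_chord_of_neg hp hpq h₀ hρ hR
      (neg_neg_of_pos h1) (neg_neg_of_pos h2)
    refine ⟨κ, c, reflCoeff m, hκ, h3, hlt, hm.refl, ?_⟩
    have := hc.refl
    rwa [neg_neg, neg_neg] at this
  · exact exists_majorant_of_chord_of_neg hp hpq h₀ hρ hR h1 h2

end Chord

/-! ### Exposing majorants and the classification of optimal ones. -/

section Exposed

variable {p q : ℝ}

/-- A majorant that is not optimal at any point outside the convex hull of its contact set. -/
def IsExposing (p q c : ℝ) (m : Fin 4 → ℝ) : Prop :=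
  IsMajorant p q c m ∧ ∀ y ∈ omegaC p q, y ∉ convexHull ℝ (contactSet p q c m) →
    ∃ c' m', IsMajorant p q c' m' ∧ affVal c' m' y < affVal c m y

theorem contactSet_hull_subset (hpq : p.HolderConjugate q) (c : ℝ) (m : Fin 4 → ℝ) :
    convexHull ℝ (contactSet p q c m) ⊆ omegaC p q := by
  refine convexHull_min ?_ (convex_omegaC hpq)
  rintro _ ⟨u, v, rfl, -⟩
  exact skelPoint_mem_omegaC u v

theorem isExposing_young (hp : 2 < p) (hpq : p.HolderConjugate q) {r t : ℝ}
    (hr : IsCriticalR p r) (ht : 0 < t) : IsExposing p q 0 (youngCoeff p q t) := by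
  refine ⟨isMajorant_young hpq (mul_pos hpq.pos ht), fun y hy hyC => ?_⟩
  rw [contactSet_young hpq ht] at hyC
  exact exists_better_majorant_of_notMem_hull hp hpq hr ht hy hyC

variable {ρ : ℝ → ℝ} {c κ R a₁ a₂ : ℝ} {m : Fin 4 → ℝ}

theorem chordEnd_eq (hpq : p.HolderConjugate q) (ρ : ℝ → ℝ) (a₁ a₂ R : ℝ) :
    chordEnd p q ρ a₁ a₂ R = skelPoint p q (-(ρ R * a₁)) (-(phiFun p R * a₂)) := by
  have h : |phiFun p R * a₂| ^ q = |R| ^ p * |a₂| ^ q := by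
    rw [abs_mul, Real.mul_rpow (abs_nonneg _) (abs_nonneg _), abs_phiFun hpq.lt,
      ← Real.rpow_mul (abs_nonneg _), hpq.sub_one_mul_conj]
  simp [chordEnd, skelPoint, ← h, abs_mul]

theorem IsChordContact.contactSet_eq (hpq : p.HolderConjugate q)
    (h : IsChordContact p q ρ c m R a₁ a₂) :
    contactSet p q c m = {skelPoint p q a₁ a₂, chordEnd p q ρ a₁ a₂ R} := by
  rw [chordEnd_eq hpq]
  ext x
  constructor
  · rintro ⟨u, v, rfl, huv⟩
    rcases (h u v).1 huv with ⟨rfl, rfl⟩ | ⟨rfl, rfl⟩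
    · exact Or.inl rfl
    · exact Or.inr rfl
  · rintro (rfl | rfl)
    · exact ⟨_, _, rfl, (h _ _).2 (Or.inl ⟨rfl, rfl⟩)⟩
    · exact ⟨_, _, rfl, (h _ _).2 (Or.inr ⟨rfl, rfl⟩)⟩

theorem IsChordContact.hull_eq (hpq : p.HolderConjugate q)
    (h : IsChordContact p q ρ c m R a₁ a₂) :
    convexHull ℝ (contactSet p q c m) =
      segment ℝ (skelPoint p q a₁ a₂) (chordEnd p q ρ a₁ a₂ R) := by
  rw [h.contactSet_eq hpq, convexHull_pair]

theorem IsMajorant.isExposing_of_finite (hpq : p.HolderConjugate q) (hκ : 0 < κ)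
    (h3 : m 3 = κ ^ (1 - q) / q) (h2 : κ < m 2 * p) (hm : IsMajorant p q c m)
    (hfin : (contactSet p q c m).Finite) : IsExposing p q c m :=
  ⟨hm, fun _ _ hy => exists_better_majorant_of_coercive hpq hκ h3 h2 hm hfin hy⟩

theorem mem_openSegment_of_mem_interior (hpq : p.HolderConjugate q) {x : Fin 4 → ℝ}
    (hx : x ∈ interior (omegaC p q))
    (hs : x ∈ segment ℝ (skelPoint p q a₁ a₂) (chordEnd p q ρ a₁ a₂ R)) :
    x ∈ openSegment ℝ (skelPoint p q a₁ a₂) (chordEnd p q ρ a₁ a₂ R) := by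
  rw [← insert_endpoints_openSegment] at hs
  rcases hs with rfl | rfl | h
  · exact absurd hx (skelPoint_notMem_interior hpq _ _)
  · rw [chordEnd_eq hpq] at hx
    exact absurd hx (skelPoint_notMem_interior hpq _ _)
  · exact h

/-- Every optimal majorant at an interior point touches the skeleton along a curve `γ_t` or at the
endpoints of a chord. -/
theorem optimal_majorant_cases (hp : 2 < p) (hpq : p.HolderConjugate q) {R₀ : ℝ}
    (h₀ : IsCriticalR p R₀) (hρ : IsRho p R₀ ρ) {x : Fin 4 → ℝ} (hx : x ∈ interior (omegaC p q))
    (hm : IsMajorant p q c m)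
    (hopt : ∀ c' m', IsMajorant p q c' m' → affVal c m x ≤ affVal c' m' x) :
    (∃ t > 0, c = 0 ∧ m = youngCoeff p q t) ∨
      IsExposing p q c m ∧
        ∃ R ∈ Ioo (-1) R₀, ∃ a₁ a₂ : ℝ, 0 < a₁ * a₂ ∧ IsChordContact p q ρ c m R a₁ a₂ := by
  have hp0 := hpq.pos
  obtain ⟨κ, hκ, h3⟩ := hm.exists_kappa hpq
  obtain ⟨hle, hne⟩ := hm.ratio hp hpq hκ h3
  have hnn := (isMajorant_iff hpq hκ h3).1 hm
  -- In the case of equality `m 1 = 0` and the gap is affine in `u`. Nonnegativity gives `m 0 = 0`,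
  -- and optimality against the Young majorant with the same `κ` gives `c = 0`.
  rcases hle.eq_or_lt with heq | hlt
  · left
    have h1 : m 1 = 0 := by
      by_contra h
      exact absurd (hne h) (by linarith)
    have h2 : m 2 = κ / p := by rw [heq]; field_simp
    have hlin : ∀ u, 0 ≤ c + m 0 * u := by
      intro u
      have := hnn u
      rw [gapProfile, h1, h2, sub_zero] at this
      linarith
    have hm0 : m 0 = 0 := by
      by_contra h
      have := hlin ((-c - 1) / m 0)
      rw [mul_div_cancel₀ _ h] at this
      linarith
    have hκt : p * (κ / p) = κ := by field_simp
    have hmy : m = youngCoeff p q (κ / p) := by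
      ext i
      fin_cases i <;> simp [youngCoeff, hκt, hm0, h1, h2, h3]
    have ht : 0 < κ / p := by positivity
    have hc := hopt 0 _ (isExposing_young hp hpq h₀ ht).1
    rw [← hmy, affVal, affVal] at hc
    have hc' := hlin 0
    exact ⟨κ / p, ht, by linarith, hmy⟩
  · right
    by_cases hz : ∃ u₁ u₂, u₁ < u₂ ∧ gapProfile p κ c m u₁ = 0 ∧ gapProfile p κ c m u₂ = 0
    · obtain ⟨u₁, u₂, hu, hz₁, hz₂⟩ := hz
      obtain ⟨R, hR, a₁, a₂, ha, hc⟩ :=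
        exists_chord_of_two_zeros hp hpq h₀ hρ hκ h3 hlt hm hu hz₁ hz₂
      refine ⟨hm.isExposing_of_finite hpq hκ h3 hlt ?_, R, hR, a₁, a₂, ha, hc⟩
      rw [hc.contactSet_eq hpq]
      exact toFinite _
    -- With at most one contact point the hull is empty or a skeleton point, so it misses `x`, and
    -- coercivity allows an improvement.
    · exfalso
      have hsub : (contactSet p q c m).Subsingleton := by
        rintro _ ⟨u, v, rfl, huv⟩ _ ⟨u', v', rfl, huv'⟩
        obtain ⟨e1, rfl⟩ := (hm.contact_iff hpq hκ h3).1 huv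
        obtain ⟨e2, rfl⟩ := (hm.contact_iff hpq hκ h3).1 huv'
        rcases lt_trichotomy u u' with h | rfl | h
        · exact absurd ⟨u, u', h, e1, e2⟩ hz
        · rfl
        · exact absurd ⟨u', u, h, e2, e1⟩ hz
      by_cases hxC : x ∈ convexHull ℝ (contactSet p q c m)
      · rcases hsub.eq_empty_or_singleton with h | ⟨z, h⟩
        · rw [h, convexHull_empty] at hxC
          exact hxC
        · have hz' : z ∈ contactSet p q c m := by rw [h]; rfl
          rw [h, convexHull_singleton] at hxC
          obtain ⟨u, v, rfl, -⟩ := hz'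
          rw [mem_singleton_iff] at hxC
          exact skelPoint_notMem_interior hpq u v (hxC ▸ hx)
      · obtain ⟨c', m', hm', hlt'⟩ :=
          exists_better_majorant_of_coercive hpq hκ h3 hlt hm hsub.finite hxC
        exact absurd (hopt c' m' hm') (by linarith)

theorem exists_exposing_chord (hp : 2 < p) (hpq : p.HolderConjugate q) {R₀ : ℝ}
    (h₀ : IsCriticalR p R₀) (hρ : IsRho p R₀ ρ) (hR : R ∈ Ioo (-1) R₀) (ha : 0 < a₁ * a₂) :
    ∃ c m, IsExposing p q c m ∧ convexHull ℝ (contactSet p q c m) =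
      segment ℝ (skelPoint p q a₁ a₂) (chordEnd p q ρ a₁ a₂ R) := by
  obtain ⟨κ, c, m, hκ, h3, h2, hm, hc⟩ := exists_majorant_of_chord hp hpq h₀ hρ hR ha
  refine ⟨c, m, hm.isExposing_of_finite hpq hκ h3 h2 ?_, hc.hull_eq hpq⟩
  rw [hc.contactSet_eq hpq]
  exact toFinite _

/-- An interior point lies in the convex hull of the contact set of an optimal majorant, which is
the convex hull of a curve `γ_t` or a chord. -/
theorem exists_optimal_of_mem_interior (hp : 2 < p) (hpq : p.HolderConjugate q) {R₀ : ℝ}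
    (h₀ : IsCriticalR p R₀) (hρ : IsRho p R₀ ρ) {x : Fin 4 → ℝ}
    (hx : x ∈ interior (omegaC p q)) :
    ∃ c m, IsMajorant p q c m ∧
      (∀ c' m', IsMajorant p q c' m' → affVal c m x ≤ affVal c' m' x) ∧
      x ∈ convexHull ℝ (contactSet p q c m) ∧
      ((∃ t > 0, convexHull ℝ (contactSet p q c m) = convexHull ℝ (gammaCurve p q t)) ∨
        ∃ R ∈ Ioo (-1) R₀, ∃ a₁ a₂ : ℝ, 0 < a₁ * a₂ ∧ convexHull ℝ (contactSet p q c m) =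
          segment ℝ (skelPoint p q a₁ a₂) (chordEnd p q ρ a₁ a₂ R)) := by
  obtain ⟨c, m, hm, hopt⟩ := exists_optimal_majorant hpq hx
  refine ⟨c, m, hm, hopt, ?_⟩
  have hexp : IsExposing p q c m → x ∈ convexHull ℝ (contactSet p q c m) := by
    intro h
    by_contra hxC
    obtain ⟨c', m', hm', hlt⟩ := h.2 x (interior_subset hx) hxC
    exact absurd (hopt c' m' hm') (by linarith)
  rcases optimal_majorant_cases hp hpq h₀ hρ hx hm hopt with
    ⟨t, ht, rfl, rfl⟩ | ⟨hE, R, hR, a₁, a₂, ha, hc⟩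
  · exact ⟨hexp (isExposing_young hp hpq h₀ ht), Or.inl ⟨t, ht, by rw [contactSet_young hpq ht]⟩⟩
  · exact ⟨hexp hE, Or.inr ⟨R, hR, a₁, a₂, ha, hc.hull_eq hpq⟩⟩

end Exposed

/-! ### Uniqueness of the optimal majorant. -/

section Uniqueness

variable {p q c c' : ℝ} {m m' : Fin 4 → ℝ}

/-- With `v` frozen, the gap is minimal at a contact point, so its derivative in `u` vanishes. -/
theorem IsMajorant.contact_slope_left (hpq : p.HolderConjugate q) (hm : IsMajorant p q c m)
    {u v : ℝ} (h : u * v = affVal c m (skelPoint p q u v)) :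
    m 0 + m 2 * p * phiFun p u = v := by
  have hd : HasDerivAt (fun s => affVal c m (skelPoint p q s v) - s * v)
      (m 0 + m 2 * (p * phiFun p u) - v) u := by
    have h1 := (((hasDerivAt_id u).const_mul (m 0)).add
      ((hasDerivAt_abs_rpow_phiFun hpq.lt u).const_mul (m 2))).sub
      ((hasDerivAt_id u).mul_const v)
    have h2 := h1.const_add (c + m 1 * v + m 3 * |v| ^ q)
    refine (h2.congr_of_eventuallyEq ?_).congr_deriv (by ring)
    refine Filter.Eventually.of_forall fun s => ?_
    simp only [affVal_skelPoint, Pi.add_apply, Pi.sub_apply, id]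
    ring
  have hmin : IsLocalMin (fun s => affVal c m (skelPoint p q s v) - s * v) u := by
    refine Filter.Eventually.of_forall fun s => ?_
    have := hm s v
    simp only
    linarith
  linarith [hmin.hasDerivAt_eq_zero hd]

theorem IsMajorant.contact_slope_right (hpq : p.HolderConjugate q) (hm : IsMajorant p q c m)
    {u v : ℝ} (h : u * v = affVal c m (skelPoint p q u v)) :
    m 1 + m 3 * q * phiFun q v = u := by
  have hd : HasDerivAt (fun s => affVal c m (skelPoint p q u s) - u * s)
      (m 1 + m 3 * (q * phiFun q v) - u) v := by
    have h1 := (((hasDerivAt_id v).const_mul (m 1)).add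
      ((hasDerivAt_abs_rpow_phiFun hpq.symm.lt v).const_mul (m 3))).sub
      ((hasDerivAt_id v).const_mul u)
    have h2 := h1.const_add (c + m 0 * u + m 2 * |u| ^ p)
    refine (h2.congr_of_eventuallyEq ?_).congr_deriv (by ring)
    refine Filter.Eventually.of_forall fun s => ?_
    simp only [affVal_skelPoint, Pi.add_apply, Pi.sub_apply, id]
    ring
  have hmin : IsLocalMin (fun s => affVal c m (skelPoint p q u s) - u * s) v := by
    refine Filter.Eventually.of_forall fun s => ?_
    have := hm u s
    simp only
    linarith
  linarith [hmin.hasDerivAt_eq_zero hd]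

/-- At a contact point the two coordinates determine each other. -/
theorem IsMajorant.contact_injective (hpq : p.HolderConjugate q) (hm : IsMajorant p q c m)
    {u v u' v' : ℝ} (h : u * v = affVal c m (skelPoint p q u v))
    (h' : u' * v' = affVal c m (skelPoint p q u' v')) : u = u' ↔ v = v' := by
  have h1 := hm.contact_slope_left hpq h
  have h2 := hm.contact_slope_left hpq h'
  have h3 := hm.contact_slope_right hpq h
  have h4 := hm.contact_slope_right hpq h'
  constructor
  · rintro rfl; linarith
  · rintro rfl; linarith

theorem eq_of_affine_eq_two {a b a' b' x y : ℝ} (hxy : x ≠ y) (hx : a + b * x = a' + b' * x)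
    (hy : a + b * y = a' + b' * y) : a = a' ∧ b = b' := by
  have hb : b = b' := by
    have : (b - b') * (x - y) = 0 := by linear_combination hx - hy
    linarith [(mul_eq_zero.1 this).resolve_right (sub_ne_zero.2 hxy)]
  subst hb
  exact ⟨by linarith, rfl⟩

/-- Two majorants with two common contact points coincide. -/
theorem IsMajorant.eq_of_two_contacts (hpq : p.HolderConjugate q) (hm : IsMajorant p q c m)
    (hm' : IsMajorant p q c' m') {u v u' v' : ℝ} (hne : u ≠ u')
    (h : u * v = affVal c m (skelPoint p q u v)) (h' : u' * v' = affVal c m (skelPoint p q u' v'))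
    (k : u * v = affVal c' m' (skelPoint p q u v))
    (k' : u' * v' = affVal c' m' (skelPoint p q u' v')) : c = c' ∧ m = m' := by
  have hp := hpq.pos
  have hq := hpq.symm.pos
  have hv : v ≠ v' := fun e => hne ((hm.contact_injective hpq h h').2 e)
  have hφ : phiFun p u ≠ phiFun p u' := (phiFun_strictMono hpq.lt).injective.ne hne
  have hψ : phiFun q v ≠ phiFun q v' := (phiFun_strictMono hpq.symm.lt).injective.ne hv
  obtain ⟨e0, e2⟩ := eq_of_affine_eq_two hφ
    ((hm.contact_slope_left hpq h).trans (hm'.contact_slope_left hpq k).symm)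
    ((hm.contact_slope_left hpq h').trans (hm'.contact_slope_left hpq k').symm)
  obtain ⟨e1, e3⟩ := eq_of_affine_eq_two hψ
    ((hm.contact_slope_right hpq h).trans (hm'.contact_slope_right hpq k).symm)
    ((hm.contact_slope_right hpq h').trans (hm'.contact_slope_right hpq k').symm)
  have e2' := mul_right_cancel₀ hp.ne' e2
  have e3' := mul_right_cancel₀ hq.ne' e3
  rw [affVal_skelPoint] at h k
  rw [← e0, ← e1, ← e2', ← e3'] at k
  refine ⟨by linarith, ?_⟩
  ext i
  fin_cases i <;> assumption

/-- At an interior point of the convex hull of its contact set a majorant is the only optimal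
one. -/
theorem IsMajorant.eq_of_optimal (hpq : p.HolderConjugate q) (hm : IsMajorant p q c m)
    (hm' : IsMajorant p q c' m') {x : Fin 4 → ℝ} (hx : x ∈ interior (omegaC p q))
    (hxC : x ∈ convexHull ℝ (contactSet p q c m)) (hle : affVal c' m' x ≤ affVal c m x) :
    c = c' ∧ m = m' := by
  obtain ⟨ι, _, w, z, hw, hw1, hz, rfl⟩ := mem_convexHull_iff_exists_fintype.1 hxC
  choose u v hzuv hval using hz
  rw [affVal_sum _ _ hw1, affVal_sum _ _ hw1] at hle
  have hterm : ∀ i, w i * affVal c m (z i) ≤ w i * affVal c' m' (z i) := by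
    intro i
    refine mul_le_mul_of_nonneg_left ?_ (hw i)
    rw [← hval i, hzuv i]
    exact hm' _ _
  -- A termwise inequality whose sums satisfy the reverse inequality is an equality in every term:
  -- points of nonzero weight are contacts of both majorants.
  have heq : ∀ i, w i * affVal c m (z i) = w i * affVal c' m' (z i) := fun i =>
    (Finset.sum_eq_sum_iff_of_le fun i _ => hterm i).1
      (le_antisymm (Finset.sum_le_sum fun i _ => hterm i) hle) i (Finset.mem_univ i)
  have hcon : ∀ i, w i ≠ 0 → u i * v i = affVal c' m' (skelPoint p q (u i) (v i)) := by
    intro i hi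
    rw [hval i, mul_left_cancel₀ hi (heq i), hzuv i]
  have hcon0 : ∀ i, u i * v i = affVal c m (skelPoint p q (u i) (v i)) := by
    intro i
    rw [hval i, ← hzuv i]
  obtain ⟨i, hi⟩ : ∃ i, w i ≠ 0 := by
    by_contra! h
    simp [h] at hw1
  by_cases hj : ∃ j, w j ≠ 0 ∧ u i ≠ u j
  · obtain ⟨j, hj, hne⟩ := hj
    exact hm.eq_of_two_contacts hpq hm' hne (hcon0 i) (hcon0 j) (hcon i hi) (hcon j hj)
  -- All points of nonzero weight coincide, so `x` would be a skeleton point.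
  · push Not at hj
    exfalso
    refine skelPoint_notMem_interior hpq (u i) (v i) ?_
    convert hx
    have : ∀ j, w j • z j = w j • skelPoint p q (u i) (v i) := by
      intro j
      by_cases hwj : w j = 0
      · simp [hwj]
      · rw [hzuv j, ← hj j hwj, ← (hm.contact_injective hpq (hcon0 i) (hcon0 j)).1 (hj j hwj)]
    rw [Finset.sum_congr rfl fun j _ => this j, ← Finset.sum_smul, hw1, one_smul]

end Uniqueness

/-! ### From exposing majorants to linearity domains. -/

section Domains

variable {p q α β c : ℝ} {m : Fin 4 → ℝ} {ρ : ℝ → ℝ} {R₀ : ℝ}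

theorem exists_affineMap_affVal (c : ℝ) (m : Fin 4 → ℝ) :
    ∃ L : (Fin 4 → ℝ) →ᵃ[ℝ] ℝ, ∀ x, L x = affVal c m x := by
  refine ⟨(∑ i, m i • (LinearMap.proj i : (Fin 4 → ℝ) →ₗ[ℝ] ℝ)).toAffineMap +
    AffineMap.const ℝ _ c, fun x => ?_⟩
  simp only [AffineMap.coe_add, Pi.add_apply, LinearMap.coe_toAffineMap, AffineMap.const_apply,
    Fin.sum_univ_four, LinearMap.add_apply, LinearMap.smul_apply, LinearMap.proj_apply,
    smul_eq_mul, affVal]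
  ring

theorem affVal_midpoint (c : ℝ) (m x y : Fin 4 → ℝ) :
    affVal c m (midpoint ℝ x y) = (affVal c m x + affVal c m y) / 2 := by
  obtain ⟨L, hL⟩ := exists_affineMap_affVal c m
  rw [← hL, ← hL, ← hL, AffineMap.map_midpoint, midpoint_eq_smul_add, smul_eq_mul, invOf_eq_inv]
  ring

/-- On a convex set on which the Bellman function is affine and which contains an interior
point of the hull of the contact set, the Bellman function is given by the majorant. -/
theorem bellmanC_eq_of_affine (hp : 2 < p) (hpq : p.HolderConjugate q) (hI : α < β)
    (h₀ : IsCriticalR p R₀) (hρ : IsRho p R₀ ρ) (hm : IsMajorant p q c m)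
    {D : Set (Fin 4 → ℝ)} (hD : D ⊆ omegaC p q) (hDc : Convex ℝ D) (L : (Fin 4 → ℝ) →ᵃ[ℝ] ℝ)
    (hL : ∀ x ∈ D, bellmanC α β p q x = ((L x : ℝ) : EReal)) {x : Fin 4 → ℝ} (hxD : x ∈ D)
    (hx : x ∈ interior (omegaC p q)) (hxC : x ∈ convexHull ℝ (contactSet p q c m))
    {y : Fin 4 → ℝ} (hy : y ∈ D) : bellmanC α β p q y = ((affVal c m y : ℝ) : EReal) := by
  -- `y` may lie on the boundary of `Ω_c`, where no optimal majorant is provided; the midpoint is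
  -- interior.
  have hz : midpoint ℝ x y ∈ openSegment ℝ x y := midpoint_mem_openSegment _ _
  have hzD : midpoint ℝ x y ∈ D := hDc.openSegment_subset hxD hy hz
  have hzi : midpoint ℝ x y ∈ interior (omegaC p q) :=
    (convex_omegaC hpq).openSegment_interior_self_subset_interior hx (hD hy) hz
  obtain ⟨c', m', hm', -, hzC, -⟩ := exists_optimal_of_mem_interior hp hpq h₀ hρ hzi
  have e1 : L x = affVal c m x := by
    have := hL x hxD
    rw [bellmanC_eq_of_mem_convexHull hpq hI hm hxC] at this
    exact (EReal.coe_eq_coe_iff.1 this).symm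
  have e2 : (L x + L y) / 2 = (affVal c' m' x + affVal c' m' y) / 2 := by
    have := hL _ hzD
    rw [bellmanC_eq_of_mem_convexHull hpq hI hm' hzC, affVal_midpoint, AffineMap.map_midpoint,
      midpoint_eq_smul_add, smul_eq_mul, invOf_eq_inv] at this
    have := EReal.coe_eq_coe_iff.1 this
    linarith
  have l1 : L x ≤ affVal c' m' x := by
    have := bellmanC_le hpq hI hm' x
    rwa [hL x hxD, EReal.coe_le_coe_iff] at this
  have l2 : L y ≤ affVal c' m' y := by
    have := bellmanC_le hpq hI hm' y
    rwa [hL y hy, EReal.coe_le_coe_iff] at this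
  -- `L` lies below the new majorant at `x` and at `y` and equals it at the midpoint, so it equals
  -- it at both ends. The new majorant is therefore optimal at `x` and coincides with the given one.
  obtain ⟨rfl, rfl⟩ := hm.eq_of_optimal hpq hm' hx hxC (by linarith)
  rw [hL y hy, EReal.coe_eq_coe_iff]
  linarith

theorem isAffineOn_hull (hpq : p.HolderConjugate q) (hI : α < β) (hm : IsMajorant p q c m) :
    convexHull ℝ (contactSet p q c m) ⊆ omegaC p q ∧
      Convex ℝ (convexHull ℝ (contactSet p q c m)) ∧
      ∃ L : (Fin 4 → ℝ) →ᵃ[ℝ] ℝ, ∀ x ∈ convexHull ℝ (contactSet p q c m),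
        bellmanC α β p q x = ((L x : ℝ) : EReal) := by
  refine ⟨contactSet_hull_subset hpq c m, convex_convexHull ℝ _, ?_⟩
  obtain ⟨L, hL⟩ := exists_affineMap_affVal c m
  exact ⟨L, fun x hx => by rw [hL, bellmanC_eq_of_mem_convexHull hpq hI hm hx]⟩

/-- A convex set on which the Bellman function is affine is contained in the hull of the contact
set of an exposing majorant as soon as they have a common interior point. -/
theorem subset_hull_of_affine (hp : 2 < p) (hpq : p.HolderConjugate q) (hI : α < β)
    (h₀ : IsCriticalR p R₀) (hρ : IsRho p R₀ ρ) (hE : IsExposing p q c m)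
    {D : Set (Fin 4 → ℝ)} (hD : D ⊆ omegaC p q ∧ Convex ℝ D ∧ ∃ L : (Fin 4 → ℝ) →ᵃ[ℝ] ℝ,
      ∀ x ∈ D, bellmanC α β p q x = ((L x : ℝ) : EReal)) {x : Fin 4 → ℝ} (hxD : x ∈ D)
    (hx : x ∈ interior (omegaC p q)) (hxC : x ∈ convexHull ℝ (contactSet p q c m)) :
    D ⊆ convexHull ℝ (contactSet p q c m) := by
  obtain ⟨hDs, hDc, L, hL⟩ := hD
  intro y hy
  by_contra hyC
  obtain ⟨c', m', hm', hlt⟩ := hE.2 y (hDs hy) hyC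
  have h1 := bellmanC_le (α := α) (β := β) hpq hI hm' y
  rw [bellmanC_eq_of_affine hp hpq hI h₀ hρ hE.1 hDs hDc L hL hxD hx hxC hy,
    EReal.coe_le_coe_iff] at h1
  linarith

/-- Maximality holds because any larger admissible set still contains the interior point `x`, and
`subset_hull_of_affine` applies to it. -/
theorem isLinearityDomain_hull (hp : 2 < p) (hpq : p.HolderConjugate q) (hI : α < β)
    (h₀ : IsCriticalR p R₀) (hρ : IsRho p R₀ ρ) (hE : IsExposing p q c m) {x : Fin 4 → ℝ}
    (hx : x ∈ interior (omegaC p q)) (hxC : x ∈ convexHull ℝ (contactSet p q c m)) :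
    IsLinearityDomain (omegaC p q) (bellmanC α β p q) (convexHull ℝ (contactSet p q c m)) :=
  ⟨isAffineOn_hull hpq hI hE.1, fun _ hD hsub =>
    subset_hull_of_affine hp hpq hI h₀ hρ hE hD (hsub hxC) hx hxC⟩

theorem IsLinearityDomain.eq_hull (hp : 2 < p) (hpq : p.HolderConjugate q) (hI : α < β)
    (h₀ : IsCriticalR p R₀) (hρ : IsRho p R₀ ρ) (hE : IsExposing p q c m) {x : Fin 4 → ℝ}
    (hx : x ∈ interior (omegaC p q)) (hxC : x ∈ convexHull ℝ (contactSet p q c m))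
    {D : Set (Fin 4 → ℝ)} (hD : IsLinearityDomain (omegaC p q) (bellmanC α β p q) D)
    (hxD : x ∈ D) : D = convexHull ℝ (contactSet p q c m) := by
  have hsub := subset_hull_of_affine hp hpq hI h₀ hρ hE hD.1 hxD hx hxC
  exact hsub.antisymm (hD.2 (isAffineOn_hull hpq hI hE.1) hsub)

/-- An exposing majorant through a given interior point. -/
theorem exists_exposing_of_mem_interior (hp : 2 < p) (hpq : p.HolderConjugate q)
    (h₀ : IsCriticalR p R₀) (hρ : IsRho p R₀ ρ) {x : Fin 4 → ℝ}
    (hx : x ∈ interior (omegaC p q)) :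
    ∃ c m, IsExposing p q c m ∧ x ∈ convexHull ℝ (contactSet p q c m) ∧
      ((∃ t > 0, convexHull ℝ (contactSet p q c m) = convexHull ℝ (gammaCurve p q t)) ∨
        ∃ R ∈ Ioo (-1) R₀, ∃ a₁ a₂ : ℝ, 0 < a₁ * a₂ ∧ convexHull ℝ (contactSet p q c m) =
          segment ℝ (skelPoint p q a₁ a₂) (chordEnd p q ρ a₁ a₂ R)) := by
  obtain ⟨_, _, -, -, hxC, h⟩ := exists_optimal_of_mem_interior hp hpq h₀ hρ hx
  rcases h with ⟨t, ht, e⟩ | ⟨R, hR, a₁, a₂, ha, e⟩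
  · rw [e] at hxC
    refine ⟨0, youngCoeff p q t, isExposing_young hp hpq h₀ ht, ?_, Or.inl ⟨t, ht, ?_⟩⟩
    · rwa [contactSet_young hpq ht]
    · rw [contactSet_young hpq ht]
  · obtain ⟨c, m, hE, e'⟩ := exists_exposing_chord hp hpq h₀ hρ hR ha
    rw [e, ← e'] at hxC
    exact ⟨c, m, hE, hxC, Or.inr ⟨R, hR, a₁, a₂, ha, e'⟩⟩

theorem existsUnique_isLinearityDomain (hp : 2 < p) (hpq : p.HolderConjugate q) (hI : α < β)
    (h₀ : IsCriticalR p R₀) (hρ : IsRho p R₀ ρ) {x : Fin 4 → ℝ}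
    (hx : x ∈ interior (omegaC p q)) :
    ∃! C : Set (Fin 4 → ℝ), IsLinearityDomain (omegaC p q) (bellmanC α β p q) C ∧ x ∈ C := by
  obtain ⟨c, m, hE, hxC, -⟩ := exists_exposing_of_mem_interior hp hpq h₀ hρ hx
  exact ⟨_, ⟨isLinearityDomain_hull hp hpq hI h₀ hρ hE hx hxC, hxC⟩,
    fun D hD => hD.1.eq_hull hp hpq hI h₀ hρ hE hx hxC hD.2⟩

/-- The linearity domains that meet the interior are hulls of curves `γ_t` or chords. -/
theorem IsInnerLinearityDomain.cases (hp : 2 < p) (hpq : p.HolderConjugate q) (hI : α < β)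
    (h₀ : IsCriticalR p R₀) (hρ : IsRho p R₀ ρ) {C : Set (Fin 4 → ℝ)}
    (hC : IsInnerLinearityDomain α β p q C) :
    (∃ t > 0, C = convexHull ℝ (gammaCurve p q t)) ∨
      ∃ R ∈ Ioo (-1) R₀, ∃ a₁ a₂ : ℝ, 0 < a₁ * a₂ ∧
        C = segment ℝ (skelPoint p q a₁ a₂) (chordEnd p q ρ a₁ a₂ R) := by
  obtain ⟨hlin, x, hxC, hx⟩ := hC
  obtain ⟨c, m, hE, hx', h⟩ := exists_exposing_of_mem_interior hp hpq h₀ hρ hx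
  rwa [← hlin.eq_hull hp hpq hI h₀ hρ hE hx hx' hxC] at h

end Domains

/-! ### Dimensions, interior points and images under `T`. -/

section Geometry

variable {p q α β t R a₁ a₂ R₀ : ℝ} {ρ : ℝ → ℝ}

theorem gamma_center_mem (hpq : p.HolderConjugate q) (ht : 0 < t) :
    ![0, 0, 1, (p * t) ^ q] ∈ convexHull ℝ (gammaCurve p q t) := by
  have h1 := skelPoint_mem_gamma_hull hpq ht 1
  have h2 := skelPoint_mem_gamma_hull hpq ht (-1)
  have h3 := (convex_convexHull ℝ (gammaCurve p q t)) h1 h2 (a := 1 / 2) (b := 1 / 2)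
    (by norm_num) (by norm_num) (by norm_num)
  convert h3 using 1
  have hκ : 0 < p * t := mul_pos hpq.pos ht
  ext i
  fin_cases i <;>
    simp [skelPoint, phiFun_one, phiFun_neg, abs_of_pos hpq.pos, abs_of_pos ht] <;> ring

theorem gamma_center_mem_interior (hpq : p.HolderConjugate q) (ht : 0 < t) :
    (![0, 0, 1, (p * t) ^ q] : Fin 4 → ℝ) ∈ interior (omegaC p q) := by
  have hκ : 0 < p * t := mul_pos hpq.pos ht
  rw [mem_interior_omegaC_iff hpq]
  simp only [Matrix.cons_val, abs_zero, Real.zero_rpow hpq.ne_zero,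
    Real.zero_rpow hpq.symm.ne_zero]
  exact ⟨one_pos, by positivity⟩

theorem isInnerLinearityDomain_gamma (hp : 2 < p) (hpq : p.HolderConjugate q) (hI : α < β)
    (h₀ : IsCriticalR p R₀) (hρ : IsRho p R₀ ρ) (ht : 0 < t) :
    IsInnerLinearityDomain α β p q (convexHull ℝ (gammaCurve p q t)) := by
  have h1 := gamma_center_mem hpq ht
  have h2 := gamma_center_mem_interior hpq ht
  refine ⟨?_, _, h1, h2⟩
  rw [← contactSet_young hpq ht] at h1 ⊢
  exact isLinearityDomain_hull hp hpq hI h₀ hρ (isExposing_young hp hpq h₀ ht) h2 h1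

/-- Both `1 + ρ R` and `1 + φ(R)` are positive, so the endpoints differ in each of the first two
coordinates, and strict convexity of both powers applies. -/
theorem openSegment_chord_subset_interior (hpq : p.HolderConjugate q)
    (h₀ : IsCriticalR p R₀) (hρ : IsRho p R₀ ρ) (hR : R ∈ Ioo (-1) R₀) (ha : 0 < a₁ * a₂) :
    openSegment ℝ (skelPoint p q a₁ a₂) (chordEnd p q ρ a₁ a₂ R) ⊆ interior (omegaC p q) := by
  have ha₁ : a₁ ≠ 0 := left_ne_zero_of_mul ha.ne'
  have ha₂ : a₂ ≠ 0 := right_ne_zero_of_mul ha.ne'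
  have hρR : 0 < ρ R := h₀.1.1.trans_le (hρ.1 R ⟨hR.1.le, (hR.2.trans h₀.1.2).le⟩).1
  have hφ := one_add_phiFun_pos hpq.lt hR.1
  have n1 : a₁ ≠ -(ρ R * a₁) := by
    intro h
    have : (1 + ρ R) * a₁ = 0 := by linarith
    rcases mul_eq_zero.1 this with h | h
    · linarith
    · exact ha₁ h
  have n2 : a₂ ≠ -(phiFun p R * a₂) := by
    intro h
    have : (1 + phiFun p R) * a₂ = 0 := by linarith
    rcases mul_eq_zero.1 this with h | h
    · linarith
    · exact ha₂ h
  rw [chordEnd_eq hpq]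
  rintro _ ⟨s, s', hs, hs', hss, rfl⟩
  rw [mem_interior_omegaC_iff hpq]
  have h1 := (strictConvexOn_abs_rpow hpq.lt).2 (mem_univ _) (mem_univ _) n1 hs hs' hss
  have h2 := (strictConvexOn_abs_rpow hpq.symm.lt).2 (mem_univ _) (mem_univ _) n2 hs hs' hss
  exact ⟨h1, h2⟩

theorem exists_chord_interior (hpq : p.HolderConjugate q)
    (h₀ : IsCriticalR p R₀) (hρ : IsRho p R₀ ρ) (hR : R ∈ Ioo (-1) R₀) (ha : 0 < a₁ * a₂) :
    ∃ x ∈ segment ℝ (skelPoint p q a₁ a₂) (chordEnd p q ρ a₁ a₂ R),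
      x ∈ interior (omegaC p q) :=
  ⟨_, openSegment_subset_segment _ _ _ (midpoint_mem_openSegment _ _),
    openSegment_chord_subset_interior hpq h₀ hρ hR ha (midpoint_mem_openSegment _ _)⟩

theorem isInnerLinearityDomain_chord (hp : 2 < p) (hpq : p.HolderConjugate q) (hI : α < β)
    (h₀ : IsCriticalR p R₀) (hρ : IsRho p R₀ ρ) (hR : R ∈ Ioo (-1) R₀) (ha : 0 < a₁ * a₂) :
    IsInnerLinearityDomain α β p q
      (segment ℝ (skelPoint p q a₁ a₂) (chordEnd p q ρ a₁ a₂ R)) := by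
  obtain ⟨x, hxs, hx⟩ := exists_chord_interior hpq h₀ hρ hR ha
  refine ⟨?_, x, hxs, hx⟩
  obtain ⟨c, m, hE, e⟩ := exists_exposing_chord hp hpq h₀ hρ hR ha
  rw [← e] at hxs ⊢
  exact isLinearityDomain_hull hp hpq hI h₀ hρ hE hx hxs

theorem affineDim_chord (hpq : p.HolderConjugate q)
    (h₀ : IsCriticalR p R₀) (hρ : IsRho p R₀ ρ) (hR : R ∈ Ioo (-1) R₀) (ha : 0 < a₁ * a₂) :
    affineDim (segment ℝ (skelPoint p q a₁ a₂) (chordEnd p q ρ a₁ a₂ R)) = 1 := by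
  have hne : skelPoint p q a₁ a₂ ≠ chordEnd p q ρ a₁ a₂ R := by
    intro h
    obtain ⟨x, hxs, hx⟩ := exists_chord_interior hpq h₀ hρ hR ha
    rw [← h, segment_same, mem_singleton_iff] at hxs
    exact skelPoint_notMem_interior hpq a₁ a₂ (hxs ▸ hx)
  rw [affineDim, ← convexHull_pair, ← direction_affineSpan, affineSpan_convexHull,
    direction_affineSpan, vectorSpan_pair_rev, finrank_span_singleton]
  exact vsub_ne_zero.2 hne.symm

/-- The hull lies in the hyperplane `x 3 = (p t)^q * x 2`. The curve points with parameters `1`,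
`-1`, `2` are linearly independent because `2^(p-1) ≠ 2`. -/
theorem affineDim_gamma (hp : 2 < p) (hpq : p.HolderConjugate q) (ht : 0 < t) :
    affineDim (convexHull ℝ (gammaCurve p q t)) = 3 := by
  have hκ : 0 < p * t := mul_pos hpq.pos ht
  rw [affineDim]
  set V := vectorSpan ℝ (convexHull ℝ (gammaCurve p q t)) with hV
  set f : (Fin 4 → ℝ) →ₗ[ℝ] ℝ := LinearMap.proj 3 - (p * t) ^ q • LinearMap.proj 2 with hf
  have hVf : V ≤ LinearMap.ker f := by
    rw [hV, vectorSpan, Submodule.span_le]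
    rintro _ ⟨x, hx, y, hy, rfl⟩
    have h1 := gamma_hull_coord hx
    have h2 := gamma_hull_coord hy
    simp [hf, h1, h2]
    ring
  have hle : Module.finrank ℝ V ≤ 3 := by
    refine (Submodule.finrank_mono hVf).trans ?_
    have hlt : Module.finrank ℝ (LinearMap.ker f) < Module.finrank ℝ (Fin 4 → ℝ) := by
      refine Submodule.finrank_lt fun h => ?_
      have : (Pi.single 3 1 : Fin 4 → ℝ) ∈ LinearMap.ker f := by rw [h]; trivial
      simp [hf] at this
    rw [Module.finrank_fin_fun] at hlt
    omega
  refine le_antisymm hle ?_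
  have hmem : ∀ u, skelPoint p q u (p * t * phiFun p u) - skelPoint p q 0 (p * t * phiFun p 0) ∈ V :=
    fun u => vsub_mem_vectorSpan ℝ (skelPoint_mem_gamma_hull hpq ht u)
      (skelPoint_mem_gamma_hull hpq ht 0)
  let w : Fin 3 → V := fun i => ⟨_, hmem (![1, -1, 2] i)⟩
  have hw : LinearIndependent ℝ w := by
    rw [Fintype.linearIndependent_iff]
    intro g hg
    have h := congrArg (fun z : V => (z : Fin 4 → ℝ)) hg
    simp only [Fin.sum_univ_three, w, Submodule.coe_add, Submodule.coe_smul,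
      Submodule.coe_zero] at h
    have e0 := congrFun h 0
    have e1 := congrFun h 1
    have e2 := congrFun h 2
    have h2p : (2 : ℝ) ^ p = 2 * 2 ^ (p - 1) := by
      rw [Real.rpow_sub_one two_ne_zero]; ring
    have hgt : (2 : ℝ) < 2 ^ (p - 1) := by
      nth_rewrite 1 [← Real.rpow_one 2]
      exact Real.rpow_lt_rpow_of_exponent_lt one_lt_two (by linarith)
    have hφ2 : phiFun p 2 = 2 ^ (p - 1) := phiFun_of_pos two_pos
    simp [skelPoint, phiFun_zero, phiFun_one, phiFun_neg, hφ2, Real.zero_rpow hpq.ne_zero]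
      at e0 e1 e2
    have e1' : g 0 - g 1 + g 2 * 2 ^ (p - 1) = 0 := by
      have : p * t * (g 0 - g 1 + g 2 * 2 ^ (p - 1)) = 0 := by linear_combination e1
      exact (mul_eq_zero.1 this).resolve_left hκ.ne'
    have g2 : g 2 = 0 := by
      have : g 2 * (2 ^ (p - 1) - 2) = 0 := by linear_combination e1' - e0
      exact (mul_eq_zero.1 this).resolve_right (by linarith)
    rw [g2] at e0 e2
    intro i
    fin_cases i
    · simp; linarith
    · simp; linarith
    · exact g2
  simpa using hw.fintype_card_le_finrank

/-- The ratio `x 3 / x 2 = (p t)^q` is constant on each hull off the origin and determines `t`. -/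
theorem injOn_gamma_hull (hpq : p.HolderConjugate q) :
    InjOn (fun t : ℝ => convexHull ℝ (gammaCurve p q t)) (Ioi 0) := by
  intro t ht s hs h
  have h1 := gamma_center_mem hpq ht
  simp only at h
  rw [h] at h1
  have h2 := gamma_hull_coord h1
  simp only [Matrix.cons_val, mul_one] at h2
  have h3 : p * t = p * s := Real.rpow_left_injOn hpq.symm.ne_zero
    (mul_pos hpq.pos ht).le (mul_pos hpq.pos hs).le h2
  exact mul_left_cancel₀ hpq.ne_zero h3

/-- On the hull `x 3 = (p t)^q * x 2`, so the Young majorant and the product of roots both reduce to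
`p * t * x 2`. -/
theorem bellmanC_gamma (hpq : p.HolderConjugate q) (hI : α < β) (ht : 0 < t)
    {x : Fin 4 → ℝ} (hx : x ∈ convexHull ℝ (gammaCurve p q t)) :
    bellmanC α β p q x = ((x 2 ^ (1 / p) * x 3 ^ (1 / q) : ℝ) : EReal) := by
  have hκ : 0 < p * t := mul_pos hpq.pos ht
  have hp := hpq.pos
  have hq := hpq.symm.pos
  have hm : IsMajorant p q 0 (youngCoeff p q t) := isMajorant_young hpq hκ
  have h3 := gamma_hull_coord hx
  have h2 : 0 ≤ x 2 :=
    (Real.rpow_nonneg (abs_nonneg _) _).trans (gamma_hull_subset hpq ht hx).1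
  rw [bellmanC_eq_of_mem_convexHull hpq hI hm (by rwa [contactSet_young hpq ht]),
    EReal.coe_eq_coe_iff]
  have e1 : x 2 ^ (1 / p) * x 3 ^ (1 / q) = p * t * x 2 := by
    rw [h3, Real.mul_rpow (by positivity) h2, ← Real.rpow_mul hκ.le, mul_one_div_cancel hq.ne',
      Real.rpow_one]
    have : x 2 ^ (1 / p) * x 2 ^ (1 / q) = x 2 := by
      rw [← Real.rpow_add_of_nonneg h2 (by positivity) (by positivity), one_div, one_div,
        hpq.inv_add_inv_eq_one, Real.rpow_one]
    linear_combination p * t * this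
  have e2 : (p * t) ^ (1 - q) * (p * t) ^ q = p * t := by
    rw [← Real.rpow_add hκ, sub_add_cancel, Real.rpow_one]
  have e3 : p⁻¹ + q⁻¹ = 1 := hpq.inv_add_inv_eq_one
  rw [e1, affVal, h3]
  simp only [youngCoeff, Matrix.cons_val, div_eq_mul_inv]
  linear_combination q⁻¹ * x 2 * e2 + p * t * x 2 * e3

/-- The interior points outside the hulls of the curves `γ_t` are the points of the open chords. -/
theorem interior_diff_gamma (hp : 2 < p) (hpq : p.HolderConjugate q)
    (h₀ : IsCriticalR p R₀) (hρ : IsRho p R₀ ρ) :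
    interior (omegaC p q) \ {x | ∃ t : ℝ, 0 < t ∧ x ∈ convexHull ℝ (gammaCurve p q t)} =
      {x | ∃ R ∈ Ioo (-1) R₀, ∃ a₁ a₂ : ℝ, 0 < a₁ * a₂ ∧
        x ∈ openSegment ℝ (skelPoint p q a₁ a₂) (chordEnd p q ρ a₁ a₂ R)} := by
  ext x
  constructor
  · rintro ⟨hx, hxg⟩
    obtain ⟨c, m, -, hxC, ⟨t, ht, e⟩ | ⟨R, hR, a₁, a₂, ha, e⟩⟩ :=
      exists_exposing_of_mem_interior hp hpq h₀ hρ hx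
    · exact absurd ⟨t, ht, e ▸ hxC⟩ hxg
    · exact ⟨R, hR, a₁, a₂, ha, mem_openSegment_of_mem_interior hpq hx (e ▸ hxC)⟩
  · rintro ⟨R, hR, a₁, a₂, ha, hxs⟩
    have hx := openSegment_chord_subset_interior hpq h₀ hρ hR ha hxs
    refine ⟨hx, ?_⟩
    rintro ⟨t, ht, hxt⟩
    have h1 := affineDim_chord hpq h₀ hρ hR ha
    have h3 := affineDim_gamma hp hpq ht
    -- A common point would lie in two linearity domains of different dimensions. The interval `[0,
    -- 1]` is an arbitrary choice, since the claim involves no interval.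
    have hu := (existsUnique_isLinearityDomain (α := 0) (β := 1) hp hpq one_pos h₀ hρ hx).unique
      ⟨(isInnerLinearityDomain_gamma hp hpq one_pos h₀ hρ ht).1, hxt⟩
      ⟨(isInnerLinearityDomain_chord hp hpq one_pos h₀ hρ hR ha).1,
        openSegment_subset_segment _ _ _ hxs⟩
    rw [hu, h1] at h3
    omega

theorem mul_mul_rpow_neg {r s w : ℝ} (hr : r ≠ 0) (hs : 0 < s) (hw : 0 < w) (N : ℝ) :
    s * N * (s ^ r * w) ^ (-(1 / r)) = N / w ^ (1 / r) := by
  rw [Real.rpow_neg (by positivity), Real.mul_rpow (by positivity) hw.le, ← Real.rpow_mul hs.le,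
    mul_one_div_cancel hr, Real.rpow_one]
  have : 0 < w ^ (1 / r) := by positivity
  field_simp

/-- The image of a point of a chord under `T`, up to the sign of the chord. -/
theorem mapT_chord_point (hpq : p.HolderConjugate q) {ε s₁ s₂ τ : ℝ} (hε : |ε| = 1)
    (hs₁ : 0 < s₁) (hs₂ : 0 < s₂) (hρR : 0 ≤ ρ R) (hτ : τ ∈ Ioo (0 : ℝ) 1) :
    mapT p q (τ • skelPoint p q (-(ε * s₁)) (-(ε * s₂)) +
      (1 - τ) • chordEnd p q ρ (-(ε * s₁)) (-(ε * s₂)) R) = ε • etaFun p q ρ τ R := by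
  have hτ1 : 0 < 1 - τ := by linarith [hτ.2]
  have hτ0 := hτ.1
  have w1 : 0 < τ + (1 - τ) * ρ R ^ p := by positivity
  have w2 : 0 < τ + (1 - τ) * |R| ^ p := by positivity
  have a1 : |-(ε * s₁)| = s₁ := by rw [abs_neg, abs_mul, hε, one_mul, abs_of_pos hs₁]
  have a2 : |-(ε * s₂)| = s₂ := by rw [abs_neg, abs_mul, hε, one_mul, abs_of_pos hs₂]
  have b1 : |ρ R * -(ε * s₁)| ^ p = ρ R ^ p * s₁ ^ p := by
    rw [abs_mul, a1, abs_of_nonneg hρR, Real.mul_rpow hρR hs₁.le]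
  have m1 := mul_mul_rpow_neg hpq.ne_zero hs₁ w1 (ε * (-τ + (1 - τ) * ρ R))
  have m2 := mul_mul_rpow_neg hpq.symm.ne_zero hs₂ w2 (ε * (-τ + (1 - τ) * phiFun p R))
  ext
  · simp only [mapT, etaFun, skelPoint, chordEnd, Pi.add_apply, Pi.smul_apply, smul_eq_mul,
      Matrix.cons_val, a1, b1, Prod.smul_fst]
    rw [← mul_div_assoc, ← m1]
    congr 1
    · ring
    · congr 1; ring
  · simp only [mapT, etaFun, skelPoint, chordEnd, Pi.add_apply, Pi.smul_apply, smul_eq_mul,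
      Matrix.cons_val, a2, Prod.smul_snd]
    rw [← mul_div_assoc, ← m2]
    congr 1
    · ring
    · congr 1; ring

theorem openSegment_eq_image_one_sub {E : Type*} [AddCommGroup E] [Module ℝ E] (x y : E) :
    openSegment ℝ x y = (fun τ : ℝ => τ • x + (1 - τ) • y) '' Ioo 0 1 := by
  rw [openSegment_symm, openSegment_eq_image]
  simp only [add_comm]

theorem mapT_image_chord (hpq : p.HolderConjugate q) {ε s₁ s₂ : ℝ} (hε : |ε| = 1)
    (hs₁ : 0 < s₁) (hs₂ : 0 < s₂) (hρR : 0 ≤ ρ R) :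
    mapT p q '' openSegment ℝ (skelPoint p q (-(ε * s₁)) (-(ε * s₂)))
      (chordEnd p q ρ (-(ε * s₁)) (-(ε * s₂)) R) =
      (fun τ => ε • etaFun p q ρ τ R) '' Ioo 0 1 := by
  rw [openSegment_eq_image_one_sub, image_image]
  exact image_congr fun τ hτ => mapT_chord_point hpq hε hs₁ hs₂ hρR hτ

end Geometry

theorem mainTheorem6 (p q : ℝ) (hp : 2 < p) (hpq : p.HolderConjugate q)
    (α β : ℝ) (hI : α < β) :
    (∃! R₀ : ℝ, IsCriticalR p R₀) ∧
    ∀ R₀ : ℝ, IsCriticalR p R₀ →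
      (∃ ρ : ℝ → ℝ, IsRho p R₀ ρ) ∧
      ∀ ρ : ℝ → ℝ, IsRho p R₀ ρ →
        -- the interior is foliated by linearity domains of dimensions one and three
        (∀ x ∈ interior (omegaC p q), ∃! C : Set (Fin 4 → ℝ),
          IsLinearityDomain (omegaC p q) (bellmanC α β p q) C ∧ x ∈ C) ∧
        (∀ C, IsInnerLinearityDomain α β p q C → affineDim C = 1 ∨ affineDim C = 3) ∧
        -- the three-dimensional linearity domains
        (∀ C, (IsInnerLinearityDomain α β p q C ∧ affineDim C = 3) ↔
          ∃ t : ℝ, 0 < t ∧ C = convexHull ℝ (gammaCurve p q t)) ∧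
        InjOn (fun t : ℝ => convexHull ℝ (gammaCurve p q t)) (Ioi 0) ∧
        (∀ t : ℝ, 0 < t →
          (∀ x ∈ convexHull ℝ (gammaCurve p q t),
            bellmanC α β p q x = ((x 2 ^ (1 / p) * x 3 ^ (1 / q) : ℝ) : EReal)) ∧
          mapT p q '' (convexHull ℝ (gammaCurve p q t) ∩ domT p q) =
            regionBoundedBy (etaLoop p q R₀ ρ)) ∧
        -- the one-dimensional linearity domains
        (∀ C, (IsInnerLinearityDomain α β p q C ∧ affineDim C = 1) ↔
          ∃ R ∈ Ioo (-1) R₀, ∃ a₁ a₂ : ℝ, 0 < a₁ * a₂ ∧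
            C = segment ℝ (skelPoint p q a₁ a₂) (chordEnd p q ρ a₁ a₂ R)) ∧
        (interior (omegaC p q) \ {x | ∃ t : ℝ, 0 < t ∧ x ∈ convexHull ℝ (gammaCurve p q t)} =
          {x | ∃ R ∈ Ioo (-1) R₀, ∃ a₁ a₂ : ℝ, 0 < a₁ * a₂ ∧
            x ∈ openSegment ℝ (skelPoint p q a₁ a₂) (chordEnd p q ρ a₁ a₂ R)}) ∧
        (∀ R ∈ Ioo (-1) R₀, ∀ a₁ a₂ : ℝ,
          (a₁ < 0 → a₂ < 0 →
            mapT p q '' openSegment ℝ (skelPoint p q a₁ a₂) (chordEnd p q ρ a₁ a₂ R) =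
              (fun τ => etaFun p q ρ τ R) '' Ioo 0 1) ∧
          (0 < a₁ → 0 < a₂ →
            mapT p q '' openSegment ℝ (skelPoint p q a₁ a₂) (chordEnd p q ρ a₁ a₂ R) =
              (fun τ => -etaFun p q ρ τ R) '' Ioo 0 1)) := by
  refine ⟨existsUnique_isCriticalR hp, fun R₀ h₀ => ⟨exists_isRho hp h₀, fun ρ hρ => ?_⟩⟩
  refine ⟨fun x hx => existsUnique_isLinearityDomain hp hpq hI h₀ hρ hx, fun C hC => ?_,
    fun C => ⟨?_, ?_⟩, injOn_gamma_hull hpq, fun t ht => ⟨fun x hx => bellmanC_gamma hpq hI ht hx, ?_⟩,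
    fun C => ⟨?_, ?_⟩, interior_diff_gamma hp hpq h₀ hρ, fun R hR a₁ a₂ => ?_⟩
  · rcases hC.cases hp hpq hI h₀ hρ with ⟨t, ht, rfl⟩ | ⟨R, hR, a₁, a₂, ha, rfl⟩
    · exact Or.inr (affineDim_gamma hp hpq ht)
    · exact Or.inl (affineDim_chord hpq h₀ hρ hR ha)
  · rintro ⟨hC, h3⟩
    rcases hC.cases hp hpq hI h₀ hρ with ⟨t, ht, rfl⟩ | ⟨R, hR, a₁, a₂, ha, rfl⟩
    · exact ⟨t, ht, rfl⟩
    · rw [affineDim_chord hpq h₀ hρ hR ha] at h3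
      omega
  · rintro ⟨t, ht, rfl⟩
    exact ⟨isInnerLinearityDomain_gamma hp hpq hI h₀ hρ ht, affineDim_gamma hp hpq ht⟩
  · rw [mapT_image_hull hpq ht]
    exact hullSlice_eq_region hp hpq h₀ ht (hρ.2.2 R₀ ⟨le_rfl, h₀.1.2.le⟩)
  · rintro ⟨hC, h1⟩
    rcases hC.cases hp hpq hI h₀ hρ with ⟨t, ht, rfl⟩ | h
    · rw [affineDim_gamma hp hpq ht] at h1
      omega
    · exact h
  · rintro ⟨R, hR, a₁, a₂, ha, rfl⟩
    exact ⟨isInnerLinearityDomain_chord hp hpq hI h₀ hρ hR ha,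
      affineDim_chord hpq h₀ hρ hR ha⟩
  · have hρR : 0 ≤ ρ R := h₀.1.1.le.trans (hρ.1 R ⟨hR.1.le, (hR.2.trans h₀.1.2).le⟩).1
    constructor
    · intro h1 h2
      simpa using mapT_image_chord (p := p) (q := q) hpq (ε := 1) (by simp) (neg_pos.2 h1)
        (neg_pos.2 h2) hρR
    · intro h1 h2
      simpa using mapT_image_chord (p := p) (q := q) hpq (ε := -1) (by simp) h1 h2 hρR
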